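/- **Setting.** Let $\sigma_b\ge 0$, $\sigma_w>0$, $d\ge 2$, and let $\phi$ be ReLU or Tanh. For a kernel $Q$ put $\hat q[Q](x,x')=\sigma_b^2+\sigma_w^2\,\mathbb E[\phi(y(x))\phi(y(x'))]$ and $\dot q[Q](x,x')=\sigma_w^2\,\mathbb E[\phi'(y(x))\phi'(y(x'))]$, where $(y(x),y(x'))$ is a centred Gaussian vector with covariance given by $Q$. *Feedforward network (FFNN).* On $\mathbb R^d$ let $q^1(x,x')=K^1(x,x')=\sigma_b^2+\frac{\sigma_w^2}{d}\,x\cdot x'$ and, for $l\ge2$, $q^l=\hat q[q^{l-1}]$ and $K^l=\dot q[q^{l-1}]\,K^{l-1}+\hat q[q^{l-1}]$ (the infinite-width NTK). *ResNet with ReLU.* $q^1_{res}=K^1_{res}=q^1$ and, for $l\ge 2$, $q^l_{res}=q^{l-1}_{res}+\hat q[q_{res}^{l-1}]$ and $K^l_{res}=K^{l-1}_{res}(\dot q[q_{res}^{l-1}]+1)+\hat q[q_{res}^{l-1}]$. *Phases.* $(\sigma_b,\sigma_w)$ is in the ordered phase, in the chaotic phase, or on the edge of chaos (EOC) if, for every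 first-layer variance $v>0$, the variances of the successive layers of the FFNN converge to some $q>0$ and $\sigma_w^2\,\mathbb E[\phi'(\sqrt q Z)^2]$, $Z\sim\mathcal N(0,1)$, is $<1$, $>1$, or $=1$ respectively. *Kernels.* Let $\kappa^L$ be one of: (a) $K^L$, with $(\sigma_b,\sigma_w)$ in the ordered or the chaotic phase; (b) the average NTK $K^L/L$, with $(\sigma_b,\sigma_w)$ on the EOC; (c) the normalized ResNet NTK $K^L_{res}/\alpha_L$ with $\alpha_L=L(1+\sigma_w^2/2)^{L-1}$ (any $\sigma_b\ge0$, $\sigma_w>0$). *Spherical harmonics.* Let $\nu$ be the uniform probability measure on $\mathbb S^{d-1}$, and let $(Y_{k,j})_{1\le j\le N(d,k)}$ be an orthonormal basis in $L^2(\nu)$ of the space of spherical harmonics of degree $k$, that is, of the restrictions to $\mathbb S^{d-1}$ of the harmonic homogeneous polynomials of degree $k$; such bases exist. Let $\Omega_s=2\pi^{s/2}/\Gamma(s/2)$, and let $P^d_k(t)=\left(-\tfrac12\right)^k\frac{\Gamma(\frac{d-1}2)}{\Gamma(k+\frac{d-1}2)}(1-t^2)^{\frac{3-d}2}\left(\frac{d}{dt}\right)^k(1-t^2)^{k+\frac{d-3}2}$.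 **Theorem.** For every $L\ge1$ there are a continuous function $g^L$ on $[-1,1]$ and numbers $(\mu^L_k)_{k\ge0}$ such that $$\mu^L_k=\frac{\Omega_{d-1}}{\Omega_d}\int_{-1}^1 g^L(t)P^d_k(t)(1-t^2)^{\frac{d-3}2}\,dt\qquad(k\ge 0),$$ and for all $x,x'\in\mathbb S^{d-1}$: $\kappa^L(x,x')=g^L(x\cdot x')$; $\int \kappa^L(x,w)Y(w)\,d\nu(w)=\mu^L_kY(x)$ for every spherical harmonic $Y$ of degree $k$; and $$\kappa^L(x,x')=\sum_{k\ge0}\mu^L_k\sum_{j=1}^{N(d,k)}Y_{k,j}(x)Y_{k,j}(x').$$ Moreover (assuming in addition, if $\kappa^L$ is the NTK of kind (a) in the chaotic phase, that $\sigma_b>0$ and $d\ge4$), $\lim_{L\to\infty}\mu^L_0$ exists and lies in $(0,\infty)$, and $\lim_{L\to\infty}\mu^L_k=0$ for every $k\ge1$. **Convolutional layers.** The same holds, with the same $g^L$ and $\mu^L_k$, for convolutional layers. Let $n_0M=d$, with inputs $x=(x_{j,\alpha})$ having $n_0$ channels and $M$ locations $\alpha\in\mathbb Z/M$ (periodic boundary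 conditions), and filter $\{-r,\dots,r\}$. Put $q^1_{\alpha,\alpha'}(x,x')=\sigma_b^2+\frac{\sigma_w^2}{n_0(2r+1)}\sum_j\sum_{|\beta|\le r}x_{j,\alpha+\beta}x'_{j,\alpha'+\beta}$ and $K^1_{\alpha,\alpha'}=q^1_{\alpha,\alpha'}$. For $l\ge2$ define $q^l_{\alpha,\alpha'}$ and $K^l_{\alpha,\alpha'}$ by replacing $\hat q$ and $\dot q\,K^{l-1}+\hat q$ in the recursions above (for the ResNet: the terms added to $q_{res}^{l-1}$ and to $K_{res}^{l-1}$) by their averages over the filter, $\frac1{2r+1}\sum_{|\beta|\le r}(\cdot)_{\alpha+\beta,\alpha'+\beta}$; define $\kappa^L_{\alpha,\alpha'}$ from these as in (a)–(c). Let $S$ be a set of inputs such that for all $x,x'\in S$ the value $q^1_{\alpha,\alpha'}(x,x')$ does not depend on $\alpha,\alpha'$. Then for all unit vectors $x,x'\in S$, all $\alpha,\alpha'$ and all $L\ge1$, $\kappa^L_{\alpha,\alpha'}(x,x')=g^L(x\cdot x')=\sum_{k\ge0}\mu^L_k\sum_{j}Y_{k,j}(x)Y_{k,j}(x')$. -/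

import Mathlib

open MeasureTheory ProbabilityTheory Filter Topology

noncomputable section

namespace DeepNTK

/-! ### Activation functions and Gaussian expectations -/

/-- The two activation functions. -/
inductive Activation where
  | relu
  | tanh

/-- The activation function `φ`. -/
def Activation.fn : Activation → ℝ → ℝ
  | .relu => fun x => max x 0
  | .tanh => fun x => Real.tanh x

/-- The derivative `φ'` (for ReLU, the indicator function of the positive half-line). -/
def Activation.dfn : Activation → ℝ → ℝ
  | .relu => fun x => if 0 < x then 1 else 0
  | .tanh => fun x => 1 - Real.tanh x ^ 2

/-- `𝔼[F(U) F(V)]` for a centred Gaussian pair `(U, V)` with `Var U = a`, `Cov(U, V) = c`,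
`Var V = b`, realised as `U = √a Z₁`, `V = √b (ρ Z₁ + √(1 - ρ²) Z₂)` where `ρ = c / (√a √b)` and
`Z₁, Z₂` are independent standard normal variables. -/
def gaussPair (F : ℝ → ℝ) (a c b : ℝ) : ℝ :=
  ∫ z : ℝ × ℝ,
    F (√a * z.1) *
      F (√b * (c / (√a * √b) * z.1 + √(1 - (c / (√a * √b)) ^ 2) * z.2))
    ∂((gaussianReal 0 1).prod (gaussianReal 0 1))

/-! ### One step of the covariance propagation

`Q` is the covariance kernel of the preactivations of the previous layer, on an arbitrary index set
(inputs for dense layers, pairs of an input and a location for convolutional layers). -/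

/-- `q̂(x, x') = σ_b² + σ_w² 𝔼[φ(y(x)) φ(y(x'))]` with `y` centred Gaussian of covariance `Q`. -/
def hatCov {X : Type*} (φ : Activation) (σb σw : ℝ) (Q : X → X → ℝ) (x x' : X) : ℝ :=
  σb ^ 2 + σw ^ 2 * gaussPair φ.fn (Q x x) (Q x x') (Q x' x')

/-- `q̇(x, x') = σ_w² 𝔼[φ'(y(x)) φ'(y(x'))]` with `y` centred Gaussian of covariance `Q`. -/
def dotCov {X : Type*} (φ : Activation) (σw : ℝ) (Q : X → X → ℝ) (x x' : X) : ℝ :=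
  σw ^ 2 * gaussPair φ.dfn (Q x x) (Q x x') (Q x' x')

/-! ### Fully connected architectures, inputs in `ℝ^d`

Layers are numbered from `1`; the value at layer `0` is a placeholder. -/

/-- Covariance `q^l` of the infinitely wide fully connected network. -/
def ffnnCov (d : ℕ) (φ : Activation) (σb σw : ℝ) :
    ℕ → EuclideanSpace ℝ (Fin d) → EuclideanSpace ℝ (Fin d) → ℝ
  | 0 => fun _ _ => 0
  | 1 => fun x x' => σb ^ 2 + σw ^ 2 / d * inner ℝ x x'
  | l + 2 => hatCov φ σb σw (ffnnCov d φ σb σw (l + 1))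

/-- Neural tangent kernel `K^L` of the infinitely wide fully connected network. -/
def ffnnNTK (d : ℕ) (φ : Activation) (σb σw : ℝ) :
    ℕ → EuclideanSpace ℝ (Fin d) → EuclideanSpace ℝ (Fin d) → ℝ
  | 0 => fun _ _ => 0
  | 1 => ffnnCov d φ σb σw 1
  | l + 2 => fun x x' =>
      dotCov φ σw (ffnnCov d φ σb σw (l + 1)) x x' * ffnnNTK d φ σb σw (l + 1) x x' +
        hatCov φ σb σw (ffnnCov d φ σb σw (l + 1)) x x'

/-- Covariance of the infinitely wide ReLU ResNet `y^l = y^{l-1} + F(w^l, y^{l-1})` with fully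
connected blocks. -/
def resCov (d : ℕ) (σb σw : ℝ) :
    ℕ → EuclideanSpace ℝ (Fin d) → EuclideanSpace ℝ (Fin d) → ℝ
  | 0 => fun _ _ => 0
  | 1 => fun x x' => σb ^ 2 + σw ^ 2 / d * inner ℝ x x'
  | l + 2 => fun x x' =>
      resCov d σb σw (l + 1) x x' + hatCov .relu σb σw (resCov d σb σw (l + 1)) x x'

/-- Neural tangent kernel of the infinitely wide ReLU ResNet with fully connected blocks. -/
def resNTK (d : ℕ) (σb σw : ℝ) :
    ℕ → EuclideanSpace ℝ (Fin d) → EuclideanSpace ℝ (Fin d) → ℝ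
  | 0 => fun _ _ => 0
  | 1 => resCov d σb σw 1
  | l + 2 => fun x x' =>
      resNTK d σb σw (l + 1) x x' * (dotCov .relu σw (resCov d σb σw (l + 1)) x x' + 1) +
        hatCov .relu σb σw (resCov d σb σw (l + 1)) x x'

/-! ### Convolutional architectures

Inputs have `n₀` channels and `M` locations with periodic boundary conditions; the filter is
`{-k, …, k}`. Kernels are functions of pairs (input, location). -/

/-- Inputs with `n₀` channels and `M` periodic locations; this is `ℝ^d` with `d = n₀ M`. -/
abbrev ConvInput (n₀ M : ℕ) : Type := EuclideanSpace ℝ (Fin n₀ × ZMod M)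

/-- Average of a kernel over simultaneous shifts by the elements of the filter `{-k, …, k}`. -/
def filterAvg {n₀ M : ℕ} (k : ℕ) (G : ConvInput n₀ M × ZMod M → ConvInput n₀ M × ZMod M → ℝ)
    (p p' : ConvInput n₀ M × ZMod M) : ℝ :=
  1 / (2 * (k : ℝ) + 1) *
    ∑ β ∈ Finset.Icc (-(k : ℤ)) k, G (p.1, p.2 + (β : ZMod M)) (p'.1, p'.2 + (β : ZMod M))

/-- `[x, x']_{α, α'} = ∑_j ∑_β x_{j, α + β} x'_{j, α' + β}`. -/
def convBracket {n₀ M : ℕ} (k : ℕ) (p p' : ConvInput n₀ M × ZMod M) : ℝ :=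
  ∑ j : Fin n₀, ∑ β ∈ Finset.Icc (-(k : ℤ)) k,
    p.1 (j, p.2 + (β : ZMod M)) * p'.1 (j, p'.2 + (β : ZMod M))

/-- First layer covariance `q^1_{α, α'}(x, x')`. -/
def convCovOne (n₀ M k : ℕ) (σb σw : ℝ) (p p' : ConvInput n₀ M × ZMod M) : ℝ :=
  σb ^ 2 + σw ^ 2 / (n₀ * (2 * (k : ℝ) + 1)) * convBracket k p p'

/-- Covariance `q^l_{α, α'}(x, x')` of the convolutional network with infinitely many channels. -/
def cnnCov (n₀ M k : ℕ) (φ : Activation) (σb σw : ℝ) :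
    ℕ → ConvInput n₀ M × ZMod M → ConvInput n₀ M × ZMod M → ℝ
  | 0 => fun _ _ => 0
  | 1 => convCovOne n₀ M k σb σw
  | l + 2 => filterAvg k (hatCov φ σb σw (cnnCov n₀ M k φ σb σw (l + 1)))

/-- Neural tangent kernel `K^L_{α, α'}(x, x')` of the convolutional network. -/
def cnnNTK (n₀ M k : ℕ) (φ : Activation) (σb σw : ℝ) :
    ℕ → ConvInput n₀ M × ZMod M → ConvInput n₀ M × ZMod M → ℝ
  | 0 => fun _ _ => 0
  | 1 => convCovOne n₀ M k σb σw
  | l + 2 => filterAvg k fun p p' =>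
      dotCov φ σw (cnnCov n₀ M k φ σb σw (l + 1)) p p' * cnnNTK n₀ M k φ σb σw (l + 1) p p' +
        hatCov φ σb σw (cnnCov n₀ M k φ σb σw (l + 1)) p p'

/-- Covariance of the ReLU ResNet with convolutional blocks. -/
def convResCov (n₀ M k : ℕ) (σb σw : ℝ) :
    ℕ → ConvInput n₀ M × ZMod M → ConvInput n₀ M × ZMod M → ℝ
  | 0 => fun _ _ => 0
  | 1 => convCovOne n₀ M k σb σw
  | l + 2 => fun p p' =>
      convResCov n₀ M k σb σw (l + 1) p p' +
        filterAvg k (hatCov .relu σb σw (convResCov n₀ M k σb σw (l + 1))) p p'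

/-- Neural tangent kernel of the ReLU ResNet with convolutional blocks. -/
def convResNTK (n₀ M k : ℕ) (σb σw : ℝ) :
    ℕ → ConvInput n₀ M × ZMod M → ConvInput n₀ M × ZMod M → ℝ
  | 0 => fun _ _ => 0
  | 1 => convCovOne n₀ M k σb σw
  | l + 2 => fun p p' =>
      convResNTK n₀ M k σb σw (l + 1) p p' +
        filterAvg k (fun r r' =>
          dotCov .relu σw (convResCov n₀ M k σb σw (l + 1)) r r' *
              convResNTK n₀ M k σb σw (l + 1) r r' +
            hatCov .relu σb σw (convResCov n₀ M k σb σw (l + 1)) r r') p p'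

/-- On the data set `S`, the first layer covariance does not depend on the locations. -/
def LocationFree (n₀ M k : ℕ) (σb σw : ℝ) (S : Set (ConvInput n₀ M)) : Prop :=
  ∀ x ∈ S, ∀ x' ∈ S, ∀ α α' γ γ' : ZMod M,
    convCovOne n₀ M k σb σw (x, α) (x', α') = convCovOne n₀ M k σb σw (x, γ) (x', γ')

/-! ### Ordered phase, chaotic phase, edge of chaos -/

/-- The variance map: `q^{l+1}(x, x) = varianceMap (q^l(x, x))` in a fully connected network. -/
def varianceMap (φ : Activation) (σb σw v : ℝ) : ℝ :=
  σb ^ 2 + σw ^ 2 * ∫ z, φ.fn (√v * z) ^ 2 ∂(gaussianReal 0 1)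

/-- The variances of the layers converge to `q > 0` when the first layer has variance `v`. -/
def IsLimitVariance (φ : Activation) (σb σw v q : ℝ) : Prop :=
  0 < q ∧ Tendsto (fun l : ℕ => (varianceMap φ σb σw)^[l] v) atTop (𝓝 q)

/-- `χ(q) = σ_w² 𝔼[φ'(√q Z)²]`, with `Z` standard normal. -/
def chi (φ : Activation) (σw q : ℝ) : ℝ :=
  σw ^ 2 * ∫ z, φ.dfn (√q * z) ^ 2 ∂(gaussianReal 0 1)

/-- `(σ_b, σ_w)` is in the ordered phase. -/
def Ordered (φ : Activation) (σb σw : ℝ) : Prop :=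
  ∀ v : ℝ, 0 < v → ∃ q, IsLimitVariance φ σb σw v q ∧ chi φ σw q < 1

/-- `(σ_b, σ_w)` is in the chaotic phase. -/
def Chaotic (φ : Activation) (σb σw : ℝ) : Prop :=
  ∀ v : ℝ, 0 < v → ∃ q, IsLimitVariance φ σb σw v q ∧ 1 < chi φ σw q

/-- `(σ_b, σ_w)` is on the edge of chaos. -/
def EdgeOfChaos (φ : Activation) (σb σw : ℝ) : Prop :=
  ∀ v : ℝ, 0 < v → ∃ q, IsLimitVariance φ σb σw v q ∧ chi φ σw q = 1

/-! ### The kernels `κ^L` -/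

/-- The three kinds of kernels. -/
inductive Model where
  /-- the NTK of a feedforward network, in the ordered or chaotic phase -/
  | plain (φ : Activation)
  /-- the average NTK of a feedforward network, on the edge of chaos -/
  | average (φ : Activation)
  /-- the normalized NTK of a ReLU ResNet -/
  | resnet

/-- The parameters `(σ_b, σ_w)` for which a kernel is considered. -/
def Model.Admissible (σb σw : ℝ) : Model → Prop
  | .plain φ => Ordered φ σb σw ∨ Chaotic φ σb σw
  | .average φ => EdgeOfChaos φ σb σw
  | .resnet => True

/-- `κ^L` for fully connected layers. -/
def Model.kernel (d : ℕ) (σb σw : ℝ) (L : ℕ) (x x' : EuclideanSpace ℝ (Fin d)) : Model → ℝ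
  | .plain φ => ffnnNTK d φ σb σw L x x'
  | .average φ => ffnnNTK d φ σb σw L x x' / L
  | .resnet => resNTK d σb σw L x x' / (L * (1 + σw ^ 2 / 2) ^ (L - 1))

/-- `κ^L_{α, α'}` for convolutional layers. -/
def Model.convKernel (n₀ M k : ℕ) (σb σw : ℝ) (L : ℕ)
    (p p' : ConvInput n₀ M × ZMod M) : Model → ℝ
  | .plain φ => cnnNTK n₀ M k φ σb σw L p p'
  | .average φ => cnnNTK n₀ M k φ σb σw L p p' / L
  | .resnet => convResNTK n₀ M k σb σw L p p' / (L * (1 + σw ^ 2 / 2) ^ (L - 1))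

/-! ### Spherical harmonics -/

section Harmonics

variable (ι : Type) [Fintype ι]

/-- The unit sphere of `ℝ^ι`. -/
abbrev USphere : Type := Metric.sphere (0 : EuclideanSpace ℝ ι) 1

/-- The uniform probability measure on the unit sphere. -/
def uniformSphere : Measure (USphere ι) :=
  ((volume : Measure (EuclideanSpace ℝ ι)).toSphere Set.univ)⁻¹ •
    (volume : Measure (EuclideanSpace ℝ ι)).toSphere

/-- The Laplacian on polynomials. -/
def polyLaplacian : MvPolynomial ι ℝ →ₗ[ℝ] MvPolynomial ι ℝ :=
  ∑ i : ι, (MvPolynomial.pderiv i).toLinearMap ∘ₗ (MvPolynomial.pderiv i).toLinearMap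

/-- Restriction of a polynomial function to the unit sphere. -/
def restrictToSphere : MvPolynomial ι ℝ →ₗ[ℝ] (USphere ι → ℝ) where
  toFun p := fun x => MvPolynomial.eval (fun i => (x : EuclideanSpace ℝ ι) i) p
  map_add' p q := by ext x; simp
  map_smul' c p := by ext x; simp [MvPolynomial.smul_eval]

/-- Spherical harmonics of degree `k`: restrictions to the sphere of the harmonic homogeneous
polynomials of degree `k`. -/
def sphericalHarmonics (k : ℕ) : Submodule ℝ (USphere ι → ℝ) :=
  (MvPolynomial.homogeneousSubmodule ι ℝ k ⊓ LinearMap.ker (polyLaplacian ι)).map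
    (restrictToSphere ι)

/-- The number `N(d, k)` of (linearly independent) spherical harmonics of degree `k`. -/
def numHarmonics (k : ℕ) : ℕ := Module.finrank ℝ (sphericalHarmonics ι k)

/-- `(Y_{k, j})_j`, `j = 1, …, N(d, k)`, is for every `k` an orthonormal basis of the space of
spherical harmonics of degree `k`, with respect to the uniform probability measure. -/
structure IsHarmonicBasis (Y : (k : ℕ) → Fin (numHarmonics ι k) → USphere ι → ℝ) : Prop where
  mem : ∀ k j, Y k j ∈ sphericalHarmonics ι k
  orthonormal : ∀ k i j,
    ∫ x, Y k i x * Y k j x ∂(uniformSphere ι) = if i = j then 1 else 0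

end Harmonics

/-! ### The Funk–Hecke formula -/

/-- `Ω_s = 2 π^{s/2} / Γ(s/2)`; for a positive integer `d`, the surface area of the unit sphere of
`ℝ^d`. -/
def sphereArea (s : ℝ) : ℝ := 2 * Real.pi ^ (s / 2) / Real.Gamma (s / 2)

/-- The Legendre polynomial `P^d_k` in dimension `d`, through Rodrigues' formula, on `(-1, 1)`. -/
def legendreP (d k : ℕ) (t : ℝ) : ℝ :=
  (-1 / 2) ^ k * (Real.Gamma (((d : ℝ) - 1) / 2) / Real.Gamma ((k : ℝ) + ((d : ℝ) - 1) / 2)) *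
    (1 - t ^ 2) ^ ((3 - (d : ℝ)) / 2) *
      iteratedDeriv k (fun s : ℝ => (1 - s ^ 2) ^ ((k : ℝ) + ((d : ℝ) - 3) / 2)) t

/-- The Funk–Hecke eigenvalue
`Ω_{d-1} / Ω_d * ∫_{-1}^{1} g(t) P^d_k(t) (1 - t²)^{(d-3)/2} dt`. -/
def funkHecke (d : ℕ) (g : ℝ → ℝ) (k : ℕ) : ℝ :=
  sphereArea ((d : ℝ) - 1) / sphereArea d *
    ∫ t in (-1 : ℝ)..1, g t * legendreP d k t * (1 - t ^ 2) ^ (((d : ℝ) - 3) / 2)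

end DeepNTK

end

noncomputable section

namespace DeepNTK

/-! ### Power series with nonnegative summable coefficients -/

/-- On `[-1, 1]`, the function `g` is the sum of a power series with nonnegative summable
coefficients. -/
def NonnegSeries (g : ℝ → ℝ) : Prop :=
  ∃ b : ℕ → ℝ, (∀ n, 0 ≤ b n) ∧ Summable b ∧
    ∀ t ∈ Set.Icc (-1 : ℝ) 1, HasSum (fun n => b n * t ^ n) (g t)

lemma abs_pow_le_one_of_mem {t : ℝ} (ht : t ∈ Set.Icc (-1 : ℝ) 1) (n : ℕ) : |t ^ n| ≤ 1 := by
  rw [abs_pow]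
  exact pow_le_one₀ (abs_nonneg t) (abs_le.2 ht)

lemma summable_mul_pow {b : ℕ → ℝ} (hb : ∀ n, 0 ≤ b n) (hs : Summable b) {t : ℝ}
    (ht : t ∈ Set.Icc (-1 : ℝ) 1) : Summable fun n => b n * t ^ n := by
  refine Summable.of_norm_bounded hs fun n => ?_
  rw [norm_mul, Real.norm_eq_abs, Real.norm_eq_abs, abs_of_nonneg (hb n)]
  exact mul_le_of_le_one_right (hb n) (abs_pow_le_one_of_mem ht n)

lemma one_mem_Icc : (1 : ℝ) ∈ Set.Icc (-1 : ℝ) 1 := ⟨by norm_num, le_rfl⟩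

namespace NonnegSeries

variable {g h : ℝ → ℝ}

lemma congr (hg : NonnegSeries g) (hgh : ∀ t ∈ Set.Icc (-1 : ℝ) 1, h t = g t) :
    NonnegSeries h := by
  obtain ⟨b, hb, hs, H⟩ := hg
  exact ⟨b, hb, hs, fun t ht => by rw [hgh t ht]; exact H t ht⟩

lemma const {a : ℝ} (ha : 0 ≤ a) : NonnegSeries fun _ => a := by
  refine ⟨fun n => if n = 0 then a else 0, fun n => by dsimp only; split_ifs <;> simp [ha],
    (hasSum_ite_eq 0 a).summable, fun t _ => ?_⟩
  convert hasSum_ite_eq 0 a using 2 with n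
  split_ifs with hn <;> simp [hn]

lemma ident : NonnegSeries fun t => t := by
  refine ⟨fun n => if n = 1 then 1 else 0, fun n => by dsimp only; split_ifs <;> simp,
    (hasSum_ite_eq 1 (1 : ℝ)).summable, fun t _ => ?_⟩
  convert hasSum_ite_eq 1 t using 2 with n
  split_ifs with hn <;> simp [hn]

lemma add (hg : NonnegSeries g) (hh : NonnegSeries h) : NonnegSeries fun t => g t + h t := by
  obtain ⟨b, hb, hs, H⟩ := hg
  obtain ⟨b', hb', hs', H'⟩ := hh
  refine ⟨fun n => b n + b' n, fun n => add_nonneg (hb n) (hb' n), hs.add hs', fun t ht => ?_⟩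
  simpa only [add_mul] using (H t ht).add (H' t ht)

lemma const_mul (hg : NonnegSeries g) {a : ℝ} (ha : 0 ≤ a) : NonnegSeries fun t => a * g t := by
  obtain ⟨b, hb, hs, H⟩ := hg
  refine ⟨fun n => a * b n, fun n => mul_nonneg ha (hb n), hs.mul_left a, fun t ht => ?_⟩
  simpa only [mul_assoc] using (H t ht).mul_left a

lemma div_const (hg : NonnegSeries g) {a : ℝ} (ha : 0 ≤ a) : NonnegSeries fun t => g t / a :=
  (hg.const_mul (inv_nonneg.2 ha)).congr fun t _ => by rw [div_eq_inv_mul]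

lemma mul (hg : NonnegSeries g) (hh : NonnegSeries h) : NonnegSeries fun t => g t * h t := by
  obtain ⟨b, hb, hs, H⟩ := hg
  obtain ⟨b', hb', hs', H'⟩ := hh
  have key : ∀ t ∈ Set.Icc (-1 : ℝ) 1,
      HasSum (fun n => ∑ kl ∈ Finset.HasAntidiagonal.antidiagonal n, (b kl.1 * t ^ kl.1) * (b' kl.2 * t ^ kl.2))
        (g t * h t) := fun t ht => by
    have h1 := (summable_mul_pow hb hs ht).norm
    have h2 := (summable_mul_pow hb' hs' ht).norm
    have h3 := summable_norm_sum_mul_antidiagonal_of_summable_norm h1 h2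
    rw [← (H t ht).tsum_eq, ← (H' t ht).tsum_eq,
      tsum_mul_tsum_eq_tsum_sum_antidiagonal_of_summable_norm h1 h2]
    exact h3.of_norm.hasSum
  have e : ∀ (t : ℝ) (n : ℕ),
      ∑ kl ∈ Finset.HasAntidiagonal.antidiagonal n, (b kl.1 * t ^ kl.1) * (b' kl.2 * t ^ kl.2) =
        (∑ kl ∈ Finset.HasAntidiagonal.antidiagonal n, b kl.1 * b' kl.2) * t ^ n := fun t n => by
    rw [Finset.sum_mul]
    refine Finset.sum_congr rfl fun kl hkl => ?_
    rw [← Finset.HasAntidiagonal.mem_antidiagonal.1 hkl, pow_add]; ring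
  refine ⟨fun n => ∑ kl ∈ Finset.HasAntidiagonal.antidiagonal n, b kl.1 * b' kl.2,
    fun n => Finset.sum_nonneg fun kl _ => mul_nonneg (hb _) (hb' _), ?_, fun t ht => ?_⟩
  · simpa using (key 1 one_mem_Icc).summable
  · simpa only [e] using key t ht

lemma pow (hg : NonnegSeries g) (n : ℕ) : NonnegSeries fun t => g t ^ n := by
  induction n with
  | zero => simpa using const zero_le_one
  | succ n ih => simpa only [pow_succ] using ih.mul hg

lemma abs_le (hg : NonnegSeries g) {t : ℝ} (ht : t ∈ Set.Icc (-1 : ℝ) 1) : |g t| ≤ g |t| := by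
  obtain ⟨b, hb, hs, H⟩ := hg
  have ht' : |t| ∈ Set.Icc (-1 : ℝ) 1 :=
    ⟨by linarith [abs_nonneg t], _root_.abs_le.2 ht⟩
  rw [← (H t ht).tsum_eq, ← (H _ ht').tsum_eq, ← Real.norm_eq_abs]
  refine tsum_of_norm_bounded (summable_mul_pow hb hs ht').hasSum fun n => ?_
  rw [norm_mul, norm_pow, Real.norm_eq_abs, Real.norm_eq_abs, abs_of_nonneg (hb n)]

lemma nonneg (hg : NonnegSeries g) {t : ℝ} (ht : t ∈ Set.Icc (0 : ℝ) 1) : 0 ≤ g t := by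
  obtain ⟨b, hb, -, H⟩ := hg
  exact (H t ⟨by linarith [ht.1], ht.2⟩).nonneg fun n => mul_nonneg (hb n) (pow_nonneg ht.1 n)

lemma mono (hg : NonnegSeries g) {s t : ℝ} (hs : 0 ≤ s) (hst : s ≤ t) (ht : t ≤ 1) :
    g s ≤ g t := by
  obtain ⟨b, hb, -, H⟩ := hg
  refine hasSum_le (fun n => ?_) (H s ⟨by linarith, hst.trans ht⟩) (H t ⟨by linarith, ht⟩)
  exact mul_le_mul_of_nonneg_left (pow_le_pow_left₀ hs hst n) (hb n)

lemma abs_le_one (hg : NonnegSeries g) {t : ℝ} (ht : t ∈ Set.Icc (-1 : ℝ) 1) : |g t| ≤ g 1 :=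
  (hg.abs_le ht).trans (hg.mono (abs_nonneg t) (_root_.abs_le.2 ht) le_rfl)

lemma continuousOn (hg : NonnegSeries g) : ContinuousOn g (Set.Icc (-1) 1) := by
  obtain ⟨b, hb, hs, H⟩ := hg
  have : ContinuousOn (fun t => ∑' n, b n * t ^ n) (Set.Icc (-1 : ℝ) 1) := by
    refine continuousOn_tsum (fun n => by fun_prop) hs fun n t ht => ?_
    rw [norm_mul, Real.norm_eq_abs, Real.norm_eq_abs, abs_of_nonneg (hb n)]
    exact mul_le_of_le_one_right (hb n) (abs_pow_le_one_of_mem ht n)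
  exact this.congr fun t ht => (H t ht).tsum_eq.symm

/-- Composition, when the inner function takes its values in `[-1, 1]`. -/
lemma comp (hh : NonnegSeries h) (hg : NonnegSeries g) (hg1 : g 1 ≤ 1) :
    NonnegSeries fun t => h (g t) := by
  have hmem : ∀ t ∈ Set.Icc (-1 : ℝ) 1, g t ∈ Set.Icc (-1 : ℝ) 1 := fun t ht =>
    _root_.abs_le.1 ((hg.abs_le_one ht).trans hg1)
  obtain ⟨a, ha, hsa, H⟩ := hh
  choose b hb hsb Hb using fun m => hg.pow m
  have hnn : ∀ p : ℕ × ℕ, 0 ≤ a p.1 * b p.1 p.2 := fun p => mul_nonneg (ha _) (hb _ _)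
  have hb1 : ∀ m, ∑' n, b m n = g 1 ^ m := fun m => by simpa using (Hb m 1 one_mem_Icc).tsum_eq
  have hsum : Summable fun p : ℕ × ℕ => a p.1 * b p.1 p.2 := by
    refine (summable_prod_of_nonneg hnn).2 ⟨fun m => (hsb m).mul_left (a m), ?_⟩
    simp only [tsum_mul_left, hb1]
    exact summable_mul_pow ha hsa (hmem 1 one_mem_Icc)
  have hsum' : Summable fun p : ℕ × ℕ => a p.2 * b p.2 p.1 :=
    (Equiv.prodComm ℕ ℕ).summable_iff.2 hsum
  refine ⟨fun n => ∑' m, a m * b m n, fun n => tsum_nonneg fun m => hnn (m, n), hsum'.prod,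
    fun t ht => ?_⟩
  have hst : Summable fun p : ℕ × ℕ => a p.1 * b p.1 p.2 * t ^ p.2 := by
    refine Summable.of_norm_bounded hsum fun p => ?_
    rw [norm_mul, Real.norm_eq_abs, Real.norm_eq_abs, abs_of_nonneg (hnn p)]
    exact mul_le_of_le_one_right (hnn p) (abs_pow_le_one_of_mem ht _)
  have h1 : HasSum (fun p : ℕ × ℕ => a p.1 * b p.1 p.2 * t ^ p.2) (h (g t)) := by
    have hm : ∀ m, HasSum (fun n => a m * b m n * t ^ n) (a m * g t ^ m) := fun m => by
      simpa only [mul_assoc] using (Hb m t ht).mul_left (a m)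
    have h2 := hst.hasSum.prod_fiberwise hm
    rw [← h2.unique (H _ (hmem t ht))]
    exact hst.hasSum
  have h3 : HasSum (fun p : ℕ × ℕ => a p.2 * b p.2 p.1 * t ^ p.1) (h (g t)) :=
    (Equiv.prodComm ℕ ℕ).hasSum_iff.2 h1
  have h4 := h3.prod_fiberwise fun n => (h3.summable.prod_factor n).hasSum
  simpa only [tsum_mul_right] using h4

end NonnegSeries

/-! ### Stein's identity and Hermite polynomials -/

/-- The standard normal distribution. -/
abbrev stdGaussian : Measure ℝ := gaussianReal 0 1

lemma hasDerivAt_gaussianPDFReal (x : ℝ) :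
    HasDerivAt (gaussianPDFReal 0 1) (-(x * gaussianPDFReal 0 1 x)) x := by
  have h : HasDerivAt (fun y : ℝ => (√(2 * Real.pi))⁻¹ * Real.exp (-y ^ 2 / 2))
      ((√(2 * Real.pi))⁻¹ * (Real.exp (-x ^ 2 / 2) * (-(2 * x) / 2))) x := by
    have h1 : HasDerivAt (fun y : ℝ => -y ^ 2 / 2) (-(2 * x) / 2) x := by
      simpa using ((hasDerivAt_pow 2 x).neg).div_const 2
    exact h1.exp.const_mul _
  have e : gaussianPDFReal 0 1 = fun y : ℝ => (√(2 * Real.pi))⁻¹ * Real.exp (-y ^ 2 / 2) := by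
    ext y; simp [gaussianPDFReal_def]
  rw [e]
  convert h using 1
  ring

lemma integrable_stdGaussian_iff {f : ℝ → ℝ} :
    Integrable f stdGaussian ↔ Integrable fun x => gaussianPDFReal 0 1 x * f x := by
  rw [stdGaussian, gaussianReal_of_var_ne_zero _ one_ne_zero,
    integrable_withDensity_iff_integrable_smul' (measurable_gaussianPDF 0 1)
      (ae_of_all _ fun _ => gaussianPDF_lt_top)]
  simp only [toReal_gaussianPDF, smul_eq_mul]

/-- Stein's identity. -/
lemma stein {f f' : ℝ → ℝ} (hf : ∀ x, HasDerivAt f (f' x) x) (h0 : Integrable f stdGaussian)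
    (h1 : Integrable (fun x => x * f x) stdGaussian) (h2 : Integrable f' stdGaussian) :
    ∫ x, x * f x ∂stdGaussian = ∫ x, f' x ∂stdGaussian := by
  rw [integral_gaussianReal_eq_integral_smul one_ne_zero,
    integral_gaussianReal_eq_integral_smul one_ne_zero]
  rw [integrable_stdGaussian_iff] at h0 h1 h2
  have := integral_mul_deriv_eq_deriv_mul_of_integrable (u := f) (v := gaussianPDFReal 0 1)
    (u' := f') (v' := fun x => -(x * gaussianPDFReal 0 1 x)) (fun x _ => hf x)
    (fun x _ => hasDerivAt_gaussianPDFReal x)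
    (by refine h1.neg.congr (ae_of_all _ fun x => ?_); simp; ring)
    (by refine h2.congr (ae_of_all _ fun x => ?_); simp; ring)
    (by refine h0.congr (ae_of_all _ fun x => ?_); simp; ring)
  have e1 : ∫ x, gaussianPDFReal 0 1 x • (x * f x) =
      -∫ x, f x * -(x * gaussianPDFReal 0 1 x) := by
    rw [← integral_neg]; congr 1; ext x; simp; ring
  rw [e1, this, neg_neg]
  congr 1; ext x; simp; ring

lemma memLp_pow (n : ℕ) (p : ENNReal) (hp : p ≠ ⊤) : MemLp (fun x : ℝ => x ^ n) p stdGaussian := by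
  have h : ∀ (n : ℕ) (p : ENNReal), p ≠ ⊤ → MemLp (fun x : ℝ => x ^ n) p stdGaussian := by
    intro n
    induction n with
    | zero => intro p _; simpa using memLp_const (1 : ℝ)
    | succ n ih =>
      intro p hp
      have h1 := ih (2 * p) (ENNReal.mul_ne_top (by simp) hp)
      have h2 := memLp_id_gaussianReal' (μ := 0) (v := 1) (2 * p) (ENNReal.mul_ne_top (by simp) hp)
      have : ENNReal.HolderTriple (2 * p) (2 * p) p := ⟨by
        rw [ENNReal.mul_inv (by simp) (by simp), ← add_mul, ENNReal.inv_two_add_inv_two, one_mul]⟩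
      have h3 := h2.mul h1 (r := p)
      refine h3.ae_eq (ae_of_all _ fun x => ?_)
      simp [pow_succ]
  exact h n p hp

lemma memLp_polynomial (P : Polynomial ℝ) (p : ENNReal) (hp : p ≠ ⊤) :
    MemLp (fun x : ℝ => P.eval x) p stdGaussian := by
  simp only [Polynomial.eval_eq_sum, Polynomial.sum_def]
  exact memLp_finsetSum _ fun n _ => (memLp_pow n p hp).const_mul _

lemma integrable_polynomial (P : Polynomial ℝ) :
    Integrable (fun x : ℝ => P.eval x) stdGaussian :=
  memLp_one_iff_integrable.1 (memLp_polynomial P 1 (by simp))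

/-- The `n`-th probabilists' Hermite polynomial with real coefficients. -/
def hermiteR (n : ℕ) : Polynomial ℝ := (Polynomial.hermite n).map (Int.castRingHom ℝ)

lemma hermiteR_zero : hermiteR 0 = 1 := by simp [hermiteR]

lemma hermiteR_succ (n : ℕ) :
    hermiteR (n + 1) = Polynomial.X * hermiteR n - Polynomial.derivative (hermiteR n) := by
  simp [hermiteR, Polynomial.hermite_succ, Polynomial.derivative_map]

lemma derivative_hermiteR_succ (n : ℕ) :
    Polynomial.derivative (hermiteR (n + 1)) = ((n : ℝ) + 1) • hermiteR n := by
  induction n with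
  | zero => simp [hermiteR_succ, hermiteR_zero]
  | succ n ih =>
    rw [hermiteR_succ (n + 1), Polynomial.derivative_sub, Polynomial.derivative_mul, ih,
      Polynomial.derivative_X, Polynomial.derivative_smul, hermiteR_succ n]
    simp only [Polynomial.smul_eq_C_mul]
    push_cast
    simp only [map_add, map_natCast, map_one]
    ring

/-- The Hermite polynomials as a polynomial sequence. -/
def hermiteSequence : Polynomial.Sequence ℝ where
  elems' := hermiteR
  degree_eq' n := by
    rw [hermiteR, Polynomial.degree_map_eq_of_injective Int.cast_injective,
      Polynomial.degree_hermite]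

lemma span_hermiteR : Submodule.span ℝ (Set.range hermiteR) = ⊤ :=
  hermiteSequence.span fun i => by
    have : (hermiteR i).Monic := (Polynomial.hermite_monic i).map _
    rw [show (hermiteSequence i) = hermiteR i from rfl, this.leadingCoeff]
    exact isUnit_one

lemma stein_polynomial (P : Polynomial ℝ) :
    ∫ x, x * P.eval x ∂stdGaussian = ∫ x, (Polynomial.derivative P).eval x ∂stdGaussian := by
  refine stein (fun x => P.hasDerivAt x) (integrable_polynomial P) ?_ (integrable_polynomial _)
  exact (integrable_polynomial (Polynomial.X * P)).congr (ae_of_all _ fun x => by simp)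

/-- The Hermite coefficients are shifted by the derivative. -/
lemma integral_mul_hermiteR_succ {f f' : ℝ → ℝ} (hf : ∀ x, HasDerivAt f (f' x) x)
    (h0 : MemLp f 2 stdGaussian) (h1 : MemLp f' 2 stdGaussian) (n : ℕ) :
    ∫ x, f x * (hermiteR (n + 1)).eval x ∂stdGaussian =
      ∫ x, f' x * (hermiteR n).eval x ∂stdGaussian := by
  have hi : ∀ {g : ℝ → ℝ} (P : Polynomial ℝ), MemLp g 2 stdGaussian →
      Integrable (fun x => g x * P.eval x) stdGaussian := fun P hg =>
    hg.integrable_mul (memLp_polynomial P 2 (by simp))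
  have hX := hi (Polynomial.X * hermiteR n) h0
  have hD := hi (Polynomial.derivative (hermiteR n)) h0
  have := stein (f := fun x => f x * (hermiteR n).eval x)
    (f' := fun x => f' x * (hermiteR n).eval x +
      f x * (Polynomial.derivative (hermiteR n)).eval x)
    (fun x => (hf x).mul ((hermiteR n).hasDerivAt x)) (hi _ h0)
    (by refine hX.congr (ae_of_all _ fun x => ?_); simp; ring) ((hi _ h1).add hD)
  rw [integral_add (hi _ h1) hD] at this
  rw [← sub_eq_iff_eq_add.2 this, ← integral_sub _ hD]
  · congr 1; ext x; simp [hermiteR_succ]; ring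
  · refine hX.congr (ae_of_all _ fun x => ?_); simp; ring

lemma integral_hermiteR_mul (m n : ℕ) :
    ∫ x, (hermiteR m).eval x * (hermiteR n).eval x ∂stdGaussian =
      if m = n then (n.factorial : ℝ) else 0 := by
  have key : ∀ n m : ℕ, ∫ x, (hermiteR (m + 1)).eval x * (hermiteR (n + 1)).eval x ∂stdGaussian =
      ((m : ℝ) + 1) * ∫ x, (hermiteR m).eval x * (hermiteR n).eval x ∂stdGaussian := fun n m => by
    rw [integral_mul_hermiteR_succ (fun x => (hermiteR (m + 1)).hasDerivAt x)
      (memLp_polynomial _ 2 (by simp)) (memLp_polynomial _ 2 (by simp)),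
      derivative_hermiteR_succ, ← integral_const_mul]
    congr 1; ext x; simp [mul_assoc]
  have hz : ∀ n, ∫ x, (hermiteR 0).eval x * (hermiteR (n + 1)).eval x ∂stdGaussian = 0 :=
    fun n => by
      rw [integral_mul_hermiteR_succ (fun x => (hermiteR 0).hasDerivAt x)
        (memLp_polynomial _ 2 (by simp)) (memLp_polynomial _ 2 (by simp))]
      simp [hermiteR_zero]
  induction n generalizing m with
  | zero =>
    cases m with
    | zero => simp [hermiteR_zero]
    | succ m =>
      simp only [mul_comm ((hermiteR (m + 1)).eval _), hz]
      simp
  | succ n ih =>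
    cases m with
    | zero => rw [hz]; simp
    | succ m =>
      rw [key, ih]
      by_cases h : m = n
      · subst h; simp [Nat.factorial_succ]
      · simp [h]

lemma measurePreserving_rotate {c s : ℝ} (h : c ^ 2 + s ^ 2 = 1) :
    MeasurePreserving (fun z : ℝ × ℝ => c * z.1 + s * z.2) (stdGaussian.prod stdGaussian)
      stdGaussian := by
  refine ⟨by fun_prop, ?_⟩
  have h1 : HasLaw (fun z : ℝ × ℝ => z.1) stdGaussian (stdGaussian.prod stdGaussian) :=
    ⟨by fun_prop, by rw [Measure.map_fst_prod]; simp⟩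
  have h2 : HasLaw (fun z : ℝ × ℝ => z.2) stdGaussian (stdGaussian.prod stdGaussian) :=
    ⟨by fun_prop, by rw [Measure.map_snd_prod]; simp⟩
  have hind : IndepFun (fun z : ℝ × ℝ => c * z.1) (fun z : ℝ × ℝ => s * z.2)
      (stdGaussian.prod stdGaussian) :=
    indepFun_prod (X := fun x => c * x) (Y := fun x => s * x) (by fun_prop) (by fun_prop)
  have h3 := gaussianReal_add_gaussianReal_of_indepFun hind (gaussianReal_const_mul h1 c).map_eq
    (gaussianReal_const_mul h2 s).map_eq
  rw [show (fun z : ℝ × ℝ => c * z.1 + s * z.2) =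
    (fun z : ℝ × ℝ => c * z.1) + (fun z : ℝ × ℝ => s * z.2) from rfl, h3]
  congr 1
  · simp
  · ext; simpa using h

/-- The Ornstein–Uhlenbeck semigroup acts diagonally on Hermite polynomials. -/
lemma integral_hermiteR_rotate {c s : ℝ} (h : c ^ 2 + s ^ 2 = 1) (n : ℕ) (x : ℝ) :
    ∫ z, (hermiteR n).eval (c * x + s * z) ∂stdGaussian = c ^ n * (hermiteR n).eval x := by
  have ev : ∀ (P : Polynomial ℝ) (z : ℝ),
      (P.comp (Polynomial.C (c * x) + Polynomial.C s * Polynomial.X)).eval z =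
        P.eval (c * x + s * z) := fun P z => by simp
  have hi : ∀ P : Polynomial ℝ, Integrable (fun z => P.eval (c * x + s * z)) stdGaussian :=
    fun P => (integrable_polynomial
      (P.comp (Polynomial.C (c * x) + Polynomial.C s * Polynomial.X))).congr
      (ae_of_all _ fun z => ev P z)
  induction n using Nat.strong_induction_on with
  | _ n ih =>
    match n with
    | 0 => simp [hermiteR_zero]
    | n + 1 =>
      have hst : ∫ z, z * (hermiteR n).eval (c * x + s * z) ∂stdGaussian =
          s * ∫ z, (Polynomial.derivative (hermiteR n)).eval (c * x + s * z) ∂stdGaussian := by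
        have := stein_polynomial
          ((hermiteR n).comp (Polynomial.C (c * x) + Polynomial.C s * Polynomial.X))
        simp only [ev] at this
        rw [this, ← integral_const_mul]
        congr 1; ext z
        simp [Polynomial.derivative_comp]
      have hzi : Integrable (fun z => z * (hermiteR n).eval (c * x + s * z)) stdGaussian :=
        (integrable_polynomial (Polynomial.X * (hermiteR n).comp
          (Polynomial.C (c * x) + Polynomial.C s * Polynomial.X))).congr
          (ae_of_all _ fun z => by simp)
      have e : ∫ z, (hermiteR (n + 1)).eval (c * x + s * z) ∂stdGaussian =
          c * x * ∫ z, (hermiteR n).eval (c * x + s * z) ∂stdGaussian -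
          c ^ 2 * ∫ z, (Polynomial.derivative (hermiteR n)).eval (c * x + s * z) ∂stdGaussian := by
        have e1 : ∀ z, (hermiteR (n + 1)).eval (c * x + s * z) =
            c * x * (hermiteR n).eval (c * x + s * z) +
            s * (z * (hermiteR n).eval (c * x + s * z)) -
            (Polynomial.derivative (hermiteR n)).eval (c * x + s * z) := fun z => by
          simp [hermiteR_succ]; ring
        simp only [e1]
        have hi1 : Integrable (fun z => c * x * (hermiteR n).eval (c * x + s * z)) stdGaussian :=
          (hi _).const_mul _
        have hi2 : Integrable (fun z => s * (z * (hermiteR n).eval (c * x + s * z)))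
            stdGaussian := hzi.const_mul _
        have hi3 : Integrable (fun z => c * x * (hermiteR n).eval (c * x + s * z) +
            s * (z * (hermiteR n).eval (c * x + s * z))) stdGaussian := hi1.add hi2
        rw [integral_sub hi3 (hi _), integral_add hi1 hi2, integral_const_mul,
          integral_const_mul, hst]
        linear_combination
          h * ∫ z, (Polynomial.derivative (hermiteR n)).eval (c * x + s * z) ∂stdGaussian
      rw [e, ih n (by omega)]
      match n with
      | 0 => simp [hermiteR_zero, hermiteR_succ]
      | n + 1 =>
        have e2 : ∀ z, (Polynomial.derivative (hermiteR (n + 1))).eval (c * x + s * z) =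
            ((n : ℝ) + 1) * (hermiteR n).eval (c * x + s * z) := fun z => by
          simp [derivative_hermiteR_succ]
        simp only [e2]
        rw [integral_const_mul, ih n (by omega), hermiteR_succ (n + 1), derivative_hermiteR_succ]
        simp
        ring

/-! ### Completeness of the Hermite polynomials and Mehler's formula -/

lemma memLp_exp_abs (t : ℝ) : MemLp (fun x : ℝ => Real.exp (|t| * |x|)) 2 stdGaussian := by
  refine (memLp_two_iff_integrable_sq (by fun_prop)).2 ?_
  refine ((integrable_exp_mul_gaussianReal (μ := 0) (v := 1) (2 * |t|)).add
    (integrable_exp_mul_gaussianReal (μ := 0) (v := 1) (-(2 * |t|)))).mono'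
    (by fun_prop) (ae_of_all _ fun x => ?_)
  rw [Real.norm_eq_abs, abs_of_nonneg (sq_nonneg _), sq, ← Real.exp_add]
  simp only [Pi.add_apply]
  rcases abs_cases x with ⟨h, -⟩ | ⟨h, -⟩ <;> rw [h]
  · refine le_trans (le_of_eq ?_) (le_add_of_nonneg_right (Real.exp_pos _).le)
    ring_nf
  · refine le_trans (le_of_eq ?_) (le_add_of_nonneg_left (Real.exp_pos _).le)
    ring_nf

/-- A square integrable function with vanishing moments has vanishing Fourier transform. -/
lemma integral_mul_cexp_eq_zero {f : ℝ → ℝ} (hf : MemLp f 2 stdGaussian)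
    (h0 : ∀ n : ℕ, ∫ x, f x * x ^ n ∂stdGaussian = 0) (t : ℝ) :
    ∫ x, (f x : ℂ) * Complex.exp (t * x * Complex.I) ∂stdGaussian = 0 := by
  have hs : ∀ x : ℝ, HasSum (fun n : ℕ => ((f x * x ^ n : ℝ) : ℂ) *
      ((t * Complex.I) ^ n / (n.factorial : ℂ)))
      ((f x : ℂ) * Complex.exp (t * x * Complex.I)) := fun x => by
    have h1 : HasSum (fun n : ℕ => (t * x * Complex.I) ^ n / (n.factorial : ℂ))
        (Complex.exp (t * x * Complex.I)) := by
      rw [Complex.exp_eq_exp_ℂ]; exact NormedSpace.expSeries_div_hasSum_exp _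
    refine (h1.mul_left (f x : ℂ)).congr_fun fun n => ?_
    push_cast; ring
  have hb : ∀ x : ℝ, HasSum (fun n : ℕ => |f x| * ((|t| * |x|) ^ n / n.factorial))
      (|f x| * Real.exp (|t| * |x|)) := fun x => by
    have h1 : HasSum (fun n : ℕ => (|t| * |x|) ^ n / (n.factorial : ℝ))
        (Real.exp (|t| * |x|)) := by
      rw [Real.exp_eq_exp_ℝ]; exact NormedSpace.expSeries_div_hasSum_exp _
    exact h1.mul_left _
  have hm : AEStronglyMeasurable f stdGaussian := hf.1
  have hint : Integrable (fun x => ∑' n : ℕ, |f x| * ((|t| * |x|) ^ n / n.factorial))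
      stdGaussian := by
    simp only [fun x => (hb x).tsum_eq]
    exact hf.abs.integrable_mul (memLp_exp_abs t)
  have key := hasSum_integral_of_dominated_convergence (μ := stdGaussian)
    (F := fun (n : ℕ) x => ((f x * x ^ n : ℝ) : ℂ) * ((t * Complex.I) ^ n / (n.factorial : ℂ)))
    (f := fun x => (f x : ℂ) * Complex.exp (t * x * Complex.I))
    (bound := fun n x => |f x| * ((|t| * |x|) ^ n / n.factorial))
    (fun n => by
      refine AEStronglyMeasurable.mul_const ?_ _
      exact Complex.continuous_ofReal.comp_aestronglyMeasurable
        (hm.mul (by fun_prop)))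
    (fun n => ae_of_all _ fun x => by
      simp only [Complex.norm_real, norm_div, norm_pow, norm_mul,
        Complex.norm_I, Real.norm_eq_abs, Complex.norm_natCast]
      apply le_of_eq; ring)
    (ae_of_all _ fun x => (hb x).summable) hint (ae_of_all _ hs)
  refine key.unique ?_
  convert hasSum_zero using 2 with n
  rw [integral_mul_const, integral_complex_ofReal, h0 n]
  simp

/-- A square integrable function with vanishing moments vanishes. -/
lemma ae_eq_zero_of_moments {f : ℝ → ℝ} (hf : MemLp f 2 stdGaussian)
    (h0 : ∀ n : ℕ, ∫ x, f x * x ^ n ∂stdGaussian = 0) : f =ᵐ[stdGaussian] 0 := by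
  have hfi : Integrable f stdGaussian := hf.integrable (by norm_num)
  have hp : Integrable (fun x => max (f x) 0) stdGaussian := hfi.pos_part
  have hn : Integrable (fun x => max (-f x) 0) stdGaussian := hfi.neg_part
  set μp := stdGaussian.withDensity fun x => ENNReal.ofReal (f x) with hμp
  set μn := stdGaussian.withDensity fun x => ENNReal.ofReal (-f x) with hμn
  have hfin : ∀ {g : ℝ → ℝ}, Integrable g stdGaussian →
      IsFiniteMeasure (stdGaussian.withDensity fun x => ENNReal.ofReal (g x)) := fun hg =>
    isFiniteMeasure_withDensity_ofReal hg.2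
  have : IsFiniteMeasure μp := hfin hfi
  have : IsFiniteMeasure μn := hfin hfi.neg
  have hchar : ∀ {g : ℝ → ℝ}, Integrable g stdGaussian → ∀ t : ℝ,
      charFun (stdGaussian.withDensity fun x => ENNReal.ofReal (g x)) t =
        ∫ x, ((max (g x) 0 : ℝ) : ℂ) * Complex.exp (t * x * Complex.I) ∂stdGaussian := by
    intro g hg t
    rw [charFun_apply_real, integral_withDensity_eq_integral_toReal_smul₀
      hg.aestronglyMeasurable.aemeasurable.ennreal_ofReal (ae_of_all _ fun _ => by simp)]
    simp only [ENNReal.toReal_ofReal', Complex.real_smul]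
  have hexp : ∀ {g : ℝ → ℝ}, Integrable g stdGaussian → ∀ t : ℝ,
      Integrable (fun x => (g x : ℂ) * Complex.exp (t * x * Complex.I)) stdGaussian := by
    intro g hg t
    refine hg.ofReal.mul_bdd (c := 1) (by fun_prop) (ae_of_all _ fun x => ?_)
    rw [show (t * x * Complex.I : ℂ) = ((t * x : ℝ) : ℂ) * Complex.I by push_cast; ring,
      Complex.norm_exp_ofReal_mul_I]
  have heq : μp = μn := by
    refine Measure.ext_of_charFun ?_
    ext t
    rw [hchar hfi, show charFun μn t = ∫ x, ((max (-f x) 0 : ℝ) : ℂ) *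
        Complex.exp (t * x * Complex.I) ∂stdGaussian from hchar hfi.neg t, ← sub_eq_zero, ← integral_sub (hexp hp t) (hexp hn t),
      ← integral_mul_cexp_eq_zero hf h0 t]
    congr 1; ext x
    rw [← sub_mul]
    congr 1
    rw [← Complex.ofReal_sub]
    congr 1
    rcases le_total (f x) 0 with h | h
    · rw [max_eq_right h, max_eq_left (by linarith)]; ring
    · rw [max_eq_left h, max_eq_right (by linarith)]; ring
  have hae := (withDensity_eq_iff hfi.aestronglyMeasurable.aemeasurable.ennreal_ofReal
    hfi.neg.aestronglyMeasurable.aemeasurable.ennreal_ofReal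
    (by
      have := (hfin hfi).measure_univ_lt_top
      rw [withDensity_apply _ MeasurableSet.univ, Measure.restrict_univ] at this
      exact this.ne)).1 heq
  filter_upwards [hae] with x hx
  simp only [Pi.neg_apply] at hx
  rcases le_total (f x) 0 with h | h
  · rw [ENNReal.ofReal_of_nonpos h] at hx
    have := ENNReal.ofReal_eq_zero.1 hx.symm
    simp only [Pi.zero_apply]; linarith
  · rw [ENNReal.ofReal_of_nonpos (by linarith : -f x ≤ 0)] at hx
    have := ENNReal.ofReal_eq_zero.1 hx
    simp only [Pi.zero_apply]; linarith

/-- The normalised Hermite functions. -/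
def hermiteN (n : ℕ) (x : ℝ) : ℝ := (√(n.factorial : ℝ))⁻¹ * (hermiteR n).eval x

lemma memLp_hermiteN (n : ℕ) : MemLp (hermiteN n) 2 stdGaussian :=
  (memLp_polynomial (hermiteR n) 2 (by simp)).const_mul _

lemma integral_hermiteN_mul (m n : ℕ) :
    ∫ x, hermiteN m x * hermiteN n x ∂stdGaussian = if m = n then 1 else 0 := by
  have e : ∀ x, hermiteN m x * hermiteN n x =
      ((√(m.factorial : ℝ))⁻¹ * (√(n.factorial : ℝ))⁻¹) *
        ((hermiteR m).eval x * (hermiteR n).eval x) := fun x => by rw [hermiteN, hermiteN]; ring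
  simp only [e]
  rw [integral_const_mul, integral_hermiteR_mul]
  split_ifs with h
  · subst h
    have h0 : (0 : ℝ) < m.factorial := by exact_mod_cast m.factorial_pos
    rw [← mul_inv, Real.mul_self_sqrt h0.le, inv_mul_cancel₀ h0.ne']
  · simp

/-- The Hermite coefficients of a function. -/
def hermiteCoeff (f : ℝ → ℝ) (n : ℕ) : ℝ := ∫ x, hermiteN n x * f x ∂stdGaussian

lemma inner_toLp {Ω : Type*} [MeasurableSpace Ω] {P : Measure Ω} {f g : Ω → ℝ} (hf : MemLp f 2 P)
    (hg : MemLp g 2 P) : inner ℝ (hf.toLp f) (hg.toLp g) = ∫ x, f x * g x ∂P := by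
  rw [L2.inner_def]
  refine integral_congr_ae ?_
  filter_upwards [hf.coeFn_toLp, hg.coeFn_toLp] with x h1 h2
  rw [h1, h2]
  simp [mul_comm]

/-- The vectors of the Hermite basis in `L²`. -/
def hermiteLp (n : ℕ) : Lp ℝ 2 stdGaussian := (memLp_hermiteN n).toLp (hermiteN n)

lemma orthonormal_hermiteLp : Orthonormal ℝ hermiteLp := by
  rw [orthonormal_iff_ite]
  intro m n
  rw [hermiteLp, hermiteLp, inner_toLp, integral_hermiteN_mul]

lemma span_hermiteLp_orthogonal : (Submodule.span ℝ (Set.range hermiteLp))ᗮ = ⊥ := by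
  rw [Submodule.eq_bot_iff]
  intro f hf
  rw [Submodule.mem_orthogonal] at hf
  have hL : MemLp f 2 stdGaussian := Lp.memLp f
  have hfeq : hL.toLp f = f := Lp.toLp_coeFn f hL
  have hint : ∀ P : Polynomial ℝ, Integrable (fun x => f x * P.eval x) stdGaussian := fun P =>
    hL.integrable_mul (memLp_polynomial P 2 (by simp))
  have hH : ∀ n, ∫ x, f x * (hermiteR n).eval x ∂stdGaussian = 0 := fun n => by
    have h := hf (hermiteLp n) (Submodule.subset_span ⟨n, rfl⟩)
    rw [← hfeq, hermiteLp, inner_toLp] at h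
    have e : ∀ x, hermiteN n x * f x =
        (√(n.factorial : ℝ))⁻¹ * (f x * (hermiteR n).eval x) := fun x => by rw [hermiteN]; ring
    simp only [e] at h
    rw [integral_const_mul] at h
    refine (mul_eq_zero.1 h).resolve_left (inv_ne_zero (Real.sqrt_ne_zero'.2 ?_))
    exact_mod_cast n.factorial_pos
  have hP : ∀ P : Polynomial ℝ, ∫ x, f x * P.eval x ∂stdGaussian = 0 := fun P => by
    have hmem : P ∈ Submodule.span ℝ (Set.range hermiteR) := by rw [span_hermiteR]; trivial
    induction hmem using Submodule.span_induction with
    | mem P hP => obtain ⟨n, rfl⟩ := hP; exact hH n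
    | zero => simp
    | add P Q _ _ h1 h2 =>
      have e : ∀ x, f x * (P + Q).eval x = f x * P.eval x + f x * Q.eval x := fun x => by
        rw [Polynomial.eval_add]; ring
      simp only [e]
      rw [integral_add (hint P) (hint Q), h1, h2, add_zero]
    | smul a P _ h1 =>
      have e : ∀ x, f x * (a • P).eval x = a * (f x * P.eval x) := fun x => by
        rw [Polynomial.eval_smul, smul_eq_mul]; ring
      simp only [e]
      rw [integral_const_mul, h1, mul_zero]
  have h0 := ae_eq_zero_of_moments hL fun n => by simpa using hP (Polynomial.X ^ n)
  exact (Lp.eq_zero_iff_ae_eq_zero).2 h0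

/-- The Hermite basis. -/
def hermiteBasis : HilbertBasis ℕ ℝ (Lp ℝ 2 stdGaussian) :=
  HilbertBasis.mkOfOrthogonalEqBot orthonormal_hermiteLp span_hermiteLp_orthogonal

lemma hasSum_hermite {f : ℝ → ℝ} (hf : MemLp f 2 stdGaussian) :
    HasSum (fun n => hermiteCoeff f n • hermiteLp n) (hf.toLp f) := by
  have h := hermiteBasis.hasSum_repr (hf.toLp f)
  convert h using 2 with n
  rw [HilbertBasis.repr_apply_apply, hermiteBasis, HilbertBasis.coe_mkOfOrthogonalEqBot,
    hermiteLp, inner_toLp, hermiteCoeff]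

/-- Mehler's formula: expansion of a Gaussian correlation in powers of the correlation
coefficient. -/
theorem hasSum_mehler {f : ℝ → ℝ} (hf : MemLp f 2 stdGaussian) {c s : ℝ}
    (h : c ^ 2 + s ^ 2 = 1) :
    HasSum (fun n => hermiteCoeff f n ^ 2 * c ^ n)
      (∫ z : ℝ × ℝ, f z.1 * f (c * z.1 + s * z.2) ∂(stdGaussian.prod stdGaussian)) := by
  have hU : MeasurePreserving (fun z : ℝ × ℝ => z.1) (stdGaussian.prod stdGaussian) stdGaussian :=
    measurePreserving_fst
  have hV := measurePreserving_rotate h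
  set U := Lp.compMeasurePreservingₗᵢ ℝ (E := ℝ) (p := 2) _ hU with hUdef
  set V := Lp.compMeasurePreservingₗᵢ ℝ (E := ℝ) (p := 2) _ hV with hVdef
  have hUt : ∀ {g : ℝ → ℝ} (hg : MemLp g 2 stdGaussian),
      U (hg.toLp g) = (hg.comp_measurePreserving hU).toLp _ := fun hg =>
    Lp.toLp_compMeasurePreserving hg hU
  have hVt : ∀ {g : ℝ → ℝ} (hg : MemLp g 2 stdGaussian),
      V (hg.toLp g) = (hg.comp_measurePreserving hV).toLp _ := fun hg =>
    Lp.toLp_compMeasurePreserving hg hV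
  have hbasis : ∀ m n, inner ℝ (U (hermiteLp m)) (V (hermiteLp n)) =
      if m = n then c ^ n else 0 := fun m n => by
    rw [hermiteLp, hermiteLp, hUt, hVt, inner_toLp]
    simp only [Function.comp_apply]
    rw [integral_prod]
    · simp only [integral_const_mul]
      have : ∀ x : ℝ, ∫ y, hermiteN n (c * x + s * y) ∂stdGaussian = c ^ n * hermiteN n x := by
        intro x
        simp only [hermiteN]
        rw [integral_const_mul, integral_hermiteR_rotate h]
        ring
      simp only [this]
      have e : ∀ x, hermiteN m x * (c ^ n * hermiteN n x) =
          c ^ n * (hermiteN m x * hermiteN n x) := fun x => by ring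
      simp only [e]
      rw [integral_const_mul, integral_hermiteN_mul]
      simp
    · exact ((memLp_hermiteN m).comp_measurePreserving hU).integrable_mul
        ((memLp_hermiteN n).comp_measurePreserving hV)
  have hsum := hasSum_hermite hf
  have h1 : ∀ n, inner ℝ (U (hf.toLp f)) (V (hermiteLp n)) = hermiteCoeff f n * c ^ n :=
    fun n => by
      have h2 := ((innerSL ℝ (V (hermiteLp n))).comp U.toContinuousLinearMap).hasSum hsum
      have h3 : HasSum (fun m => if m = n then hermiteCoeff f n * c ^ n else 0)
          (inner ℝ (V (hermiteLp n)) (U (hf.toLp f))) := by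
        refine h2.congr_fun fun m => ?_
        change _ = inner ℝ (V (hermiteLp n)) (U (hermiteCoeff f m • hermiteLp m))
        rw [map_smul, inner_smul_right, real_inner_comm, hbasis]
        split_ifs with hmn
        · rw [hmn]
        · simp
      rw [real_inner_comm]
      exact h3.unique (hasSum_ite_eq n _)
  have h4 := ((innerSL ℝ (U (hf.toLp f))).comp V.toContinuousLinearMap).hasSum hsum
  have h5 : (innerSL ℝ (U (hf.toLp f))).comp V.toContinuousLinearMap (hf.toLp f) =
      ∫ z : ℝ × ℝ, f z.1 * f (c * z.1 + s * z.2) ∂(stdGaussian.prod stdGaussian) := by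
    simp only [ContinuousLinearMap.comp_apply, LinearIsometry.coe_toContinuousLinearMap,
      innerSL_apply_apply]
    rw [hUt, hVt, inner_toLp]
    rfl
  rw [h5] at h4
  refine h4.congr_fun fun n => ?_
  change _ = inner ℝ (U (hf.toLp f)) (V (hermiteCoeff f n • hermiteLp n))
  rw [map_smul, inner_smul_right, h1]
  ring

/-- The Hermite coefficients of a differentiable function and of its derivative. -/
lemma hermiteCoeff_deriv {f f' : ℝ → ℝ} (hf : ∀ x, HasDerivAt f (f' x) x)
    (h0 : MemLp f 2 stdGaussian) (h1 : MemLp f' 2 stdGaussian) (n : ℕ) :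
    hermiteCoeff f' n ^ 2 = ((n : ℝ) + 1) * hermiteCoeff f (n + 1) ^ 2 := by
  have e : ∀ (g : ℝ → ℝ) n, hermiteCoeff g n =
      (√(n.factorial : ℝ))⁻¹ * ∫ x, g x * (hermiteR n).eval x ∂stdGaussian := fun g n => by
    rw [hermiteCoeff, ← integral_const_mul]
    congr 1; ext x; rw [hermiteN]; ring
  have h2 : (0 : ℝ) < n.factorial := by exact_mod_cast n.factorial_pos
  have h3 : (0 : ℝ) < (n + 1).factorial := by exact_mod_cast (n + 1).factorial_pos
  rw [e, e, integral_mul_hermiteR_succ hf h0 h1, mul_pow, mul_pow, inv_pow, inv_pow,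
    Real.sq_sqrt h2.le, Real.sq_sqrt h3.le, Nat.factorial_succ]
  have : ((n : ℝ) + 1) ≠ 0 := by positivity
  push_cast
  field_simp

/-! ### Integration of homogeneous polynomials over the sphere -/

set_option linter.unusedSectionVars false

section SphereIntegral

variable {ι : Type} [Fintype ι]

/-- The polynomial function on Euclidean space. -/
def polyFun (p : MvPolynomial ι ℝ) (y : EuclideanSpace ℝ ι) : ℝ := MvPolynomial.eval (fun i => y i) p

lemma restrictToSphere_apply (p : MvPolynomial ι ℝ) (x : USphere ι) :
    restrictToSphere ι p x = polyFun p x := rfl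

lemma continuous_polyFun (p : MvPolynomial ι ℝ) : Continuous (polyFun p) :=
  (MvPolynomial.continuous_eval p).comp (by fun_prop)

lemma polyFun_smul {p : MvPolynomial ι ℝ} {n : ℕ} (hp : p.IsHomogeneous n) (r : ℝ)
    (y : EuclideanSpace ℝ ι) : polyFun p (r • y) = r ^ n * polyFun p y := by
  simp only [polyFun, MvPolynomial.eval_eq, Finset.mul_sum, PiLp.smul_apply, smul_eq_mul]
  refine Finset.sum_congr rfl fun m hm => ?_
  have h1 : ∑ i ∈ m.support, m i = n := (hp.degree_eq_sum_deg_support hm).symm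
  simp only [mul_pow, Finset.prod_mul_distrib, Finset.prod_pow_eq_pow_sum, h1]
  ring

lemma hasLineDerivAt_polyFun [DecidableEq ι] (p : MvPolynomial ι ℝ) (y : EuclideanSpace ℝ ι)
    (i : ι) : HasLineDerivAt ℝ (polyFun p) (polyFun (MvPolynomial.pderiv i p) y) y
      (EuclideanSpace.single i 1) := by
  induction p using MvPolynomial.induction_on with
  | C a =>
    simp only [HasLineDerivAt, polyFun, MvPolynomial.eval_C, MvPolynomial.pderiv_C, map_zero]
    exact hasDerivAt_const _ _
  | add p q hp hq =>
    simp only [HasLineDerivAt, polyFun, map_add] at hp hq ⊢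
    exact hp.add hq
  | mul_X p j hp =>
    simp only [HasLineDerivAt, polyFun] at hp ⊢
    have hX : HasDerivAt (fun t : ℝ => (y + t • EuclideanSpace.single i (1 : ℝ)) j)
        (if j = i then 1 else 0) 0 := by
      simp only [PiLp.add_apply, PiLp.smul_apply, smul_eq_mul, PiLp.single_apply]
      simpa using ((hasDerivAt_id (0 : ℝ)).mul_const (if j = i then (1 : ℝ) else 0)).const_add (y j)
    have h := hp.mul hX
    simp only [MvPolynomial.eval_mul, MvPolynomial.eval_X]
    convert! h using 1
    simp only [MvPolynomial.pderiv_mul, MvPolynomial.pderiv_X, map_add, map_mul,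
      MvPolynomial.eval_X, zero_smul, add_zero]
    by_cases hij : j = i
    · subst hij; simp
    · simp [hij]

lemma hasLineDerivAt_gaussian [DecidableEq ι] (y : EuclideanSpace ℝ ι) (i : ι) :
    HasLineDerivAt ℝ (fun y : EuclideanSpace ℝ ι => Real.exp (-‖y‖ ^ 2))
      (-(2 * y i * Real.exp (-‖y‖ ^ 2))) y (EuclideanSpace.single i 1) := by
  have h0 : HasDerivAt (fun t : ℝ => ‖y + t • EuclideanSpace.single i (1 : ℝ)‖ ^ 2) (2 * y i) 0 := by
    have e : ∀ t : ℝ, ‖y + t • EuclideanSpace.single i (1 : ℝ)‖ ^ 2 =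
        ‖y‖ ^ 2 + 2 * (t * y i) + t ^ 2 := fun t => by
      rw [norm_add_sq_real, inner_smul_right, norm_smul]
      simp [EuclideanSpace.inner_single_right]
    simp only [e]
    have h1 := (((hasDerivAt_id (0 : ℝ)).mul_const (y i)).const_mul 2).const_add (‖y‖ ^ 2)
    have h2 := h1.add (hasDerivAt_pow 2 (0 : ℝ))
    convert! h2 using 1
    simp
  simp only [HasLineDerivAt]
  have h1 := h0.neg.exp
  convert! h1 using 1
  simp; ring

lemma exists_bound_polyFun {p : MvPolynomial ι ℝ} {n : ℕ} (hp : p.IsHomogeneous n) :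
    ∃ C, ∀ y, |polyFun p y| ≤ C * ‖y‖ ^ n := by
  obtain ⟨C, hC⟩ := (isCompact_sphere (0 : EuclideanSpace ℝ ι) 1).exists_bound_of_continuousOn
    (continuous_polyFun p).continuousOn
  refine ⟨max C |polyFun p 0|, fun y => ?_⟩
  rcases eq_or_ne y 0 with rfl | hy
  · rcases Nat.eq_zero_or_pos n with rfl | hn
    · simp
    · have : polyFun p ((0 : ℝ) • (0 : EuclideanSpace ℝ ι)) = 0 := by
        rw [polyFun_smul hp, zero_pow hn.ne', zero_mul]
      rw [zero_smul] at this
      simp [this, hn.ne']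
  · have hy' : ‖y‖ ≠ 0 := norm_ne_zero_iff.2 hy
    have h1 : y = ‖y‖ • (‖y‖⁻¹ • y) := by rw [smul_smul, mul_inv_cancel₀ hy', one_smul]
    have h2 := hC (‖y‖⁻¹ • y) (by simp [norm_smul, hy'])
    rw [Real.norm_eq_abs] at h2
    rw [h1, polyFun_smul hp, abs_mul, abs_pow, abs_norm, ← h1, mul_comm]
    exact mul_le_mul_of_nonneg_right (h2.trans (le_max_left _ _)) (by positivity)

lemma continuous_polyFun_sphere (p : MvPolynomial ι ℝ) :
    Continuous fun x : USphere ι => polyFun p x :=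
  (continuous_polyFun p).comp continuous_subtype_val

variable [Nonempty ι]

lemma integrable_polyFun_gaussian {p : MvPolynomial ι ℝ} {n : ℕ} (hp : p.IsHomogeneous n) :
    Integrable fun y => polyFun p y * Real.exp (-‖y‖ ^ 2) := by
  obtain ⟨C, hC⟩ := exists_bound_polyFun hp
  have hg : Integrable (fun y : EuclideanSpace ℝ ι => ‖y‖ ^ n * Real.exp (-‖y‖ ^ 2)) := by
    refine (integrable_fun_norm_addHaar (volume : Measure (EuclideanSpace ℝ ι))
      (f := fun r => r ^ n * Real.exp (-r ^ 2))).2 ?_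
    have h := integrableOn_rpow_mul_exp_neg_mul_sq one_pos
      (s := ((Module.finrank ℝ (EuclideanSpace ℝ ι) - 1 + n : ℕ) : ℝ)) (by
        have : (0 : ℝ) ≤ ((Module.finrank ℝ (EuclideanSpace ℝ ι) - 1 + n : ℕ) : ℝ) := by positivity
        linarith)
    refine h.congr_fun (fun r _ => ?_) measurableSet_Ioi
    simp only [Real.rpow_natCast, smul_eq_mul, pow_add]
    ring_nf
  refine (hg.const_mul C).mono' ((continuous_polyFun p).mul (by fun_prop)).aestronglyMeasurable
    (ae_of_all _ fun y => ?_)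
  rw [Real.norm_eq_abs, abs_mul, Real.abs_exp, ← mul_assoc]
  exact mul_le_mul_of_nonneg_right (hC y) (Real.exp_pos _).le

/-- Integration of a homogeneous polynomial against a Gaussian, in polar coordinates. -/
lemma integral_polyFun_gaussian {p : MvPolynomial ι ℝ} {n : ℕ} (hp : p.IsHomogeneous n) :
    ∫ y, polyFun p y * Real.exp (-‖y‖ ^ 2) =
      (∫ x : USphere ι, polyFun p x ∂(volume : Measure (EuclideanSpace ℝ ι)).toSphere) *
        (1 / 2 * Real.Gamma ((n + Fintype.card ι : ℝ) / 2)) := by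
  have hdim : Module.finrank ℝ (EuclideanSpace ℝ ι) = Fintype.card ι := finrank_euclideanSpace
  have hpos : 0 < Fintype.card ι := Fintype.card_pos
  obtain ⟨F, hF⟩ : ∃ F : EuclideanSpace ℝ ι → ℝ,
      F = fun y => polyFun p y * Real.exp (-‖y‖ ^ 2) := ⟨_, rfl⟩
  have h1 : ∫ y, F y = ∫ y : ({(0)}ᶜ : Set (EuclideanSpace ℝ ι)), F y
      ∂((volume : Measure (EuclideanSpace ℝ ι)).comap (↑)) := by
    rw [integral_subtype_comap (measurableSet_singleton _).compl F,
      restrict_compl_singleton]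
  have h2 : ∫ y : ({(0)}ᶜ : Set (EuclideanSpace ℝ ι)), F y
      ∂((volume : Measure (EuclideanSpace ℝ ι)).comap (↑)) =
      ∫ z : USphere ι × Set.Ioi (0 : ℝ), polyFun p z.1 * ((z.2 : ℝ) ^ n * Real.exp (-(z.2 : ℝ) ^ 2))
        ∂(volume : Measure (EuclideanSpace ℝ ι)).toSphere.prod
          (Measure.volumeIoiPow (Module.finrank ℝ (EuclideanSpace ℝ ι) - 1)) := by
    rw [← (volume : Measure (EuclideanSpace ℝ ι)).measurePreserving_homeomorphUnitSphereProd.integral_comp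
      (Homeomorph.measurableEmbedding _)]
    refine integral_congr_ae (ae_of_all _ fun y => ?_)
    have hy : ‖(y : EuclideanSpace ℝ ι)‖ ≠ 0 := norm_ne_zero_iff.2 y.2
    have e : (y : EuclideanSpace ℝ ι) = ‖(y : EuclideanSpace ℝ ι)‖ •
        (‖(y : EuclideanSpace ℝ ι)‖⁻¹ • (y : EuclideanSpace ℝ ι)) := by
      rw [smul_smul, mul_inv_cancel₀ hy, one_smul]
    simp only [hF, homeomorphUnitSphereProd_apply_fst_coe, homeomorphUnitSphereProd_apply_snd_coe]
    conv_lhs => rw [e, polyFun_smul hp, ← e]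
    ring
  rw [← hF, h1, h2, integral_prod_mul (fun x : USphere ι => polyFun p x)
    (fun r : Set.Ioi (0 : ℝ) => (r : ℝ) ^ n * Real.exp (-(r : ℝ) ^ 2))]
  congr 1
  simp only [Measure.volumeIoiPow, ENNReal.ofReal]
  rw [integral_withDensity_eq_integral_smul, integral_subtype_comap measurableSet_Ioi
    fun a : ℝ => Real.toNNReal (a ^ (Module.finrank ℝ (EuclideanSpace ℝ ι) - 1)) •
      (a ^ n * Real.exp (-a ^ 2))]
  · have h3 := integral_rpow_mul_exp_neg_rpow (p := 2) (q := ((Fintype.card ι - 1 + n : ℕ) : ℝ))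
      two_pos (by
        have : (0 : ℝ) ≤ ((Fintype.card ι - 1 + n : ℕ) : ℝ) := by positivity
        linarith)
    have h4 : (((Fintype.card ι - 1 + n : ℕ) : ℝ) + 1) / 2 = (n + Fintype.card ι : ℝ) / 2 := by
      push_cast [Nat.cast_sub hpos]; ring
    rw [← h4, ← h3]
    refine setIntegral_congr_fun measurableSet_Ioi fun r hr => ?_
    have hr' : (0 : ℝ) < r := hr
    simp only [NNReal.smul_def, Real.coe_toNNReal _ (pow_nonneg hr'.le _), smul_eq_mul, hdim,
      Real.rpow_natCast, pow_add, Real.rpow_ofNat]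
    ring
  · exact (measurable_subtype_coe.pow_const _).real_toNNReal

lemma gaussian_stein {p : MvPolynomial ι ℝ} {n : ℕ} (hp : p.IsHomogeneous n) (i : ι) :
    2 * ∫ y, polyFun (MvPolynomial.X i * p) y * Real.exp (-‖y‖ ^ 2) =
      ∫ y, polyFun (MvPolynomial.pderiv i p) y * Real.exp (-‖y‖ ^ 2) := by
  classical
  have hX : (MvPolynomial.X i * p).IsHomogeneous (1 + n) := (MvPolynomial.isHomogeneous_X ℝ i).mul hp
  have e : ∀ y : EuclideanSpace ℝ ι, polyFun p y * -(2 * y i * Real.exp (-‖y‖ ^ 2)) =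
      (-2) * (polyFun (MvPolynomial.X i * p) y * Real.exp (-‖y‖ ^ 2)) := fun y => by
    simp only [polyFun, map_mul, MvPolynomial.eval_X]; ring
  have key := integral_bilinear_hasLineDerivAt_right_eq_neg_left_of_integrable
    (μ := (volume : Measure (EuclideanSpace ℝ ι))) (B := ContinuousLinearMap.mul ℝ ℝ)
    (f := polyFun p) (f' := polyFun (MvPolynomial.pderiv i p))
    (g := fun y => Real.exp (-‖y‖ ^ 2)) (g' := fun y => -(2 * y i * Real.exp (-‖y‖ ^ 2)))
    (v := EuclideanSpace.single i 1)
    (by simpa using integrable_polyFun_gaussian hp.pderiv)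
    (by simpa only [ContinuousLinearMap.mul_apply', e] using
      (integrable_polyFun_gaussian hX).const_mul (-2))
    (by simpa using integrable_polyFun_gaussian hp)
    (fun y _ => hasLineDerivAt_polyFun p y i) (fun y _ => hasLineDerivAt_gaussian y i)
  simp only [ContinuousLinearMap.mul_apply', e] at key
  rw [integral_const_mul] at key
  linarith

lemma toSphere_univ_pos : 0 < (volume : Measure (EuclideanSpace ℝ ι)).toSphere Set.univ := by
  rw [pos_iff_ne_zero, Ne, Measure.measure_univ_eq_zero]
  exact Measure.toSphere_ne_zero _

instance : IsProbabilityMeasure (uniformSphere ι) := by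
  refine ⟨?_⟩
  rw [uniformSphere, Measure.smul_apply, smul_eq_mul]
  exact ENNReal.inv_mul_cancel toSphere_univ_pos.ne' (measure_ne_top _ _)

instance : (uniformSphere ι).IsOpenPosMeasure := by
  refine ⟨fun U hU hne => ?_⟩
  rw [uniformSphere, Measure.smul_apply, smul_eq_mul]
  exact mul_ne_zero (ENNReal.inv_ne_zero.2 (measure_ne_top _ _)) (hU.measure_ne_zero _ hne)

lemma integrable_sphere {f : USphere ι → ℝ} (hf : Continuous f) :
    Integrable f (uniformSphere ι) :=
  hf.integrable_of_hasCompactSupport (HasCompactSupport.of_compactSpace f)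

/-- The mean of a polynomial over the sphere. -/
def sphereMean (p : MvPolynomial ι ℝ) : ℝ := ∫ x : USphere ι, polyFun p x ∂(uniformSphere ι)

lemma sphereMean_add (p q : MvPolynomial ι ℝ) :
    sphereMean (p + q) = sphereMean p + sphereMean q := by
  rw [sphereMean, sphereMean, sphereMean, ← integral_add
    (integrable_sphere (continuous_polyFun_sphere p))
    (integrable_sphere (continuous_polyFun_sphere q))]
  simp [polyFun]

lemma sphereMean_smul (a : ℝ) (p : MvPolynomial ι ℝ) :
    sphereMean (a • p) = a * sphereMean p := by
  rw [sphereMean, sphereMean, ← integral_const_mul]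
  simp [polyFun, MvPolynomial.smul_eval]

/-- The mean over the sphere as a linear functional. -/
def sphereMeanₗ : MvPolynomial ι ℝ →ₗ[ℝ] ℝ where
  toFun := sphereMean
  map_add' := sphereMean_add
  map_smul' := sphereMean_smul

lemma sphereMean_sum {α : Type*} (s : Finset α) (f : α → MvPolynomial ι ℝ) :
    sphereMean (∑ i ∈ s, f i) = ∑ i ∈ s, sphereMean (f i) :=
  map_sum sphereMeanₗ f s

/-- Integration by parts on the sphere. -/
lemma sphereMean_X_mul {p : MvPolynomial ι ℝ} {n : ℕ} (hp : p.IsHomogeneous n) (i : ι)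
    (hd : 2 ≤ Fintype.card ι) :
    ((n : ℝ) + Fintype.card ι - 1) * sphereMean (MvPolynomial.X i * p) =
      sphereMean (MvPolynomial.pderiv i p) := by
  have hX : (MvPolynomial.X i * p).IsHomogeneous (1 + n) := (MvPolynomial.isHomogeneous_X ℝ i).mul hp
  have hd' : (2 : ℝ) ≤ Fintype.card ι := by exact_mod_cast hd
  have h := gaussian_stein hp i
  rw [integral_polyFun_gaussian hX] at h
  have hm : ∀ p : MvPolynomial ι ℝ, sphereMean p =
      ((volume : Measure (EuclideanSpace ℝ ι)).toSphere Set.univ)⁻¹.toReal *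
      ∫ x : USphere ι, polyFun p x ∂(volume : Measure (EuclideanSpace ℝ ι)).toSphere := fun p => by
    rw [sphereMean, uniformSphere, integral_smul_measure, smul_eq_mul]
  rw [hm, hm]
  have hG : Real.Gamma ((((1 + n : ℕ) : ℝ) + Fintype.card ι) / 2) =
      (((n : ℝ) + Fintype.card ι - 1) / 2) * Real.Gamma (((n : ℝ) + Fintype.card ι - 1) / 2) := by
    rw [← Real.Gamma_add_one]
    · congr 1; push_cast; ring
    · have : (0 : ℝ) ≤ n := by positivity
      apply ne_of_gt; linarith
  rw [hG] at h
  have hGpos : 0 < Real.Gamma (((n : ℝ) + Fintype.card ι - 1) / 2) := by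
    have : (0 : ℝ) ≤ n := by positivity
    exact Real.Gamma_pos_of_pos (by linarith)
  rcases n with _ | n
  · obtain ⟨a, rfl⟩ : ∃ a, p = MvPolynomial.C a := by
      rw [← MvPolynomial.totalDegree_zero_iff_isHomogeneous,
        MvPolynomial.totalDegree_eq_zero_iff_eq_C] at hp
      exact ⟨_, hp⟩
    simp only [MvPolynomial.pderiv_C] at h ⊢
    simp only [polyFun, map_zero, zero_mul, integral_zero] at h ⊢
    have h5 := (mul_eq_zero.1 ((mul_eq_zero.1 h).resolve_left two_ne_zero)).resolve_right (by
      have : 0 < (((0 : ℕ) : ℝ) + Fintype.card ι - 1) := by push_cast; linarith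
      positivity)
    rw [h5]; ring
  · have hp' : (MvPolynomial.pderiv i p).IsHomogeneous n := by simpa using hp.pderiv (i := i)
    rw [integral_polyFun_gaussian hp', show ((n : ℝ) + Fintype.card ι) / 2 =
      (((n + 1 : ℕ) : ℝ) + Fintype.card ι - 1) / 2 by push_cast; ring] at h
    rw [mul_left_comm]
    congr 1
    refine mul_right_cancel₀ (mul_pos one_half_pos hGpos).ne' ?_
    rw [← h]
    ring

end SphereIntegral

/-! ### Zonal monomials acting on spherical harmonics -/

/-- The eigenvalue of the kernel `(x · x')ⁿ` on the spherical harmonics of degree `k` in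
dimension `d`. -/
def monomialEigenvalue (d : ℕ) : ℕ → ℕ → ℝ
  | 0, 0 => 1
  | 1, 0 => 0
  | n + 2, 0 => ((n : ℝ) + 1) / (n + d) * monomialEigenvalue d n 0
  | 0, _ + 1 => 0
  | n + 1, k + 1 => ((n : ℝ) + 1) / (n + 1 + k + d - 1) * monomialEigenvalue d n k

lemma monomialEigenvalue_nonneg {d : ℕ} (hd : 2 ≤ d) (n k : ℕ) :
    0 ≤ monomialEigenvalue d n k := by
  fun_induction monomialEigenvalue d n k with
  | case1 => norm_num
  | case2 => norm_num
  | case3 n ih => positivity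
  | case4 => norm_num
  | case5 n k ih =>
    refine mul_nonneg (div_nonneg (by positivity) ?_) ih
    linarith

lemma monomialEigenvalue_of_lt (d : ℕ) {n k : ℕ} (h : n < k) : monomialEigenvalue d n k = 0 := by
  induction k generalizing n with
  | zero => omega
  | succ k ih =>
    cases n with
    | zero => rw [monomialEigenvalue]
    | succ n => rw [monomialEigenvalue, ih (by omega), mul_zero]

lemma monomialEigenvalue_self_ne_zero {d : ℕ} (hd : 2 ≤ d) (k : ℕ) :
    monomialEigenvalue d k k ≠ 0 := by
  have hd' : (2 : ℝ) ≤ d := by exact_mod_cast hd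
  induction k with
  | zero => simp [monomialEigenvalue]
  | succ k ih =>
    rw [monomialEigenvalue]
    refine mul_ne_zero (div_ne_zero (by positivity) ?_) ih
    apply ne_of_gt; linarith

section Harmonic

variable {ι : Type} [Fintype ι]

/-- Harmonic homogeneous polynomials of degree `k`. -/
abbrev harmonicPoly (ι : Type) [Fintype ι] (k : ℕ) : Submodule ℝ (MvPolynomial ι ℝ) :=
  MvPolynomial.homogeneousSubmodule ι ℝ k ⊓ LinearMap.ker (polyLaplacian ι)

lemma polyLaplacian_apply (p : MvPolynomial ι ℝ) :
    polyLaplacian ι p = ∑ i, MvPolynomial.pderiv i (MvPolynomial.pderiv i p) := by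
  simp [polyLaplacian, LinearMap.sum_apply]

lemma mem_harmonicPoly {k : ℕ} {p : MvPolynomial ι ℝ} :
    p ∈ harmonicPoly ι k ↔ p.IsHomogeneous k ∧ polyLaplacian ι p = 0 := by
  rw [harmonicPoly, Submodule.mem_inf, MvPolynomial.mem_homogeneousSubmodule, LinearMap.mem_ker]

/-- The linear form `y ↦ x · y`. -/
def linForm (x : EuclideanSpace ℝ ι) : MvPolynomial ι ℝ :=
  ∑ i, MvPolynomial.C (x i) * MvPolynomial.X i

lemma linForm_isHomogeneous (x : EuclideanSpace ℝ ι) : (linForm x).IsHomogeneous 1 :=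
  MvPolynomial.IsHomogeneous.sum _ _ _ fun _ _ => MvPolynomial.isHomogeneous_C_mul_X _ _

lemma linForm_pow_isHomogeneous (x : EuclideanSpace ℝ ι) (n : ℕ) :
    (linForm x ^ n).IsHomogeneous n := by
  simpa using (linForm_isHomogeneous x).pow n

lemma polyFun_linForm (x y : EuclideanSpace ℝ ι) : polyFun (linForm x) y = inner ℝ x y := by
  simp [polyFun, linForm, PiLp.inner_apply, mul_comm]

lemma polyFun_linForm_pow (x y : EuclideanSpace ℝ ι) (n : ℕ) :
    polyFun (linForm x ^ n) y = inner ℝ x y ^ n := by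
  rw [← polyFun_linForm]; simp [polyFun]

lemma pderiv_linForm (x : EuclideanSpace ℝ ι) (i : ι) :
    MvPolynomial.pderiv i (linForm x) = MvPolynomial.C (x i) := by
  classical
  simp [linForm, MvPolynomial.pderiv_X, Pi.single_apply, Derivation.leibniz]

/-- The derivative of a polynomial in the direction `x`. -/
def dirDeriv (x : EuclideanSpace ℝ ι) (p : MvPolynomial ι ℝ) : MvPolynomial ι ℝ :=
  ∑ i, MvPolynomial.C (x i) * MvPolynomial.pderiv i p

lemma pderiv_comm' (i j : ι) (p : MvPolynomial ι ℝ) :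
    MvPolynomial.pderiv i (MvPolynomial.pderiv j p) =
      MvPolynomial.pderiv j (MvPolynomial.pderiv i p) := by
  classical
  have h : ⁅(MvPolynomial.pderiv i : Derivation ℝ (MvPolynomial ι ℝ) (MvPolynomial ι ℝ)),
      (MvPolynomial.pderiv j : Derivation ℝ (MvPolynomial ι ℝ) (MvPolynomial ι ℝ))⁆ = 0 := by
    refine MvPolynomial.derivation_ext fun k => ?_
    rw [Derivation.commutator_apply]
    simp only [MvPolynomial.pderiv_X, Pi.single_apply]
    split_ifs <;> simp
  have h2 := DFunLike.congr_fun h p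
  rw [Derivation.commutator_apply] at h2
  exact sub_eq_zero.1 h2

lemma dirDeriv_mem_harmonicPoly (x : EuclideanSpace ℝ ι) {k : ℕ} {p : MvPolynomial ι ℝ}
    (hp : p ∈ harmonicPoly ι (k + 1)) : dirDeriv x p ∈ harmonicPoly ι k := by
  rw [mem_harmonicPoly] at hp ⊢
  refine ⟨MvPolynomial.IsHomogeneous.sum _ _ _ fun i _ =>
    MvPolynomial.IsHomogeneous.C_mul (by simpa using hp.1.pderiv (i := i)) _, ?_⟩
  have h : polyLaplacian ι (dirDeriv x p) = dirDeriv x (polyLaplacian ι p) := by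
    simp only [polyLaplacian_apply, dirDeriv, map_sum, MvPolynomial.pderiv_C_mul,
      Finset.mul_sum]
    refine Finset.sum_congr rfl fun i _ => Finset.sum_congr rfl fun j _ => ?_
    rw [pderiv_comm' i j, pderiv_comm' i j]
  rw [h, hp.2]
  simp [dirDeriv]

lemma polyFun_dirDeriv (x : EuclideanSpace ℝ ι) {k : ℕ} {p : MvPolynomial ι ℝ}
    (hp : p.IsHomogeneous k) : polyFun (dirDeriv x p) x = k * polyFun p x := by
  have h := congrArg (MvPolynomial.eval fun i => x i) hp.sum_X_mul_pderiv
  simpa [polyFun, dirDeriv] using h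

variable [Nonempty ι]

lemma sphereMean_linForm_pow_mul (hd : 2 ≤ Fintype.card ι) {x : EuclideanSpace ℝ ι}
    (hx : ‖x‖ = 1) (n k : ℕ) {H : MvPolynomial ι ℝ} (hH : H ∈ harmonicPoly ι k) :
    sphereMean (linForm x ^ n * H) =
      monomialEigenvalue (Fintype.card ι) n k * polyFun H x := by
  have hd' : (2 : ℝ) ≤ Fintype.card ι := by exact_mod_cast hd
  have hxx : ∑ i, x i * x i = 1 := by
    have := EuclideanSpace.real_norm_sq_eq x
    rw [hx] at this
    simpa [sq] using this.symm
  induction k generalizing n H with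
  | zero =>
    obtain ⟨a, rfl⟩ : ∃ a, H = MvPolynomial.C a := by
      have h := (mem_harmonicPoly.1 hH).1
      rw [← MvPolynomial.totalDegree_zero_iff_isHomogeneous,
        MvPolynomial.totalDegree_eq_zero_iff_eq_C] at h
      exact ⟨_, h⟩
    rw [mul_comm, ← MvPolynomial.smul_eq_C_mul, sphereMean_smul,
      show polyFun (MvPolynomial.C a) x = a by simp [polyFun], mul_comm]
    congr 1
    have hstep : ∀ n, sphereMean (linForm x ^ (n + 1)) =
        ∑ i, x i * sphereMean (MvPolynomial.X i * linForm x ^ n) := fun n => by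
      rw [pow_succ', linForm, Finset.sum_mul, ← linForm, sphereMean_sum]
      refine Finset.sum_congr rfl fun i _ => ?_
      rw [mul_assoc, ← MvPolynomial.smul_eq_C_mul, sphereMean_smul]
    induction n using Nat.twoStepInduction with
    | zero =>
      simp [monomialEigenvalue, sphereMean, polyFun]
    | one =>
      rw [monomialEigenvalue, ← zero_add 1, hstep]
      refine Finset.sum_eq_zero fun i _ => ?_
      have h := sphereMean_X_mul (MvPolynomial.isHomogeneous_one ι ℝ) i hd
      have h0 : sphereMean (MvPolynomial.pderiv i (1 : MvPolynomial ι ℝ)) = 0 := by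
        simp [sphereMean, polyFun]
      rw [h0] at h
      rw [pow_zero, (mul_eq_zero.1 h).resolve_left (by push_cast; linarith), mul_zero]
    | more n ih _ =>
      rw [monomialEigenvalue, ← ih, hstep]
      have h1 : ∀ i, sphereMean (MvPolynomial.X i * linForm x ^ (n + 1)) =
          ((n : ℝ) + 1) / (n + Fintype.card ι) * (x i * sphereMean (linForm x ^ n)) := fun i => by
        have h := sphereMean_X_mul (linForm_pow_isHomogeneous x (n + 1)) i hd
        have h2 : MvPolynomial.pderiv i (linForm x ^ (n + 1)) =
            (((n : ℝ) + 1) * x i) • linForm x ^ n := by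
          rw [MvPolynomial.pderiv_pow, pderiv_linForm, MvPolynomial.smul_eq_C_mul]
          simp only [Nat.add_sub_cancel, map_mul, map_add, map_natCast, map_one]
          push_cast; ring
        rw [h2, sphereMean_smul] at h
        have h3 : (n : ℝ) + Fintype.card ι ≠ 0 := by positivity
        rw [div_mul_eq_mul_div, eq_div_iff h3]
        push_cast at h
        linear_combination h
      simp only [h1]
      have : ∀ i, x i * (((n : ℝ) + 1) / (n + Fintype.card ι) *
          (x i * sphereMean (linForm x ^ n))) =
          (x i * x i) * (((n : ℝ) + 1) / (n + Fintype.card ι) * sphereMean (linForm x ^ n)) :=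
        fun i => by ring
      simp only [this]
      rw [← Finset.sum_mul, hxx, one_mul]
  | succ k ih =>
    obtain ⟨hhom, hlap⟩ := mem_harmonicPoly.1 hH
    have hD : ∀ i, (MvPolynomial.pderiv i H).IsHomogeneous k := fun i => by
      simpa using hhom.pderiv (i := i)
    have h1 : ((k : ℝ) + 1) * sphereMean (linForm x ^ n * H) =
        ∑ i, sphereMean (MvPolynomial.X i * (linForm x ^ n * MvPolynomial.pderiv i H)) := by
      rw [← sphereMean_sum, ← sphereMean_smul]
      congr 1
      have h := hhom.sum_X_mul_pderiv
      rw [nsmul_eq_mul] at h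
      have e : ∑ i, MvPolynomial.X i * (linForm x ^ n * MvPolynomial.pderiv i H) =
          linForm x ^ n * ∑ i, MvPolynomial.X i * MvPolynomial.pderiv i H := by
        rw [Finset.mul_sum]; exact Finset.sum_congr rfl fun i _ => by ring
      rw [e, h, MvPolynomial.smul_eq_C_mul]
      simp only [map_add, map_natCast, map_one]
      push_cast; ring
    have h2 : ∀ i, ((n : ℝ) + k + Fintype.card ι - 1) *
        sphereMean (MvPolynomial.X i * (linForm x ^ n * MvPolynomial.pderiv i H)) =
        sphereMean ((n : ℝ) • (linForm x ^ (n - 1) * (MvPolynomial.C (x i) *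
          MvPolynomial.pderiv i H)) +
          linForm x ^ n * MvPolynomial.pderiv i (MvPolynomial.pderiv i H)) := fun i => by
      have h := sphereMean_X_mul ((linForm_pow_isHomogeneous x n).mul (hD i)) i hd
      push_cast at h
      rw [h]
      congr 1
      rw [MvPolynomial.pderiv_mul, MvPolynomial.pderiv_pow, pderiv_linForm,
        MvPolynomial.smul_eq_C_mul]
      simp only [map_natCast]
      ring
    have h3 : ((n : ℝ) + k + Fintype.card ι - 1) * (((k : ℝ) + 1) *
        sphereMean (linForm x ^ n * H)) = n * sphereMean (linForm x ^ (n - 1) * dirDeriv x H) := by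
      rw [h1, Finset.mul_sum]
      simp only [h2, sphereMean_add, sphereMean_smul]
      rw [Finset.sum_add_distrib, ← Finset.mul_sum, ← sphereMean_sum, ← sphereMean_sum,
        ← Finset.mul_sum, ← Finset.mul_sum, ← polyLaplacian_apply, hlap, mul_zero]
      have : sphereMean (0 : MvPolynomial ι ℝ) = 0 := by simp [sphereMean, polyFun]
      rw [this, add_zero, dirDeriv]
    have hk : (k : ℝ) + 1 ≠ 0 := by positivity
    have hc : (n : ℝ) + k + Fintype.card ι - 1 ≠ 0 := by
      apply ne_of_gt; linarith
    cases n with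
    | zero =>
      rw [monomialEigenvalue, zero_mul]
      simp only [Nat.cast_zero, zero_mul] at h3 hc
      exact (mul_eq_zero.1 ((mul_eq_zero.1 h3).resolve_left hc)).resolve_left hk
    | succ n =>
      rw [Nat.add_sub_cancel, ih n (dirDeriv_mem_harmonicPoly x hH), polyFun_dirDeriv x hhom] at h3
      rw [monomialEigenvalue]
      push_cast at h3 hc
      rw [div_mul_eq_mul_div, div_mul_eq_mul_div, eq_div_iff hc]
      refine mul_left_cancel₀ hk ?_
      linear_combination h3

/-- The Funk–Hecke formula for monomial kernels. -/
lemma integral_inner_pow_mul (hd : 2 ≤ Fintype.card ι) (n k : ℕ) {Y : USphere ι → ℝ}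
    (hY : Y ∈ sphericalHarmonics ι k) (x : USphere ι) :
    ∫ w : USphere ι, inner ℝ (x : EuclideanSpace ℝ ι) (w : EuclideanSpace ℝ ι) ^ n * Y w
      ∂(uniformSphere ι) = monomialEigenvalue (Fintype.card ι) n k * Y x := by
  obtain ⟨H, hH, rfl⟩ := hY
  have h := sphereMean_linForm_pow_mul hd (x := x) (by simp) n k hH
  rw [restrictToSphere_apply, ← h, sphereMean]
  refine integral_congr_ae (ae_of_all _ fun w => ?_)
  simp only [restrictToSphere_apply, ← polyFun_linForm_pow]
  simp [polyFun]

end Harmonic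

/-! ### Polynomials on the sphere are sums of spherical harmonics -/

section Decomposition

variable {ι : Type} [Fintype ι]

/-- The polynomial `|y|²`. -/
def normSqPoly (ι : Type) [Fintype ι] : MvPolynomial ι ℝ := ∑ i, MvPolynomial.X i ^ 2

lemma normSqPoly_isHomogeneous : (normSqPoly ι).IsHomogeneous 2 :=
  MvPolynomial.IsHomogeneous.sum _ _ _ fun i _ => MvPolynomial.isHomogeneous_X_pow i 2

lemma pderiv_normSqPoly (i : ι) :
    MvPolynomial.pderiv i (normSqPoly ι) = 2 * MvPolynomial.X i := by
  classical
  simp [normSqPoly, MvPolynomial.pderiv_X, Pi.single_apply]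

lemma polyLaplacian_normSqPoly_mul {u : MvPolynomial ι ℝ} {s : ℕ} (hu : u.IsHomogeneous s) :
    polyLaplacian ι (normSqPoly ι * u) =
      (2 * (Fintype.card ι : ℝ) + 4 * s) • u + normSqPoly ι * polyLaplacian ι u := by
  have h1 : ∀ i, MvPolynomial.pderiv i (MvPolynomial.pderiv i (normSqPoly ι * u)) =
      2 * u + 4 * (MvPolynomial.X i * MvPolynomial.pderiv i u) +
        normSqPoly ι * MvPolynomial.pderiv i (MvPolynomial.pderiv i u) := fun i => by
    rw [MvPolynomial.pderiv_mul, map_add, MvPolynomial.pderiv_mul, MvPolynomial.pderiv_mul,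
      pderiv_normSqPoly]
    have h2 : MvPolynomial.pderiv i (2 * MvPolynomial.X i : MvPolynomial ι ℝ) = 2 := by
      rw [show (2 : MvPolynomial ι ℝ) = MvPolynomial.C 2 from
        (map_ofNat MvPolynomial.C 2).symm, MvPolynomial.pderiv_C_mul,
        MvPolynomial.pderiv_X_self, mul_one]
    rw [h2]; ring
  simp only [polyLaplacian_apply, h1, Finset.sum_add_distrib, ← Finset.mul_sum,
    hu.sum_X_mul_pderiv, MvPolynomial.smul_eq_C_mul]
  have h2 : (MvPolynomial.C 2 : MvPolynomial ι ℝ) = 2 := map_ofNat MvPolynomial.C 2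
  have h4 : (MvPolynomial.C 4 : MvPolynomial ι ℝ) = 4 := map_ofNat MvPolynomial.C 4
  simp only [Finset.sum_const, Finset.card_univ, nsmul_eq_mul, map_add, map_mul, map_natCast,
    h2, h4]
  ring

lemma exists_polyLaplacian_normSqPoly_pow_mul [Nonempty ι] {m : ℕ} {h : MvPolynomial ι ℝ}
    (hh : h ∈ harmonicPoly ι m) (j : ℕ) :
    ∃ c : ℝ, 0 < c ∧ polyLaplacian ι (normSqPoly ι ^ (j + 1) * h) = c • (normSqPoly ι ^ j * h) := by
  obtain ⟨hm, hl⟩ := mem_harmonicPoly.1 hh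
  induction j with
  | zero =>
    refine ⟨2 * (Fintype.card ι : ℝ) + 4 * m, by positivity, ?_⟩
    rw [zero_add, pow_one, polyLaplacian_normSqPoly_mul hm, hl, mul_zero, add_zero, pow_zero,
      one_mul]
  | succ j ih =>
    obtain ⟨c, hc, e⟩ := ih
    refine ⟨2 * (Fintype.card ι : ℝ) + 4 * ((2 * (j + 1) + m : ℕ) : ℝ) + c, by positivity, ?_⟩
    rw [pow_succ', mul_assoc,
      polyLaplacian_normSqPoly_mul ((normSqPoly_isHomogeneous.pow (j + 1)).mul hm), e,
      mul_smul_comm, ← mul_assoc, ← pow_succ', ← add_smul]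

/-- Polynomials of degree `n` that are sums of products of powers of `|y|²` and harmonic
polynomials. -/
def harmonicSpan (ι : Type) [Fintype ι] (n : ℕ) : Submodule ℝ (MvPolynomial ι ℝ) :=
  Submodule.span ℝ {p | ∃ j m h, m + 2 * j = n ∧ h ∈ harmonicPoly ι m ∧ p = normSqPoly ι ^ j * h}

lemma isHomogeneous_of_mem_harmonicSpan {n : ℕ} {p : MvPolynomial ι ℝ}
    (hp : p ∈ harmonicSpan ι n) : p.IsHomogeneous n := by
  rw [← MvPolynomial.mem_homogeneousSubmodule]
  refine Submodule.span_le.2 ?_ hp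
  rintro _ ⟨j, m, h, rfl, hh, rfl⟩
  rw [SetLike.mem_coe, MvPolynomial.mem_homogeneousSubmodule, add_comm]
  exact (normSqPoly_isHomogeneous.pow j).mul (mem_harmonicPoly.1 hh).1

lemma exists_polyLaplacian_eq [Nonempty ι] {n : ℕ} {p : MvPolynomial ι ℝ}
    (hp : p ∈ harmonicSpan ι n) : ∃ r ∈ harmonicSpan ι (n + 2), polyLaplacian ι r = p := by
  suffices h : harmonicSpan ι n ≤ (harmonicSpan ι (n + 2)).map (polyLaplacian ι) by
    simpa using h hp
  refine Submodule.span_le.2 ?_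
  rintro _ ⟨j, m, h, rfl, hh, rfl⟩
  obtain ⟨c, hc, e⟩ := exists_polyLaplacian_normSqPoly_pow_mul hh j
  refine ⟨c⁻¹ • (normSqPoly ι ^ (j + 1) * h), Submodule.smul_mem _ _
    (Submodule.subset_span ⟨j + 1, m, h, by ring, hh, rfl⟩), ?_⟩
  rw [map_smul, e, smul_smul, inv_mul_cancel₀ hc.ne', one_smul]

lemma mem_harmonicSpan [Nonempty ι] {n : ℕ} {p : MvPolynomial ι ℝ} (hp : p.IsHomogeneous n) :
    p ∈ harmonicSpan ι n := by
  have hC : ∀ {q : MvPolynomial ι ℝ} i, q.IsHomogeneous 0 → MvPolynomial.pderiv i q = 0 := by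
    intro q i hq
    rw [← MvPolynomial.totalDegree_zero_iff_isHomogeneous,
      MvPolynomial.totalDegree_eq_zero_iff_eq_C] at hq
    rw [hq, MvPolynomial.pderiv_C]
  have hharm : ∀ {n : ℕ} {q : MvPolynomial ι ℝ}, q ∈ harmonicPoly ι n → q ∈ harmonicSpan ι n :=
    fun {n q} hq => Submodule.subset_span ⟨0, n, q, by simp, hq, by simp⟩
  induction n using Nat.twoStepInduction generalizing p with
  | zero =>
    refine hharm (mem_harmonicPoly.2 ⟨hp, ?_⟩)
    rw [polyLaplacian_apply]
    exact Finset.sum_eq_zero fun i _ => by rw [hC i hp, map_zero]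
  | one =>
    refine hharm (mem_harmonicPoly.2 ⟨hp, ?_⟩)
    rw [polyLaplacian_apply]
    exact Finset.sum_eq_zero fun i _ => hC i (by simpa using hp.pderiv (i := i))
  | more n ih _ =>
    have h1 : (polyLaplacian ι p).IsHomogeneous n := by
      rw [polyLaplacian_apply]
      exact MvPolynomial.IsHomogeneous.sum _ _ _ fun i _ => by
        simpa using (hp.pderiv (i := i)).pderiv (i := i)
    obtain ⟨r, hr, e⟩ := exists_polyLaplacian_eq (ih h1)
    rw [← sub_add_cancel p r]
    refine Submodule.add_mem _ (hharm (mem_harmonicPoly.2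
      ⟨hp.sub (isHomogeneous_of_mem_harmonicSpan hr), ?_⟩)) hr
    rw [map_sub, e, sub_self]

lemma restrictToSphere_mem_iSup [Nonempty ι] {n : ℕ} {p : MvPolynomial ι ℝ}
    (hp : p.IsHomogeneous n) :
    restrictToSphere ι p ∈ ⨆ k, sphericalHarmonics ι k := by
  suffices h : harmonicSpan ι n ≤ (⨆ k, sphericalHarmonics ι k).comap (restrictToSphere ι) from
    h (mem_harmonicSpan hp)
  refine Submodule.span_le.2 ?_
  rintro _ ⟨j, m, h, rfl, hh, rfl⟩
  have e : restrictToSphere ι (normSqPoly ι ^ j * h) = restrictToSphere ι h := by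
    ext x
    have hx : ∑ i, (x : EuclideanSpace ℝ ι) i ^ 2 = 1 := by
      rw [← EuclideanSpace.real_norm_sq_eq]; simp
    simp [restrictToSphere, normSqPoly, hx]
  rw [SetLike.mem_coe, Submodule.mem_comap, e]
  exact Submodule.mem_iSup_of_mem m ⟨h, hh, rfl⟩

lemma continuous_of_mem_sphericalHarmonics {k : ℕ} {Y : USphere ι → ℝ}
    (hY : Y ∈ sphericalHarmonics ι k) : Continuous Y := by
  obtain ⟨H, -, rfl⟩ := hY
  exact continuous_polyFun_sphere H

instance (k : ℕ) : FiniteDimensional ℝ (sphericalHarmonics ι k) := by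
  have : FiniteDimensional ℝ (MvPolynomial.homogeneousSubmodule ι ℝ k) :=
    Module.Finite.iff_fg.2 (MvPolynomial.homogeneousSubmodule_fg ι ℝ k)
  have : FiniteDimensional ℝ (harmonicPoly ι k) :=
    Submodule.finiteDimensional_of_le (inf_le_left : harmonicPoly ι k ≤ _)
  rw [sphericalHarmonics]
  infer_instance

end Decomposition

/-! ### Orthonormal bases of spherical harmonics -/

section Basis

variable {ι : Type} [Fintype ι] [Nonempty ι]

lemma eq_zero_of_integral_mul_self {f : USphere ι → ℝ} (hf : Continuous f)
    (h : ∫ x, f x * f x ∂(uniformSphere ι) = 0) : f = 0 := by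
  have h1 : (fun x => f x * f x) =ᵐ[uniformSphere ι] 0 :=
    (integral_eq_zero_iff_of_nonneg (fun x => mul_self_nonneg _)
      (integrable_sphere (hf.mul hf))).1 h
  have h2 := (hf.mul hf).ae_eq_iff_eq (uniformSphere ι) continuous_zero |>.1 h1
  ext x
  exact mul_self_eq_zero.1 (congrFun h2 x)

lemma integral_add_sphere {f g : USphere ι → ℝ} (hf : Continuous f) (hg : Continuous g) :
    ∫ x, f x + g x ∂(uniformSphere ι) =
      ∫ x, f x ∂(uniformSphere ι) + ∫ x, g x ∂(uniformSphere ι) :=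
  integral_add (integrable_sphere hf) (integrable_sphere hg)

lemma integral_sub_sphere {f g : USphere ι → ℝ} (hf : Continuous f) (hg : Continuous g) :
    ∫ x, f x - g x ∂(uniformSphere ι) =
      ∫ x, f x ∂(uniformSphere ι) - ∫ x, g x ∂(uniformSphere ι) :=
  integral_sub (integrable_sphere hf) (integrable_sphere hg)

/-- The inner product of `L²` on the spherical harmonics of degree `k`. -/
@[reducible] def harmonicCore (ι : Type) [Fintype ι] [Nonempty ι] (k : ℕ) :
    InnerProductSpace.Core ℝ (sphericalHarmonics ι k) where
  inner f g := ∫ x, f.1 x * g.1 x ∂(uniformSphere ι)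
  conj_inner_symm f g := by simp [mul_comm]
  re_inner_nonneg f := integral_nonneg fun x => mul_self_nonneg _
  add_left f g h := by
    have hc := fun f : sphericalHarmonics ι k => continuous_of_mem_sphericalHarmonics f.2
    simp only [Submodule.coe_add, Pi.add_apply, add_mul]
    exact integral_add (integrable_sphere ((hc f).mul (hc h)))
      (integrable_sphere ((hc g).mul (hc h)))
  smul_left f g r := by
    simp [mul_assoc, integral_const_mul]
  definite f hf := by
    ext1
    exact eq_zero_of_integral_mul_self (continuous_of_mem_sphericalHarmonics f.2) hf

theorem exists_isHarmonicBasis (ι : Type) [Fintype ι] [Nonempty ι] :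
    ∃ Y, IsHarmonicBasis ι Y := by
  have h : ∀ k, ∃ Y : Fin (numHarmonics ι k) → USphere ι → ℝ,
      (∀ j, Y j ∈ sphericalHarmonics ι k) ∧
      ∀ i j, ∫ x, Y i x * Y j x ∂(uniformSphere ι) = if i = j then 1 else 0 := fun k => by
    let _ := (harmonicCore ι k).toNormedAddCommGroup
    let _ := InnerProductSpace.ofCore (harmonicCore ι k).toCore
    let b := stdOrthonormalBasis ℝ (sphericalHarmonics ι k)
    exact ⟨fun j => (b j).1, fun j => (b j).2, fun i j =>
      (orthonormal_iff_ite.1 b.orthonormal) i j⟩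
  choose Y h1 h2 using h
  exact ⟨Y, h1, h2⟩

/-- The reproducing kernel of the spherical harmonics of degree `k`. -/
def zonal {N : ℕ} (Y : Fin N → USphere ι → ℝ) (x y : USphere ι) : ℝ := ∑ j, Y j x * Y j y

variable {Y : (k : ℕ) → Fin (numHarmonics ι k) → USphere ι → ℝ}

lemma IsHarmonicBasis.exists_repr (hY : IsHarmonicBasis ι Y) {k : ℕ} {h : USphere ι → ℝ}
    (hh : h ∈ sphericalHarmonics ι k) :
    ∃ c : Fin (numHarmonics ι k) → ℝ, h = ∑ j, c j • Y k j := by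
  have hc := fun j => continuous_of_mem_sphericalHarmonics (hY.mem k j)
  have hlin : LinearIndependent ℝ fun j =>
      (⟨Y k j, hY.mem k j⟩ : sphericalHarmonics ι k) := by
    rw [Fintype.linearIndependent_iff]
    intro c hsum i
    have h1 : ∀ x, ∑ j, c j * Y k j x = 0 := fun x => by
      have := congrFun (congrArg Subtype.val hsum) x
      simpa using this
    have h2 : ∫ x, (∑ j, c j * Y k j x) * Y k i x ∂(uniformSphere ι) = c i := by
      simp only [Finset.sum_mul, mul_assoc]
      rw [integral_finsetSum]
      · simp [integral_const_mul, hY.orthonormal]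
      · exact fun j _ => (integrable_sphere ((hc j).mul (hc i))).const_mul _
    rw [← h2]
    simp [h1]
  have hspan := hlin.span_eq_top_of_card_eq_finrank' (by
    rw [Fintype.card_fin, numHarmonics])
  have hmem : (⟨h, hh⟩ : sphericalHarmonics ι k) ∈ Submodule.span ℝ (Set.range fun j =>
      (⟨Y k j, hY.mem k j⟩ : sphericalHarmonics ι k)) := by rw [hspan]; trivial
  obtain ⟨c, hc⟩ := (Submodule.mem_span_range_iff_exists_fun ℝ).1 hmem
  refine ⟨c, ?_⟩
  have := congrArg Subtype.val hc
  simpa using this.symm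

lemma IsHarmonicBasis.integral_zonal_mul (hY : IsHarmonicBasis ι Y) {k : ℕ} {h : USphere ι → ℝ}
    (hh : h ∈ sphericalHarmonics ι k) (y : USphere ι) :
    ∫ x, zonal (Y k) x y * h x ∂(uniformSphere ι) = h y := by
  have hc := fun j => continuous_of_mem_sphericalHarmonics (hY.mem k j)
  obtain ⟨c, rfl⟩ := hY.exists_repr hh
  have e : ∀ x, zonal (Y k) x y * (∑ j, c j • Y k j) x =
      ∑ i, ∑ j, Y k i y * c j * (Y k i x * Y k j x) := fun x => by
    simp only [zonal, Finset.sum_apply, Pi.smul_apply, smul_eq_mul, Finset.sum_mul_sum]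
    exact Finset.sum_congr rfl fun i _ => Finset.sum_congr rfl fun j _ => by ring
  simp only [e]
  rw [integral_finsetSum]
  · have : ∀ i, ∫ x, ∑ j, Y k i y * c j * (Y k i x * Y k j x) ∂(uniformSphere ι) =
        Y k i y * c i := fun i => by
      rw [integral_finsetSum]
      · simp [integral_const_mul, hY.orthonormal]
      · exact fun j _ => (integrable_sphere ((hc i).mul (hc j))).const_mul _
    simp only [this, Finset.sum_apply, Pi.smul_apply, smul_eq_mul]
    exact Finset.sum_congr rfl fun i _ => mul_comm _ _
  · exact fun i _ => integrable_finsetSum _ fun j _ =>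
      (integrable_sphere ((hc i).mul (hc j))).const_mul _

/-- Spherical harmonics of different degrees are orthogonal. -/
lemma integral_mul_eq_zero_of_lt (hd : 2 ≤ Fintype.card ι) {k l : ℕ} (hkl : k < l)
    {f g : USphere ι → ℝ} (hf : f ∈ sphericalHarmonics ι k) (hg : g ∈ sphericalHarmonics ι l) :
    ∫ x, f x * g x ∂(uniformSphere ι) = 0 := by
  have hfc := continuous_of_mem_sphericalHarmonics hf
  have hgc := continuous_of_mem_sphericalHarmonics hg
  set ν := uniformSphere ι
  let F : USphere ι → USphere ι → ℝ := fun x w =>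
    inner ℝ (x : EuclideanSpace ℝ ι) (w : EuclideanSpace ℝ ι) ^ k * f w * g x
  have hFc : Continuous (Function.uncurry F) := by
    simp only [F, Function.uncurry_def]; fun_prop
  have hFi : Integrable (Function.uncurry F) (ν.prod ν) :=
    hFc.integrable_of_hasCompactSupport (HasCompactSupport.of_compactSpace _)
  have hswap := integral_integral_swap hFi
  have h1 : ∫ x, ∫ w, F x w ∂ν ∂ν =
      monomialEigenvalue (Fintype.card ι) k k * ∫ x, f x * g x ∂ν := by
    simp only [F]
    rw [← integral_const_mul]
    refine integral_congr_ae (ae_of_all _ fun x => ?_)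
    simp only
    rw [integral_mul_const, integral_inner_pow_mul hd k k hf x]; ring
  have h2 : ∫ w, ∫ x, F x w ∂ν ∂ν = 0 := by
    rw [← integral_zero (USphere ι) ℝ (μ := ν)]
    refine integral_congr_ae (ae_of_all _ fun w => ?_)
    have e : ∀ x : USphere ι, F x w = f w *
        (inner ℝ (w : EuclideanSpace ℝ ι) (x : EuclideanSpace ℝ ι) ^ k * g x) := fun x => by
      simp only [F]; rw [real_inner_comm]; ring
    simp only [e]
    rw [integral_const_mul, integral_inner_pow_mul hd k l hg w, monomialEigenvalue_of_lt _ hkl]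
    ring
  rw [h1, h2] at hswap
  exact (mul_eq_zero.1 hswap).resolve_left (monomialEigenvalue_self_ne_zero hd k)

lemma integral_mul_eq_zero_of_ne (hd : 2 ≤ Fintype.card ι) {k l : ℕ} (hkl : k ≠ l)
    {f g : USphere ι → ℝ} (hf : f ∈ sphericalHarmonics ι k) (hg : g ∈ sphericalHarmonics ι l) :
    ∫ x, f x * g x ∂(uniformSphere ι) = 0 := by
  rcases hkl.lt_or_gt with h | h
  · exact integral_mul_eq_zero_of_lt hd h hf hg
  · simp only [mul_comm (f _)]
    exact integral_mul_eq_zero_of_lt hd h hg hf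

lemma IsHarmonicBasis.zonal_mem (hY : IsHarmonicBasis ι Y) (k : ℕ) (y : USphere ι) :
    (fun x => zonal (Y k) x y) ∈ sphericalHarmonics ι k := by
  have : (fun x => zonal (Y k) x y) = ∑ j, Y k j y • Y k j := by
    ext x; simp [zonal, mul_comm]
  rw [this]
  exact Submodule.sum_mem _ fun j _ => Submodule.smul_mem _ _ (hY.mem k j)

/-- Expansion of the zonal monomials in spherical harmonics. -/
theorem IsHarmonicBasis.inner_pow_eq (hY : IsHarmonicBasis ι Y) (hd : 2 ≤ Fintype.card ι) (n : ℕ)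
    (x y : USphere ι) :
    inner ℝ (x : EuclideanSpace ℝ ι) (y : EuclideanSpace ℝ ι) ^ n =
      ∑ k ∈ Finset.range (n + 1), monomialEigenvalue (Fintype.card ι) n k * zonal (Y k) x y := by
  set lam := monomialEigenvalue (Fintype.card ι) n
  set p : USphere ι → ℝ := fun x =>
    inner ℝ (x : EuclideanSpace ℝ ι) (y : EuclideanSpace ℝ ι) ^ n with hp
  set s : USphere ι → ℝ := fun x =>
    ∑ k ∈ Finset.range (n + 1), lam k * zonal (Y k) x y with hs
  have hzc : ∀ k, Continuous fun x => zonal (Y k) x y := fun k =>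
    continuous_of_mem_sphericalHarmonics (hY.zonal_mem k y)
  have hpc : Continuous p := by fun_prop
  have hsc : Continuous s := continuous_finsetSum _ fun k _ => (hzc k).const_mul _
  have hpm : p ∈ ⨆ k, sphericalHarmonics ι k := by
    have : p = restrictToSphere ι (linForm (y : EuclideanSpace ℝ ι) ^ n) := by
      ext x
      rw [restrictToSphere_apply, polyFun_linForm_pow, hp, real_inner_comm]
    rw [this]
    exact restrictToSphere_mem_iSup (linForm_pow_isHomogeneous _ n)
  have hsm : s ∈ ⨆ k, sphericalHarmonics ι k := by
    have : s = ∑ k ∈ Finset.range (n + 1), lam k • fun x => zonal (Y k) x y := by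
      ext x; simp [hs]
    rw [this]
    exact Submodule.sum_mem _ fun k _ => Submodule.smul_mem _ _
      (Submodule.mem_iSup_of_mem k (hY.zonal_mem k y))
  have horth : ∀ l, ∀ h ∈ sphericalHarmonics ι l,
      ∫ x, (p - s) x * h x ∂(uniformSphere ι) = 0 := fun l h hh => by
    have hhc := continuous_of_mem_sphericalHarmonics hh
    have h1 : ∫ x, p x * h x ∂(uniformSphere ι) = lam l * h y := by
      rw [← integral_inner_pow_mul hd n l hh y]
      simp only [hp, real_inner_comm]
    have h2 : ∫ x, s x * h x ∂(uniformSphere ι) = lam l * h y := by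
      simp only [hs, Finset.sum_mul, mul_assoc]
      have hi : ∀ k ∈ Finset.range (n + 1),
          Integrable (fun x => lam k * (zonal (Y k) x y * h x)) (uniformSphere ι) := fun k _ =>
        (integrable_sphere ((hzc k).mul hhc)).const_mul _
      rw [integral_finsetSum _ hi]
      simp only [integral_const_mul]
      by_cases hl : l ∈ Finset.range (n + 1)
      · rw [Finset.sum_eq_single_of_mem l hl, hY.integral_zonal_mul hh y]
        intro k _ hkl
        rw [integral_mul_eq_zero_of_ne hd hkl (hY.zonal_mem k y) hh, mul_zero]
      · have hl' : n < l := by simpa [Nat.lt_succ_iff] using hl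
        rw [show lam l = 0 from monomialEigenvalue_of_lt _ hl', zero_mul]
        refine Finset.sum_eq_zero fun k hk => ?_
        rw [integral_mul_eq_zero_of_ne hd (fun e => hl (e ▸ hk) : k ≠ l) (hY.zonal_mem k y) hh, mul_zero]
    simp only [Pi.sub_apply, sub_mul]
    rw [integral_sub_sphere (f := fun x => p x * h x) (g := fun x => s x * h x) (hpc.mul hhc)
      (hsc.mul hhc), h1, h2,
      sub_self]
  have hall : ∀ g ∈ ⨆ k, sphericalHarmonics ι k,
      Continuous g ∧ ∫ x, (p - s) x * g x ∂(uniformSphere ι) = 0 := fun g hg => by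
    induction hg using Submodule.iSup_induction' with
    | mem l h hh => exact ⟨continuous_of_mem_sphericalHarmonics hh, horth l h hh⟩
    | zero => exact ⟨continuous_zero, by simp⟩
    | add f g _ _ hf hg =>
      refine ⟨hf.1.add hg.1, ?_⟩
      simp only [Pi.add_apply, mul_add]
      rw [integral_add_sphere (f := fun x => (p - s) x * f x) (g := fun x => (p - s) x * g x)
        ((hpc.sub hsc).mul hf.1) ((hpc.sub hsc).mul hg.1), hf.2, hg.2, add_zero]
  have h0 := eq_zero_of_integral_mul_self (hpc.sub hsc)
    (hall (p - s) (Submodule.sub_mem _ hpm hsm)).2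
  exact sub_eq_zero.1 (congrFun h0 x)

end Basis

/-! ### Zonal kernels given by power series -/

lemma monomialEigenvalue_le_one {d : ℕ} (hd : 2 ≤ d) (n k : ℕ) :
    monomialEigenvalue d n k ≤ 1 := by
  have hd' : (2 : ℝ) ≤ d := by exact_mod_cast hd
  fun_induction monomialEigenvalue d n k with
  | case1 => norm_num
  | case2 => norm_num
  | case3 n ih =>
    refine mul_le_one₀ ((div_le_one (by positivity)).2 (by linarith))
      (monomialEigenvalue_nonneg hd _ _) ih
  | case4 => norm_num
  | case5 n k ih =>
    exact mul_le_one₀ ((div_le_one (by linarith)).2 (by linarith))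
      (monomialEigenvalue_nonneg hd _ _) ih

/-- The eigenvalue of the zonal kernel with power series coefficients `b`. -/
def seriesEigenvalue (d : ℕ) (b : ℕ → ℝ) (k : ℕ) : ℝ := ∑' n, b n * monomialEigenvalue d n k

lemma hasSum_seriesEigenvalue {d : ℕ} (hd : 2 ≤ d) {b : ℕ → ℝ} (hb : ∀ n, 0 ≤ b n)
    (hs : Summable b) (k : ℕ) :
    HasSum (fun n => b n * monomialEigenvalue d n k) (seriesEigenvalue d b k) := by
  refine Summable.hasSum (Summable.of_nonneg_of_le
    (fun n => mul_nonneg (hb n) (monomialEigenvalue_nonneg hd n k)) (fun n => ?_) hs)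
  exact mul_le_of_le_one_right (hb n) (monomialEigenvalue_le_one hd n k)

/-- Interchange of summations in the expansion of a power series of zonal monomials. -/
lemma hasSum_triangular_swap {b : ℕ → ℝ} {lam : ℕ → ℕ → ℝ} {mu z zx zy : ℕ → ℝ} {t a : ℝ}
    (hb : ∀ n, 0 ≤ b n) (hs : Summable b) (hlam : ∀ n k, 0 ≤ lam n k)
    (hlt : ∀ {n k}, n < k → lam n k = 0) (hmu : ∀ k, HasSum (fun n => b n * lam n k) (mu k))
    (hzx : ∀ k, 0 ≤ zx k) (hzy : ∀ k, 0 ≤ zy k) (hz : ∀ k, |z k| ≤ 1 / 2 * (zx k + zy k))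
    (hx : ∀ n, ∑ k ∈ Finset.range (n + 1), lam n k * zx k = 1)
    (hy : ∀ n, ∑ k ∈ Finset.range (n + 1), lam n k * zy k = 1)
    (hxy : ∀ n, ∑ k ∈ Finset.range (n + 1), lam n k * z k = t ^ n)
    (ha : HasSum (fun n => b n * t ^ n) a) : HasSum (fun k => mu k * z k) a := by
  have hexp : ∀ (w : ℕ → ℝ) (n : ℕ), HasSum (fun k => b n * lam n k * w k)
      (b n * ∑ k ∈ Finset.range (n + 1), lam n k * w k) := fun w n => by
    have h0 : ∀ k ∉ Finset.range (n + 1), lam n k * w k = 0 := fun k hk => by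
      rw [hlt (by simpa using hk), zero_mul]
    have h1 : HasSum (fun k => lam n k * w k) _ := hasSum_sum_of_ne_finset_zero h0
    simpa only [mul_assoc] using h1.mul_left (b n)
  have hdiag : ∀ w : ℕ → ℝ, (∀ k, 0 ≤ w k) →
      (∀ n, ∑ k ∈ Finset.range (n + 1), lam n k * w k = 1) →
      Summable fun p : ℕ × ℕ => b p.1 * lam p.1 p.2 * w p.2 := fun w hw h1 => by
    have hnn : ∀ p : ℕ × ℕ, 0 ≤ b p.1 * lam p.1 p.2 * w p.2 := fun p =>
      mul_nonneg (mul_nonneg (hb _) (hlam _ _)) (hw _)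
    have ht : ∀ n, ∑' k, b n * lam n k * w k = b n := fun n => by
      rw [(hexp w n).tsum_eq, h1, mul_one]
    refine (summable_prod_of_nonneg hnn).2 ⟨fun n => (hexp w n).summable, ?_⟩
    simpa only [ht] using hs
  have hsum : Summable fun p : ℕ × ℕ => b p.1 * lam p.1 p.2 * z p.2 := by
    have hdom := ((hdiag zx hzx hx).add (hdiag zy hzy hy)).mul_left (1 / 2)
    refine Summable.of_norm_bounded hdom fun p => ?_
    have h0 : 0 ≤ b p.1 * lam p.1 p.2 := mul_nonneg (hb _) (hlam _ _)
    rw [norm_mul, Real.norm_eq_abs, Real.norm_eq_abs, abs_of_nonneg h0]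
    calc b p.1 * lam p.1 p.2 * |z p.2|
        ≤ b p.1 * lam p.1 p.2 * (1 / 2 * (zx p.2 + zy p.2)) :=
          mul_le_mul_of_nonneg_left (hz _) h0
      _ = _ := by ring
  have h1 := hsum.hasSum.prod_fiberwise (hexp z)
  simp only [hxy] at h1
  have h2 : HasSum (fun p : ℕ × ℕ => b p.1 * lam p.1 p.2 * z p.2) a := by
    rw [← h1.unique ha]
    exact hsum.hasSum
  have h3 : HasSum (fun p : ℕ × ℕ => b p.2 * lam p.2 p.1 * z p.1) a :=
    (Equiv.prodComm ℕ ℕ).hasSum_iff.2 h2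
  exact h3.prod_fiberwise fun k => (hmu k).mul_right (z k)

section

variable {ι : Type} [Fintype ι]

lemma inner_mem_Icc (x y : USphere ι) :
    inner ℝ (x : EuclideanSpace ℝ ι) (y : EuclideanSpace ℝ ι) ∈ Set.Icc (-1 : ℝ) 1 := by
  have h := abs_real_inner_le_norm (x : EuclideanSpace ℝ ι) (y : EuclideanSpace ℝ ι)
  rw [norm_eq_of_mem_sphere, norm_eq_of_mem_sphere, mul_one] at h
  exact abs_le.1 h

lemma inner_self_sphere (x : USphere ι) :
    inner ℝ (x : EuclideanSpace ℝ ι) (x : EuclideanSpace ℝ ι) = (1 : ℝ) := by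
  rw [real_inner_self_eq_norm_sq, norm_eq_of_mem_sphere, one_pow]

/-- Spherical harmonics diagonalise zonal kernels. -/
lemma integral_series_mul [Nonempty ι] (hd : 2 ≤ Fintype.card ι) {g : ℝ → ℝ} {b : ℕ → ℝ} (hb : ∀ n, 0 ≤ b n)
    (hs : Summable b) (hg : ∀ t ∈ Set.Icc (-1 : ℝ) 1, HasSum (fun n => b n * t ^ n) (g t))
    {k : ℕ} {Y : USphere ι → ℝ} (hY : Y ∈ sphericalHarmonics ι k) (x : USphere ι) :
    ∫ w : USphere ι, g (inner ℝ (x : EuclideanSpace ℝ ι) (w : EuclideanSpace ℝ ι)) * Y w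
      ∂(uniformSphere ι) = seriesEigenvalue (Fintype.card ι) b k * Y x := by
  have hYc := continuous_of_mem_sphericalHarmonics hY
  have key := hasSum_integral_of_dominated_convergence (μ := uniformSphere ι)
    (F := fun n w => b n * (inner ℝ (x : EuclideanSpace ℝ ι) (w : EuclideanSpace ℝ ι) ^ n * Y w))
    (f := fun w => g (inner ℝ (x : EuclideanSpace ℝ ι) (w : EuclideanSpace ℝ ι)) * Y w)
    (bound := fun n w => b n * |Y w|)
    (fun n => (by fun_prop : Continuous _).aestronglyMeasurable)
    (fun n => ae_of_all _ fun w => by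
      rw [norm_mul, norm_mul, Real.norm_eq_abs, Real.norm_eq_abs, Real.norm_eq_abs,
        abs_of_nonneg (hb n)]
      exact mul_le_mul_of_nonneg_left (mul_le_of_le_one_left (abs_nonneg _)
        (abs_pow_le_one_of_mem (inner_mem_Icc x w) n)) (hb n))
    (ae_of_all _ fun w => hs.mul_right _)
    (by
      simp only [tsum_mul_right]
      exact (integrable_sphere hYc.abs).const_mul _)
    (ae_of_all _ fun w => by
      simpa only [mul_assoc] using (hg _ (inner_mem_Icc x w)).mul_right (Y w))
  simp only [integral_const_mul, integral_inner_pow_mul hd _ k hY x] at key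
  refine key.unique ?_
  simpa only [mul_assoc] using (hasSum_seriesEigenvalue hd hb hs k).mul_right (Y x)

lemma abs_zonal_le {N : ℕ} (Y : Fin N → USphere ι → ℝ) (x y : USphere ι) :
    |zonal Y x y| ≤ 1 / 2 * (zonal Y x x + zonal Y y y) := by
  simp only [zonal]
  refine (Finset.abs_sum_le_sum_abs _ _).trans ?_
  rw [← Finset.sum_add_distrib, Finset.mul_sum]
  refine Finset.sum_le_sum fun j _ => ?_
  rw [abs_le]
  constructor <;> nlinarith [sq_nonneg (Y j x + Y j y), sq_nonneg (Y j x - Y j y)]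

/-- The expansion of a zonal kernel in spherical harmonics. -/
lemma IsHarmonicBasis.hasSum_series [Nonempty ι]
    {Y : (k : ℕ) → Fin (numHarmonics ι k) → USphere ι → ℝ}
    (hY : IsHarmonicBasis ι Y) (hd : 2 ≤ Fintype.card ι) {g : ℝ → ℝ} {b : ℕ → ℝ}
    (hb : ∀ n, 0 ≤ b n) (hs : Summable b)
    (hg : ∀ t ∈ Set.Icc (-1 : ℝ) 1, HasSum (fun n => b n * t ^ n) (g t)) (x y : USphere ι) :
    HasSum (fun k => seriesEigenvalue (Fintype.card ι) b k * ∑ j, Y k j x * Y k j y)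
      (g (inner ℝ (x : EuclideanSpace ℝ ι) (y : EuclideanSpace ℝ ι))) := by
  refine hasSum_triangular_swap hb hs (monomialEigenvalue_nonneg hd)
    (fun h => monomialEigenvalue_of_lt _ h) (hasSum_seriesEigenvalue hd hb hs)
    (z := fun k => zonal (Y k) x y) (zx := fun k => zonal (Y k) x x)
    (zy := fun k => zonal (Y k) y y)
    (fun k => Finset.sum_nonneg fun j _ => mul_self_nonneg _)
    (fun k => Finset.sum_nonneg fun j _ => mul_self_nonneg _)
    (fun k => abs_zonal_le (Y k) x y)
    (fun n => (by simpa [inner_self_sphere] using (hY.inner_pow_eq hd n x x).symm))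
    (fun n => (by simpa [inner_self_sphere] using (hY.inner_pow_eq hd n y y).symm))
    (fun n => (hY.inner_pow_eq hd n x y).symm) (hg _ (inner_mem_Icc x y))

end

/-! ### The Funk–Hecke formula -/

lemma one_sub_sq_pos {t : ℝ} (ht : t ∈ Set.Ioo (-1 : ℝ) 1) : 0 < 1 - t ^ 2 := by
  nlinarith [ht.1, ht.2]

lemma intervalIntegrable_one_sub_sq_rpow {e : ℝ} (he : -1 < e) :
    IntervalIntegrable (fun t : ℝ => (1 - t ^ 2) ^ e) volume (-1) 1 := by
  have h01 : IntervalIntegrable (fun t : ℝ => (1 - t ^ 2) ^ e) volume 0 1 := by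
    have h1 : IntervalIntegrable (fun t : ℝ => (1 - t) ^ e) volume 0 1 := by
      have := (intervalIntegral.intervalIntegrable_rpow' he (a := 1) (b := 0)).comp_sub_left 1
      simpa using this
    have h2 : ContinuousOn (fun t : ℝ => (1 + t) ^ e) (Set.uIcc 0 1) := by
      rw [Set.uIcc_of_le zero_le_one]
      exact ContinuousOn.rpow_const (by fun_prop) fun t ht => Or.inl (by linarith [ht.1])
    refine (h1.mul_continuousOn h2).congr fun t ht => ?_
    rw [Set.uIoc_of_le zero_le_one] at ht
    rw [← Real.mul_rpow (by linarith [ht.2]) (by linarith [ht.1])]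
    congr 1; ring
  have h10 : IntervalIntegrable (fun t : ℝ => (1 - t ^ 2) ^ e) volume (-1) 0 := by
    rw [IntervalIntegrable.iff_comp_neg]
    simpa using h01.symm
  exact h10.trans h01

/-- The polynomial factor of the `j`-th derivative of `(1 - t²)^β`. -/
def rodriguesPoly (β : ℝ) : ℕ → Polynomial ℝ
  | 0 => 1
  | j + 1 => (1 - Polynomial.X ^ 2) * Polynomial.derivative (rodriguesPoly β j) -
      Polynomial.C (2 * (β - j)) * Polynomial.X * rodriguesPoly β j

/-- The `j`-th derivative of `(1 - t²)^β`. -/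
def rodriguesFun (β : ℝ) (j : ℕ) (t : ℝ) : ℝ :=
  (1 - t ^ 2) ^ (β - j) * (rodriguesPoly β j).eval t

lemma hasDerivAt_rodriguesFun (β : ℝ) (j : ℕ) {t : ℝ} (ht : t ∈ Set.Ioo (-1 : ℝ) 1) :
    HasDerivAt (rodriguesFun β j) (rodriguesFun β (j + 1) t) t := by
  have hp := one_sub_sq_pos ht
  have h1 : HasDerivAt (fun s : ℝ => 1 - s ^ 2) (-(2 * t)) t := by
    simpa using (hasDerivAt_pow 2 t).const_sub 1
  have h2 := (h1.rpow_const (p := β - j) (Or.inl hp.ne')).mul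
    ((rodriguesPoly β j).hasDerivAt t)
  convert! h2 using 1
  have e : (1 - t ^ 2) ^ (β - j) = (1 - t ^ 2) ^ (β - j - 1) * (1 - t ^ 2) := by
    conv_rhs => rw [← Real.rpow_one (1 - t ^ 2), ← Real.rpow_mul hp.le, one_mul,
      ← Real.rpow_add hp, sub_add_cancel]
  rw [e]
  simp only [rodriguesFun, rodriguesPoly, Polynomial.eval_sub, Polynomial.eval_mul,
    Polynomial.eval_one, Polynomial.eval_pow, Polynomial.eval_X, Polynomial.eval_C, Nat.cast_succ,
    ← sub_sub]
  ring

lemma iteratedDeriv_one_sub_sq_rpow (β : ℝ) (j : ℕ) {t : ℝ} (ht : t ∈ Set.Ioo (-1 : ℝ) 1) :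
    iteratedDeriv j (fun s : ℝ => (1 - s ^ 2) ^ β) t = rodriguesFun β j t := by
  induction j generalizing t with
  | zero => simp [rodriguesFun, rodriguesPoly]
  | succ j ih =>
    rw [iteratedDeriv_succ]
    have : iteratedDeriv j (fun s : ℝ => (1 - s ^ 2) ^ β) =ᶠ[𝓝 t] rodriguesFun β j := by
      filter_upwards [isOpen_Ioo.mem_nhds ht] with s hs using ih hs
    rw [this.deriv_eq]
    exact (hasDerivAt_rodriguesFun β j ht).deriv

lemma intervalIntegrable_rodriguesFun {β : ℝ} {j : ℕ} (h : -1 < β - j) :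
    IntervalIntegrable (rodriguesFun β j) volume (-1) 1 :=
  (intervalIntegrable_one_sub_sq_rpow h).mul_continuousOn
    (rodriguesPoly β j).continuous.continuousOn

/-- Integration by parts against a derivative of `(1 - t²)^β`. -/
lemma integral_pow_mul_rodriguesFun_succ {β : ℝ} {j : ℕ} (h : 0 < β - j) (n : ℕ) :
    ∫ t in (-1 : ℝ)..1, t ^ n * rodriguesFun β (j + 1) t =
      -n * ∫ t in (-1 : ℝ)..1, t ^ (n - 1) * rodriguesFun β j t := by
  have hc : Continuous (rodriguesFun β j) := by
    unfold rodriguesFun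
    exact (Continuous.rpow_const (by fun_prop) fun t => Or.inr h.le).mul
      (rodriguesPoly β j).continuous
  have key := intervalIntegral.integral_mul_deriv_eq_deriv_mul_of_hasDerivAt
    (a := -1) (b := 1) (u := fun t : ℝ => t ^ n) (u' := fun t : ℝ => n * t ^ (n - 1))
    (v := rodriguesFun β j) (v' := rodriguesFun β (j + 1))
    (by fun_prop) hc.continuousOn (fun t _ => hasDerivAt_pow n t)
    (fun t ht => hasDerivAt_rodriguesFun β j (by simpa using ht))
    ((by fun_prop : Continuous _).intervalIntegrable _ _)
    (intervalIntegrable_rodriguesFun (by push_cast; linarith))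
  rw [key]
  have h1 : rodriguesFun β j 1 = 0 := by simp [rodriguesFun, Real.zero_rpow h.ne']
  have h2 : rodriguesFun β j (-1) = 0 := by simp [rodriguesFun, Real.zero_rpow h.ne']
  simp only [h1, h2, mul_zero, sub_zero, zero_sub, mul_assoc,
    intervalIntegral.integral_const_mul, neg_mul]

/-- The moments of the weight `(1 - t²)^β`. -/
def weightMoment (m : ℕ) (β : ℝ) : ℝ := ∫ t in (-1 : ℝ)..1, t ^ m * (1 - t ^ 2) ^ β

lemma integral_pow_mul_rodriguesFun {β : ℝ} (n j : ℕ) (h : -1 < β - j) :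
    ∫ t in (-1 : ℝ)..1, t ^ n * rodriguesFun β j t =
      (-1) ^ j * n.descFactorial j * weightMoment (n - j) β := by
  induction j generalizing n with
  | zero => simp [rodriguesFun, rodriguesPoly, weightMoment]
  | succ j ih =>
    push_cast at h
    rw [integral_pow_mul_rodriguesFun_succ (by linarith), ih _ (by linarith)]
    cases n with
    | zero => simp
    | succ n =>
      rw [Nat.succ_descFactorial_succ, Nat.add_sub_cancel, Nat.add_sub_add_right]
      push_cast; ring

lemma weightMoment_one {β : ℝ} (h : -1 < β) : weightMoment 1 β = 0 := by
  have key := integral_pow_mul_rodriguesFun (β := β + 1) 0 1 (by push_cast; linarith)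
  have e : ∀ t : ℝ, t ^ 0 * rodriguesFun (β + 1) 1 t =
      -(2 * (β + 1)) * (t ^ 1 * (1 - t ^ 2) ^ β) := fun t => by
    simp [rodriguesFun, rodriguesPoly]; ring
  simp only [e, intervalIntegral.integral_const_mul] at key
  have h0 : β + 1 ≠ 0 := by linarith
  simpa [h0, weightMoment] using key

lemma intervalIntegrable_pow_mul_weight {β : ℝ} (h : -1 < β) (m : ℕ) :
    IntervalIntegrable (fun t : ℝ => t ^ m * (1 - t ^ 2) ^ β) volume (-1) 1 :=
  (intervalIntegrable_one_sub_sq_rpow h).continuousOn_mul (by fun_prop)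

lemma weightMoment_add_one {β : ℝ} (h : -1 < β) (m : ℕ) :
    weightMoment m (β + 1) = weightMoment m β - weightMoment (m + 2) β := by
  simp only [weightMoment]
  rw [← intervalIntegral.integral_sub (intervalIntegrable_pow_mul_weight h m)
    (intervalIntegrable_pow_mul_weight h (m + 2))]
  refine intervalIntegral.integral_congr_Ioo_of_le (by norm_num) fun t ht => ?_
  rw [Real.rpow_add (one_sub_sq_pos ht), Real.rpow_one]
  ring

lemma weightMoment_add_two' {β : ℝ} (h : -1 < β) (m : ℕ) :
    2 * (β + 1) * weightMoment (m + 2) β = (m + 1) * weightMoment m (β + 1) := by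
  have key := integral_pow_mul_rodriguesFun (β := β + 1) (m + 1) 1 (by push_cast; linarith)
  have e : ∀ t : ℝ, t ^ (m + 1) * rodriguesFun (β + 1) 1 t =
      -(2 * (β + 1)) * (t ^ (m + 2) * (1 - t ^ 2) ^ β) := fun t => by
    simp [rodriguesFun, rodriguesPoly]; ring
  simp only [e, intervalIntegral.integral_const_mul] at key
  rw [← weightMoment] at key
  simp at key
  linarith

lemma weightMoment_add_two {β : ℝ} (h : -1 < β) (m : ℕ) :
    weightMoment (m + 2) β = (m + 1) / (m + 2 * β + 3) * weightMoment m β := by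
  have h1 := weightMoment_add_two' h m
  rw [weightMoment_add_one h] at h1
  have : (0 : ℝ) < m + 2 * β + 3 := by have : (0 : ℝ) ≤ m := by positivity
                                       linarith
  field_simp
  linarith

lemma weightMoment_succ_exponent {β : ℝ} (h : -1 < β) (m : ℕ) :
    weightMoment m (β + 1) = (2 * β + 2) / (m + 2 * β + 3) * weightMoment m β := by
  rw [weightMoment_add_one h, weightMoment_add_two h]
  have : (0 : ℝ) < m + 2 * β + 3 := by have : (0 : ℝ) ≤ m := by positivity
                                       linarith
  field_simp
  ring

lemma weightMoment_zero_neg_half : weightMoment 0 (-1 / 2) = Real.pi := by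
  have hd : ∀ t ∈ Set.Ioo (-1 : ℝ) 1, HasDerivAt Real.arcsin (t ^ 0 * (1 - t ^ 2) ^ (-1 / 2 : ℝ)) t :=
    fun t ht => by
    have := Real.hasDerivAt_arcsin ht.1.ne' ht.2.ne
    convert! this using 1
    rw [neg_div, Real.rpow_neg (one_sub_sq_pos ht).le, ← Real.sqrt_eq_rpow]
    simp
  rw [weightMoment, intervalIntegral.integral_eq_sub_of_hasDerivAt_of_le (by norm_num)
    Real.continuous_arcsin.continuousOn hd (intervalIntegrable_pow_mul_weight (by norm_num) 0)]
  simp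

lemma sphereArea_ratio (s : ℝ) :
    sphereArea (s - 1) / sphereArea s =
      (√Real.pi)⁻¹ * (Real.Gamma (s / 2) / Real.Gamma ((s - 1) / 2)) := by
  have hp := Real.pi_pos
  have e : Real.pi ^ (s / 2) = Real.pi ^ ((s - 1) / 2) * √Real.pi := by
    rw [Real.sqrt_eq_rpow, ← Real.rpow_add hp]; congr 1; ring
  rw [sphereArea, sphereArea, e, div_div_div_eq]
  by_cases hg : Real.Gamma ((s - 1) / 2) = 0
  · simp [hg]
  · field_simp

lemma sphereArea_mul_weightMoment {d : ℕ} (hd : 2 ≤ d) :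
    sphereArea ((d : ℝ) - 1) / sphereArea d * weightMoment 0 (((d : ℝ) - 3) / 2) = 1 := by
  induction d using Nat.strong_induction_on with
  | _ d ih =>
    obtain rfl | rfl | ⟨e, rfl, he⟩ : d = 2 ∨ d = 3 ∨ ∃ e, d = e + 2 ∧ 2 ≤ e := by
      by_cases h2 : d = 2
      · exact Or.inl h2
      by_cases h3 : d = 3
      · exact Or.inr (Or.inl h3)
      · exact Or.inr (Or.inr ⟨d - 2, by omega, by omega⟩)
    · rw [sphereArea_ratio]
      have e1 : (((2 : ℕ) : ℝ) - 3) / 2 = -1 / 2 := by norm_num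
      have e2 : (((2 : ℕ) : ℝ) - 1) / 2 = 1 / 2 := by norm_num
      have e3 : ((2 : ℕ) : ℝ) / 2 = 1 := by norm_num
      rw [e1, e2, e3, weightMoment_zero_neg_half, Real.Gamma_one, Real.Gamma_one_half_eq]
      have hp := Real.pi_pos
      have := Real.mul_self_sqrt hp.le
      have h2 : √Real.pi ≠ 0 := (Real.sqrt_pos.2 hp).ne'
      field_simp
      linarith
    · rw [sphereArea_ratio]
      have e1 : (((3 : ℕ) : ℝ) - 3) / 2 = 0 := by norm_num
      have e2 : (((3 : ℕ) : ℝ) - 1) / 2 = 1 := by norm_num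
      have e3 : ((3 : ℕ) : ℝ) / 2 = 1 / 2 + 1 := by norm_num
      rw [e1, e2, e3, Real.Gamma_one, Real.Gamma_add_one (by norm_num), Real.Gamma_one_half_eq]
      simp [weightMoment]
      field_simp
      norm_num
    · have hi := ih e (by omega) he
      have he' : (2 : ℝ) ≤ e := by exact_mod_cast he
      rw [sphereArea_ratio] at hi ⊢
      push_cast
      have e1 : ((e : ℝ) + 2 - 3) / 2 = (e - 3) / 2 + 1 := by ring
      have e2 : ((e : ℝ) + 2 - 1) / 2 = (e - 1) / 2 + 1 := by ring
      have e3 : ((e : ℝ) + 2) / 2 = e / 2 + 1 := by ring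
      rw [e1, e2, e3, weightMoment_succ_exponent (by linarith), Real.Gamma_add_one (by linarith),
        Real.Gamma_add_one (by linarith)]
      refine Eq.trans ?_ hi
      have h3 : (e : ℝ) - 1 ≠ 0 := by linarith
      have e4 : 2 * (((e : ℝ) - 3) / 2) + 2 = e - 1 := by ring
      have e5 : ((0 : ℕ) : ℝ) + 2 * (((e : ℝ) - 3) / 2) + 3 = e := by push_cast; ring
      rw [e4, e5]
      generalize Real.Gamma (((e : ℝ) - 1) / 2) = G at *
      field_simp

/-- The constant in front of `∫ g R_k` in the Funk–Hecke formula, `R_k` being the `k`-th derivative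
of `(1 - t²)^(k + (d - 3) / 2)`. -/
def funkHeckeConst (d k : ℕ) : ℝ :=
  sphereArea ((d : ℝ) - 1) / sphereArea d *
    ((-1 / 2) ^ k * (Real.Gamma (((d : ℝ) - 1) / 2) / Real.Gamma ((k : ℝ) + ((d : ℝ) - 1) / 2)))

lemma funkHecke_eq (d : ℕ) (g : ℝ → ℝ) (k : ℕ) :
    funkHecke d g k = funkHeckeConst d k *
      ∫ t in (-1 : ℝ)..1, g t * rodriguesFun ((k : ℝ) + ((d : ℝ) - 3) / 2) k t := by
  rw [funkHecke, funkHeckeConst, mul_assoc (sphereArea _ / _)]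
  refine congrArg _ ?_
  rw [← intervalIntegral.integral_const_mul]
  refine intervalIntegral.integral_congr_Ioo_of_le (by norm_num : (-1 : ℝ) ≤ 1) fun t ht => ?_
  rw [legendreP, iteratedDeriv_one_sub_sq_rpow _ _ ht]
  have h : (1 - t ^ 2) ^ ((3 - (d : ℝ)) / 2) * (1 - t ^ 2) ^ (((d : ℝ) - 3) / 2) = 1 := by
    rw [← Real.rpow_add (one_sub_sq_pos ht), ← add_div]; simp
  linear_combination (g t * ((-1 / 2) ^ k * (Real.Gamma (((d : ℝ) - 1) / 2) /
    Real.Gamma ((k : ℝ) + ((d : ℝ) - 1) / 2))) *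
      rodriguesFun ((k : ℝ) + ((d : ℝ) - 3) / 2) k t) * h

lemma funkHecke_pow {d : ℕ} (hd : 2 ≤ d) (n k : ℕ) :
    funkHecke d (fun t => t ^ n) k = monomialEigenvalue d n k := by
  have hd' : (2 : ℝ) ≤ d := by exact_mod_cast hd
  have key : ∀ n k, funkHecke d (fun t => t ^ n) k = (-1) ^ k * funkHeckeConst d k *
      n.descFactorial k * weightMoment (n - k) ((k : ℝ) + ((d : ℝ) - 3) / 2) := fun n k => by
    rw [funkHecke_eq, integral_pow_mul_rodriguesFun n k (by linarith)]; ring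
  have hC : ∀ k, (-1) ^ (k + 1) * funkHeckeConst d (k + 1) =
      (-1) ^ k * funkHeckeConst d k / (2 * k + d - 1) := fun k => by
    have hk : (0 : ℝ) ≤ k := by positivity
    have e : ((k + 1 : ℕ) : ℝ) + ((d : ℝ) - 1) / 2 = (k + ((d : ℝ) - 1) / 2) + 1 := by
      push_cast; ring
    have hp : 0 < (k : ℝ) + ((d : ℝ) - 1) / 2 := by linarith
    have hg := (Real.Gamma_pos_of_pos hp).ne'
    have h2 : 2 * (k : ℝ) + d - 1 ≠ 0 := by linarith
    have h3 : (k : ℝ) + ((d : ℝ) - 1) / 2 = (2 * k + d - 1) / 2 := by ring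
    rw [funkHeckeConst, funkHeckeConst, e, Real.Gamma_add_one hp.ne', pow_succ, pow_succ]
    generalize Real.Gamma ((k : ℝ) + ((d : ℝ) - 1) / 2) = G at *
    rw [h3]
    field_simp
  fun_induction monomialEigenvalue d n k with
  | case1 =>
    rw [key]
    have := sphereArea_mul_weightMoment hd
    have hg : Real.Gamma (((d : ℝ) - 1) / 2) ≠ 0 := (Real.Gamma_pos_of_pos (by linarith)).ne'
    simpa [funkHeckeConst, hg] using this
  | case2 => rw [key]; simp [weightMoment_one (show -1 < ((d : ℝ) - 3) / 2 by linarith)]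
  | case3 n ih =>
    rw [← ih, key, key]
    simp only [Nat.sub_zero, Nat.descFactorial_zero, Nat.cast_zero, zero_add]
    rw [weightMoment_add_two (by linarith)]
    have : (n : ℝ) + 2 * (((d : ℝ) - 3) / 2) + 3 = n + d := by ring
    rw [this]; ring
  | case4 => rw [key]; simp
  | case5 n k ih =>
    rw [← ih, key, key, hC, Nat.succ_descFactorial_succ, Nat.succ_sub_succ]
    have e : ((k + 1 : ℕ) : ℝ) + ((d : ℝ) - 3) / 2 = (k + ((d : ℝ) - 3) / 2) + 1 := by
      push_cast; ring
    rw [e, weightMoment_succ_exponent (by linarith)]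
    rcases lt_or_ge n k with hnk | hnk
    · simp [Nat.descFactorial_eq_zero_iff_lt.2 hnk]
    · have e1 : ((n - k : ℕ) : ℝ) + 2 * (k + ((d : ℝ) - 3) / 2) + 3 = n + 1 + k + d - 1 := by
        push_cast [hnk]; ring
      have e2 : 2 * ((k : ℝ) + ((d : ℝ) - 3) / 2) + 2 = 2 * k + d - 1 := by ring
      rw [e1, e2]
      have h1 : 2 * (k : ℝ) + d - 1 ≠ 0 := by linarith
      push_cast
      field_simp

lemma intervalIntegrable_funkHecke_kernel {d : ℕ} (hd : 2 ≤ d) (k : ℕ) :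
    IntervalIntegrable (rodriguesFun ((k : ℝ) + ((d : ℝ) - 3) / 2) k) volume (-1) 1 := by
  have hd' : (2 : ℝ) ≤ d := by exact_mod_cast hd
  exact intervalIntegrable_rodriguesFun (by linarith)

/-- The Funk–Hecke eigenvalue of a power series. -/
lemma funkHecke_series {d : ℕ} (hd : 2 ≤ d) {g : ℝ → ℝ} {b : ℕ → ℝ} (hb : ∀ n, 0 ≤ b n)
    (hs : Summable b) (hg : ∀ t ∈ Set.Icc (-1 : ℝ) 1, HasSum (fun n => b n * t ^ n) (g t)) (k : ℕ) :
    funkHecke d g k = seriesEigenvalue d b k := by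
  set R := rodriguesFun ((k : ℝ) + ((d : ℝ) - 3) / 2) k with hR
  have hRi : IntervalIntegrable R volume (-1) 1 := intervalIntegrable_funkHecke_kernel hd k
  have hmem : ∀ t ∈ Set.uIoc (-1 : ℝ) 1, t ∈ Set.Icc (-1 : ℝ) 1 := fun t ht => by
    rw [Set.uIoc_of_le (by norm_num)] at ht
    exact ⟨ht.1.le, ht.2⟩
  have key := intervalIntegral.hasSum_integral_of_dominated_convergence (μ := volume)
    (a := -1) (b := 1) (F := fun n t => b n * (t ^ n * R t)) (f := fun t => g t * R t)
    (fun n t => b n * |R t|)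
    (fun n => by
      have h1 : IntervalIntegrable (fun t => b n * (t ^ n * R t)) volume (-1) 1 :=
        (hRi.continuousOn_mul (g := fun t : ℝ => t ^ n) (by fun_prop)).const_mul (b n)
      exact h1.def'.aestronglyMeasurable)
    (fun n => ae_of_all _ fun t ht => by
      rw [norm_mul, norm_mul, Real.norm_eq_abs, Real.norm_eq_abs, Real.norm_eq_abs,
        abs_of_nonneg (hb n)]
      exact mul_le_mul_of_nonneg_left (mul_le_of_le_one_left (abs_nonneg _)
        (abs_pow_le_one_of_mem (hmem t ht) n)) (hb n))
    (ae_of_all _ fun t _ => hs.mul_right _)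
    (by simp only [tsum_mul_right]; exact hRi.abs.const_mul _)
    (ae_of_all _ fun t ht => by
      simpa only [mul_assoc] using (hg t (hmem t ht)).mul_right (R t))
  simp only [intervalIntegral.integral_const_mul] at key
  have key2 := key.mul_left (funkHeckeConst d k)
  rw [hR, ← funkHecke_eq] at key2
  refine key2.unique ((hasSum_seriesEigenvalue hd hb hs k).congr_fun fun n => ?_)
  rw [← funkHecke_pow hd, funkHecke_eq]; ring

/-- Limits of Funk–Hecke eigenvalues along functions tending to a constant. -/
lemma tendsto_funkHecke {d : ℕ} (hd : 2 ≤ d) {g : ℕ → ℝ → ℝ} {a C e : ℝ}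
    (hc : ∀ᶠ L in atTop, ContinuousOn (g L) (Set.Icc (-1) 1))
    (hlim : ∀ t ∈ Set.Ioo (-1 : ℝ) 1, Tendsto (fun L => g L t) atTop (𝓝 a))
    (hbd : ∀ᶠ L in atTop, ∀ t ∈ Set.Ioo (-1 : ℝ) 1, |g L t| ≤ C * (1 - t ^ 2) ^ (-e))
    (he : -1 < ((d : ℝ) - 3) / 2 - e) (k : ℕ) :
    Tendsto (fun L => funkHecke d (g L) k) atTop (𝓝 (if k = 0 then a else 0)) := by
  have hval : (if k = 0 then a else 0) = funkHecke d (fun _ => a) k := by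
    have h1 := funkHecke_pow hd 0 k
    rw [funkHecke_eq] at h1 ⊢
    simp only [pow_zero, one_mul] at h1
    simp only [intervalIntegral.integral_const_mul]
    rw [mul_left_comm, h1]
    cases k <;> simp [monomialEigenvalue]
  rw [hval]
  simp only [funkHecke_eq]
  refine Tendsto.const_mul _ ?_
  set R := rodriguesFun ((k : ℝ) + ((d : ℝ) - 3) / 2) k with hR
  have hRi : IntervalIntegrable R volume (-1) 1 := intervalIntegrable_funkHecke_kernel hd k
  have hae : ∀ᵐ t : ℝ ∂volume, t ∈ Set.uIoc (-1 : ℝ) 1 → t ∈ Set.Ioo (-1 : ℝ) 1 := by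
    have : ∀ᵐ t : ℝ ∂volume, t ≠ 1 := by simp [ae_iff]
    filter_upwards [this] with t h1 ht
    rw [Set.uIoc_of_le (by norm_num)] at ht
    exact ⟨ht.1, lt_of_le_of_ne ht.2 h1⟩
  refine intervalIntegral.tendsto_integral_filter_of_dominated_convergence
    (fun t => C * ((1 - t ^ 2) ^ (((d : ℝ) - 3) / 2 - e) *
      |(rodriguesPoly ((k : ℝ) + ((d : ℝ) - 3) / 2) k).eval t|)) ?_ ?_ ?_ ?_
  · filter_upwards [hc] with L hL
    have h1 := hRi.continuousOn_mul (g := g L)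
      (by rw [Set.uIcc_of_le (by norm_num : (-1 : ℝ) ≤ 1)]; exact hL)
    exact h1.def'.aestronglyMeasurable
  · filter_upwards [hbd] with L hL
    filter_upwards [hae] with t ht ht'
    have hp := one_sub_sq_pos (ht ht')
    rw [norm_mul, Real.norm_eq_abs, Real.norm_eq_abs]
    refine (mul_le_mul_of_nonneg_right (hL t (ht ht')) (abs_nonneg _)).trans_eq ?_
    rw [hR, rodriguesFun, abs_mul, abs_of_pos (Real.rpow_pos_of_pos hp _), add_sub_cancel_left,
      sub_eq_add_neg (_ / _ : ℝ), Real.rpow_add hp]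
    ring
  · refine IntervalIntegrable.const_mul ?_ C
    exact (intervalIntegrable_one_sub_sq_rpow he).mul_continuousOn
      (Polynomial.continuous _).abs.continuousOn
  · filter_upwards [hae] with t ht ht'
    exact (hlim t (ht ht')).mul_const _

/-! ### The covariance maps as power series -/

lemma Activation.abs_fn_le (φ : Activation) (x : ℝ) : |φ.fn x| ≤ 1 + |x| := by
  cases φ with
  | relu =>
    have h : |max x 0| ≤ |x| := by
      rw [abs_of_nonneg (le_max_right x 0)]
      exact max_le (le_abs_self x) (abs_nonneg x)
    simp only [Activation.fn]
    linarith
  | tanh =>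
    have := (Real.abs_tanh_lt_one x).le
    simp only [Activation.fn]
    linarith [abs_nonneg x]

lemma continuous_tanh : Continuous Real.tanh := by
  simp only [funext Real.tanh_eq_sinh_div_cosh]
  exact Real.continuous_sinh.div Real.continuous_cosh fun x => (Real.cosh_pos x).ne'

lemma Activation.measurable_fn (φ : Activation) : Measurable φ.fn := by
  cases φ with
  | relu => exact measurable_id.max measurable_const
  | tanh => exact continuous_tanh.measurable

lemma Activation.measurable_dfn (φ : Activation) : Measurable φ.dfn := by
  cases φ with
  | relu => exact Measurable.ite measurableSet_Ioi measurable_const measurable_const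
  | tanh => exact measurable_const.sub (continuous_tanh.measurable.pow_const 2)

lemma Activation.abs_dfn_le (φ : Activation) (x : ℝ) : |φ.dfn x| ≤ 1 := by
  cases φ with
  | relu => simp only [Activation.dfn]; split_ifs <;> simp
  | tanh =>
    have h := Real.abs_tanh_lt_one x
    have h2 : Real.tanh x ^ 2 ≤ 1 := by rw [← sq_abs]; exact pow_le_one₀ (abs_nonneg _) h.le
    simp only [Activation.dfn]
    rw [abs_le]
    constructor <;> nlinarith [sq_nonneg (Real.tanh x)]

lemma memLp_two_of_abs_le_add {f : ℝ → ℝ} (hm : Measurable f) (h : ∀ x, |f x| ≤ 1 + |x|) (a : ℝ) :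
    MemLp (fun x => f (a * x)) 2 stdGaussian := by
  have h1 : MemLp (fun x : ℝ => 1 + |a| * |x|) 2 stdGaussian := by
    have h2 : MemLp (fun x : ℝ => x) 2 stdGaussian := by simpa using memLp_pow 1 2 (by simp)
    have h3 : MemLp (fun x : ℝ => |x|) 2 stdGaussian := h2.norm
    have h4 : MemLp (fun x : ℝ => |a| * |x|) 2 stdGaussian := h3.const_mul |a|
    exact (memLp_const (1 : ℝ)).add h4
  refine h1.mono (hm.comp (measurable_const_mul a)).aestronglyMeasurable (ae_of_all _ fun x => ?_)
  rw [Real.norm_eq_abs, Real.norm_eq_abs]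
  refine (h (a * x)).trans ((le_of_eq ?_).trans (le_abs_self _))
  rw [abs_mul]

lemma Activation.memLp_fn (φ : Activation) (a : ℝ) :
    MemLp (fun x => φ.fn (a * x)) 2 stdGaussian :=
  memLp_two_of_abs_le_add φ.measurable_fn φ.abs_fn_le a

lemma Activation.memLp_dfn (φ : Activation) (a : ℝ) :
    MemLp (fun x => φ.dfn (a * x)) 2 stdGaussian :=
  memLp_two_of_abs_le_add φ.measurable_dfn
    (fun x => (φ.abs_dfn_le x).trans (by linarith [abs_nonneg x])) a

lemma Real_tanh_pos {x : ℝ} (hx : 0 < x) : 0 < Real.tanh x := by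
  rw [Real.tanh_eq_sinh_div_cosh]
  exact div_pos (Real.sinh_pos_iff.2 hx) (Real.cosh_pos x)

lemma Activation.fn_pos (φ : Activation) {x : ℝ} (hx : 0 < x) : 0 < φ.fn x := by
  cases φ with
  | relu => exact lt_max_of_lt_left hx
  | tanh => exact Real_tanh_pos hx

lemma Activation.mul_fn_nonneg (φ : Activation) (x : ℝ) : 0 ≤ x * φ.fn x := by
  rcases lt_trichotomy x 0 with hx | rfl | hx
  · cases φ with
    | relu => simp [Activation.fn, max_eq_right hx.le]
    | tanh =>
      have := Real_tanh_pos (neg_pos.2 hx)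
      rw [Real.tanh_neg] at this
      exact mul_nonneg_of_nonpos_of_nonpos hx.le (by simp only [Activation.fn]; linarith)
  · simp
  · exact (mul_pos hx (φ.fn_pos hx)).le

lemma hermiteCoeff_zero (f : ℝ → ℝ) : hermiteCoeff f 0 = ∫ x, f x ∂stdGaussian := by
  simp [hermiteCoeff, hermiteN, hermiteR_zero]

lemma hermiteCoeff_one (f : ℝ → ℝ) : hermiteCoeff f 1 = ∫ x, x * f x ∂stdGaussian := by
  simp [hermiteCoeff, hermiteN, hermiteR_succ, hermiteR_zero]

lemma stdGaussian_Ioi_pos : 0 < stdGaussian (Set.Ioi 0) := by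
  rw [pos_iff_ne_zero]
  intro h
  have := gaussianReal_absolutelyContinuous' 0 one_ne_zero h
  simp at this

lemma Activation.hermiteCoeff_one_pos (φ : Activation) {a : ℝ} (ha : 0 < a) :
    0 < hermiteCoeff (fun x => φ.fn (a * x)) 1 := by
  have h2 : MemLp (fun x : ℝ => x) 2 stdGaussian := by simpa using memLp_pow 1 2 (by simp)
  have hi : Integrable (fun x => x * φ.fn (a * x)) stdGaussian :=
    h2.integrable_mul (φ.memLp_fn a)
  have hnn : ∀ x, 0 ≤ x * φ.fn (a * x) := fun x => by
    have := φ.mul_fn_nonneg (a * x)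
    rw [mul_assoc] at this
    exact nonneg_of_mul_nonneg_right this ha
  rw [hermiteCoeff_one, integral_pos_iff_support_of_nonneg hnn hi]
  refine stdGaussian_Ioi_pos.trans_le (measure_mono fun x hx => ?_)
  exact (mul_pos hx (φ.fn_pos (mul_pos ha hx))).ne'

/-- `𝔼[F(√v Z₁) F(√v (c Z₁ + √(1 - c²) Z₂))]`. -/
def dual (F : ℝ → ℝ) (v c : ℝ) : ℝ :=
  ∫ z : ℝ × ℝ, F (√v * z.1) * F (√v * (c * z.1 + √(1 - c ^ 2) * z.2))
    ∂(stdGaussian.prod stdGaussian)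

lemma gaussPair_eq_dual (F : ℝ → ℝ) {v : ℝ} (hv : 0 < v) (q : ℝ) :
    gaussPair F v q v = dual F v (q / v) := by
  rw [gaussPair, dual, Real.mul_self_sqrt hv.le]

lemma one_sub_sq_nonneg {c : ℝ} (hc : c ∈ Set.Icc (-1 : ℝ) 1) : 0 ≤ 1 - c ^ 2 := by
  nlinarith [hc.1, hc.2]

lemma hasSum_dual {F : ℝ → ℝ} {v : ℝ} (hF : MemLp (fun x => F (√v * x)) 2 stdGaussian) {c : ℝ}
    (hc : c ∈ Set.Icc (-1 : ℝ) 1) :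
    HasSum (fun n => hermiteCoeff (fun x => F (√v * x)) n ^ 2 * c ^ n) (dual F v c) :=
  hasSum_mehler hF (s := √(1 - c ^ 2)) (by rw [Real.sq_sqrt (one_sub_sq_nonneg hc)]; ring)

lemma nonnegSeries_dual {F : ℝ → ℝ} {v : ℝ} (hF : MemLp (fun x => F (√v * x)) 2 stdGaussian) :
    NonnegSeries (dual F v) :=
  ⟨_, fun _ => sq_nonneg _, by simpa using (hasSum_dual hF one_mem_Icc).summable,
    fun _ ht => hasSum_dual hF ht⟩

lemma dual_one (F : ℝ → ℝ) (v : ℝ) : dual F v 1 = ∫ z, F (√v * z) ^ 2 ∂stdGaussian := by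
  simp only [dual, one_pow, sub_self, Real.sqrt_zero, one_mul, zero_mul, add_zero, ← pow_two]
  rw [integral_fun_fst (fun x => F (√v * x) ^ 2)]
  simp

/-- Lower bound for the increment of the covariance map. -/
lemma Activation.mul_one_sub_le_dual (φ : Activation) (v : ℝ) {c : ℝ}
    (hc : c ∈ Set.Icc (-1 : ℝ) 1) :
    hermiteCoeff (fun x => φ.fn (√v * x)) 1 ^ 2 * (1 - c) ≤ dual φ.fn v 1 - dual φ.fn v c := by
  have h := (hasSum_dual (φ.memLp_fn √v) one_mem_Icc).sub (hasSum_dual (φ.memLp_fn √v) hc)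
  have h1 := le_hasSum h 1 fun n _ => by
    rw [one_pow, ← mul_sub]
    exact mul_nonneg (sq_nonneg _)
      (sub_nonneg.2 ((le_abs_self _).trans (abs_pow_le_one_of_mem hc n)))
  simpa [mul_sub] using h1

lemma Activation.dual_one_pos (φ : Activation) {v : ℝ} (hv : 0 < v) : 0 < dual φ.fn v 1 := by
  have h := Activation.mul_one_sub_le_dual φ v (c := 0) (by simp)
  have h0 : 0 ≤ dual φ.fn v 0 := (nonnegSeries_dual (φ.memLp_fn √v)).nonneg (by simp)
  have := φ.hermiteCoeff_one_pos (Real.sqrt_pos.2 hv)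
  have := pow_pos this 2
  linarith

/-- The covariance of the layer `l + 1` as a function of the inner product of two unit inputs;
`s = 0` for a plain network and `s = 1` for a residual network. -/
def covFun (d : ℕ) (φ : Activation) (s σb σw : ℝ) : ℕ → ℝ → ℝ
  | 0 => fun t => σb ^ 2 + σw ^ 2 / d * t
  | l + 1 => fun t => s * covFun d φ s σb σw l t + (σb ^ 2 + σw ^ 2 *
      gaussPair φ.fn (covFun d φ s σb σw l 1) (covFun d φ s σb σw l t) (covFun d φ s σb σw l 1))

/-- The neural tangent kernel of the layer `l + 1` as a function of the inner product of two unit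
inputs; `s = 0` for a plain network and `s = 1` for a residual network. -/
def ntkFun (d : ℕ) (φ : Activation) (s σb σw : ℝ) : ℕ → ℝ → ℝ
  | 0 => covFun d φ s σb σw 0
  | l + 1 => fun t => ntkFun d φ s σb σw l t * (s + σw ^ 2 *
        gaussPair φ.dfn (covFun d φ s σb σw l 1) (covFun d φ s σb σw l t)
          (covFun d φ s σb σw l 1)) +
      (σb ^ 2 + σw ^ 2 *
        gaussPair φ.fn (covFun d φ s σb σw l 1) (covFun d φ s σb σw l t)
          (covFun d φ s σb σw l 1))

section

variable {d : ℕ} {φ : Activation} {s σb σw : ℝ}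

lemma covFun_one_pos (hd : 2 ≤ d) (hs : 0 ≤ s) (hσw : 0 < σw) (l : ℕ) :
    0 < covFun d φ s σb σw l 1 := by
  induction l with
  | zero =>
    have : (0 : ℝ) < d := by exact_mod_cast (by omega : 0 < d)
    simp only [covFun]
    positivity
  | succ l ih =>
    simp only [covFun]
    rw [gaussPair_eq_dual _ ih, div_self ih.ne']
    have := φ.dual_one_pos ih
    positivity

lemma nonnegSeries_covFun (hd : 2 ≤ d) (hs : 0 ≤ s) (hσw : 0 < σw) (l : ℕ) :
    NonnegSeries (covFun d φ s σb σw l) := by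
  induction l with
  | zero =>
    exact (NonnegSeries.const (sq_nonneg σb)).add
      (NonnegSeries.ident.const_mul (by positivity))
  | succ l ih =>
    have hv := covFun_one_pos (φ := φ) (σb := σb) hd hs hσw l
    simp only [covFun, gaussPair_eq_dual _ hv]
    exact (ih.const_mul hs).add ((NonnegSeries.const (sq_nonneg σb)).add
      (((nonnegSeries_dual (φ.memLp_fn _)).comp (ih.div_const hv.le)
        (div_self hv.ne').le).const_mul (sq_nonneg σw)))

lemma nonnegSeries_ntkFun (hd : 2 ≤ d) (hs : 0 ≤ s) (hσw : 0 < σw) (l : ℕ) :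
    NonnegSeries (ntkFun d φ s σb σw l) := by
  induction l with
  | zero => exact nonnegSeries_covFun hd hs hσw 0
  | succ l ih =>
    have hv := covFun_one_pos (φ := φ) (σb := σb) hd hs hσw l
    have hc := (nonnegSeries_covFun (φ := φ) (σb := σb) hd hs hσw l).div_const hv.le
    simp only [ntkFun, gaussPair_eq_dual _ hv]
    exact (ih.mul ((NonnegSeries.const hs).add
      (((nonnegSeries_dual (φ.memLp_dfn _)).comp hc
        (div_self hv.ne').le).const_mul (sq_nonneg σw)))).add
      ((NonnegSeries.const (sq_nonneg σb)).add
      (((nonnegSeries_dual (φ.memLp_fn _)).comp hc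
        (div_self hv.ne').le).const_mul (sq_nonneg σw)))

lemma ffnnCov_eq (l : ℕ) (x x' : USphere (Fin d)) :
    ffnnCov d φ σb σw (l + 1) x x' = covFun d φ 0 σb σw l (inner ℝ x.1 x'.1) := by
  induction l generalizing x x' with
  | zero => rfl
  | succ l ih => simp only [ffnnCov, hatCov, covFun, ih, inner_self_sphere]; ring

lemma ffnnNTK_eq (l : ℕ) (x x' : USphere (Fin d)) :
    ffnnNTK d φ σb σw (l + 1) x x' = ntkFun d φ 0 σb σw l (inner ℝ x.1 x'.1) := by
  induction l generalizing x x' with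
  | zero => rfl
  | succ l ih =>
    simp only [ffnnNTK, hatCov, dotCov, ntkFun, ih, ffnnCov_eq, inner_self_sphere]; ring

lemma resCov_eq (l : ℕ) (x x' : USphere (Fin d)) :
    resCov d σb σw (l + 1) x x' = covFun d .relu 1 σb σw l (inner ℝ x.1 x'.1) := by
  induction l generalizing x x' with
  | zero => rfl
  | succ l ih => simp only [resCov, hatCov, covFun, ih, inner_self_sphere]; ring

lemma resNTK_eq (l : ℕ) (x x' : USphere (Fin d)) :
    resNTK d σb σw (l + 1) x x' = ntkFun d .relu 1 σb σw l (inner ℝ x.1 x'.1) := by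
  induction l generalizing x x' with
  | zero => rfl
  | succ l ih =>
    simp only [resNTK, hatCov, dotCov, ntkFun, ih, resCov_eq, inner_self_sphere]; ring

end

/-! ### Convolutional layers -/

section

variable {n₀ M r : ℕ} {σb σw : ℝ}

lemma filterAvg_const {G : ConvInput n₀ M × ZMod M → ConvInput n₀ M × ZMod M → ℝ} {a : ℝ}
    {p p' : ConvInput n₀ M × ZMod M} (h : ∀ α α' : ZMod M, G (p.1, α) (p'.1, α') = a) :
    filterAvg r G p p' = a := by
  have hc : (((r : ℤ) + 1 - -(r : ℤ)).toNat : ℝ) = 2 * r + 1 := by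
    have : ((r : ℤ) + 1 - -(r : ℤ)).toNat = 2 * r + 1 := by omega
    rw [this]; push_cast; ring
  simp only [filterAvg, h, Finset.sum_const, Int.card_Icc, nsmul_eq_mul, hc]
  field_simp

lemma sum_convBracket [NeZero M] (x x' : ConvInput n₀ M) :
    ∑ α : ZMod M, convBracket r (x, α) (x', α) = (2 * r + 1) * inner ℝ x x' := by
  have h1 : ∀ (j : Fin n₀) (β : ℤ),
      ∑ α : ZMod M, x (j, α + (β : ZMod M)) * x' (j, α + (β : ZMod M)) =
        ∑ α : ZMod M, x (j, α) * x' (j, α) := fun j β =>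
    Fintype.sum_equiv (Equiv.addRight (β : ZMod M)) _ _ fun α => rfl
  have hc : (((r : ℤ) + 1 - -(r : ℤ)).toNat : ℝ) = 2 * r + 1 := by
    have : ((r : ℤ) + 1 - -(r : ℤ)).toNat = 2 * r + 1 := by omega
    rw [this]; push_cast; ring
  simp only [convBracket]
  rw [Finset.sum_comm]
  have h2 : ∀ j : Fin n₀, ∑ α : ZMod M, ∑ β ∈ Finset.Icc (-(r : ℤ)) r,
      x (j, α + (β : ZMod M)) * x' (j, α + (β : ZMod M)) =
        (2 * r + 1) * ∑ α : ZMod M, x (j, α) * x' (j, α) := fun j => by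
    rw [Finset.sum_comm]
    simp only [h1, Finset.sum_const, Int.card_Icc, nsmul_eq_mul, hc]
  simp only [h2]
  rw [← Finset.mul_sum]
  rw [PiLp.inner_apply, Fintype.sum_prod_type]
  simp [mul_comm]

variable {S : Set (ConvInput n₀ M)}

lemma convCovOne_eq [NeZero M] {d : ℕ} (hd : n₀ * M = d) (hd2 : 2 ≤ d) (φ : Activation) (s : ℝ)
    (hS : LocationFree n₀ M r σb σw S) {x x' : ConvInput n₀ M} (hx : x ∈ S) (hx' : x' ∈ S)
    (α α' : ZMod M) :
    convCovOne n₀ M r σb σw (x, α) (x', α') = covFun d φ s σb σw 0 (inner ℝ x x') := by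
  have h1 : ∑ γ : ZMod M, convCovOne n₀ M r σb σw (x, α) (x', α') =
      ∑ γ : ZMod M, convCovOne n₀ M r σb σw (x, γ) (x', γ) :=
    Finset.sum_congr rfl fun γ _ => hS x hx x' hx' α α' γ γ
  have hM : (M : ℝ) ≠ 0 := by exact_mod_cast NeZero.ne M
  have hn : (n₀ : ℝ) ≠ 0 := by
    rintro h
    have : n₀ = 0 := by exact_mod_cast h
    subst this
    omega
  simp only [Finset.sum_const, Finset.card_univ, ZMod.card, nsmul_eq_mul] at h1
  have h2 : ∑ γ : ZMod M, convCovOne n₀ M r σb σw (x, γ) (x', γ) =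
      M * σb ^ 2 + σw ^ 2 / (n₀ * (2 * (r : ℝ) + 1)) * ((2 * r + 1) * inner ℝ x x') := by
    simp only [convCovOne]
    rw [Finset.sum_add_distrib, ← Finset.mul_sum, sum_convBracket]
    simp
  rw [h2] at h1
  have hd' : (d : ℝ) = n₀ * M := by rw [← hd]; push_cast; ring
  rw [covFun, hd']
  refine mul_left_cancel₀ hM (h1.trans ?_)
  field_simp

lemma cnnCov_eq [NeZero M] {d : ℕ} (hd : n₀ * M = d) (hd2 : 2 ≤ d) (φ : Activation)
    (hS : LocationFree n₀ M r σb σw S) (l : ℕ) (x x' : USphere (Fin n₀ × ZMod M))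
    (hx : x.1 ∈ S) (hx' : x'.1 ∈ S) (α α' : ZMod M) :
    cnnCov n₀ M r φ σb σw (l + 1) (x.1, α) (x'.1, α') =
      covFun d φ 0 σb σw l (inner ℝ x.1 x'.1) := by
  induction l generalizing x x' α α' with
  | zero => exact convCovOne_eq hd hd2 φ 0 hS hx hx' α α'
  | succ l ih =>
    refine filterAvg_const fun γ γ' => ?_
    simp only [hatCov, covFun, ih x x' hx hx', ih x x hx hx, ih x' x' hx' hx', inner_self_sphere]
    ring

lemma cnnNTK_eq [NeZero M] {d : ℕ} (hd : n₀ * M = d) (hd2 : 2 ≤ d) (φ : Activation)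
    (hS : LocationFree n₀ M r σb σw S) (l : ℕ) (x x' : USphere (Fin n₀ × ZMod M))
    (hx : x.1 ∈ S) (hx' : x'.1 ∈ S) (α α' : ZMod M) :
    cnnNTK n₀ M r φ σb σw (l + 1) (x.1, α) (x'.1, α') =
      ntkFun d φ 0 σb σw l (inner ℝ x.1 x'.1) := by
  induction l generalizing α α' with
  | zero => exact convCovOne_eq hd hd2 φ 0 hS hx hx' α α'
  | succ l ih =>
    refine filterAvg_const fun γ γ' => ?_
    have hc := cnnCov_eq (r := r) (σb := σb) (σw := σw) hd hd2 φ hS l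
    simp only [hatCov, dotCov, ntkFun, ih, hc x x' hx hx', hc x x hx hx, hc x' x' hx' hx',
      inner_self_sphere]
    ring

lemma convResCov_eq [NeZero M] {d : ℕ} (hd : n₀ * M = d) (hd2 : 2 ≤ d)
    (hS : LocationFree n₀ M r σb σw S) (l : ℕ) (x x' : USphere (Fin n₀ × ZMod M))
    (hx : x.1 ∈ S) (hx' : x'.1 ∈ S) (α α' : ZMod M) :
    convResCov n₀ M r σb σw (l + 1) (x.1, α) (x'.1, α') =
      covFun d .relu 1 σb σw l (inner ℝ x.1 x'.1) := by
  induction l generalizing x x' α α' with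
  | zero => exact convCovOne_eq hd hd2 .relu 1 hS hx hx' α α'
  | succ l ih =>
    simp only [convResCov, covFun, ih x x' hx hx', one_mul]
    congr 1
    refine filterAvg_const fun γ γ' => ?_
    simp only [hatCov, ih x x' hx hx', ih x x hx hx, ih x' x' hx' hx', inner_self_sphere]

lemma convResNTK_eq [NeZero M] {d : ℕ} (hd : n₀ * M = d) (hd2 : 2 ≤ d)
    (hS : LocationFree n₀ M r σb σw S) (l : ℕ) (x x' : USphere (Fin n₀ × ZMod M))
    (hx : x.1 ∈ S) (hx' : x'.1 ∈ S) (α α' : ZMod M) :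
    convResNTK n₀ M r σb σw (l + 1) (x.1, α) (x'.1, α') =
      ntkFun d .relu 1 σb σw l (inner ℝ x.1 x'.1) := by
  induction l generalizing α α' with
  | zero => exact convCovOne_eq hd hd2 .relu 1 hS hx hx' α α'
  | succ l ih =>
    have hc := convResCov_eq (r := r) (σb := σb) (σw := σw) hd hd2 hS l
    simp only [convResNTK, ntkFun, ih, mul_add, mul_one, add_assoc]
    congr 1
    refine filterAvg_const fun γ γ' => ?_
    simp only [hatCov, dotCov, ih, hc x x' hx hx', hc x x hx hx, hc x' x' hx' hx',
      inner_self_sphere]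
    ring

end

/-! ### Inequalities between a power series and its derivatives -/

/-- On `[-1, 1]`, `F` is a power series with nonnegative coefficients and `F'` is its termwise
derivative. -/
def SeriesDeriv (F F' : ℝ → ℝ) : Prop :=
  ∃ A : ℕ → ℝ, (∀ n, 0 ≤ A n) ∧
    (∀ c ∈ Set.Icc (-1 : ℝ) 1, HasSum (fun n : ℕ => A n * c ^ n) (F c)) ∧
    ∀ c ∈ Set.Icc (-1 : ℝ) 1, HasSum (fun n : ℕ => ((n : ℝ) + 1) * A (n + 1) * c ^ n) (F' c)

/-- On `[-1, 1]`, `F` is a power series with nonnegative coefficients, and `F'` and `F''` are its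
first two termwise derivatives. -/
def SeriesDerivTwo (F F' F'' : ℝ → ℝ) : Prop :=
  ∃ A : ℕ → ℝ, (∀ n, 0 ≤ A n) ∧
    (∀ c ∈ Set.Icc (-1 : ℝ) 1, HasSum (fun n : ℕ => A n * c ^ n) (F c)) ∧
    (∀ c ∈ Set.Icc (-1 : ℝ) 1, HasSum (fun n : ℕ => ((n : ℝ) + 1) * A (n + 1) * c ^ n) (F' c)) ∧
    ∀ c ∈ Set.Icc (-1 : ℝ) 1,
      HasSum (fun n : ℕ => ((n : ℝ) + 1) * ((n : ℝ) + 2) * A (n + 2) * c ^ n) (F'' c)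

lemma abs_pow_succ_sub_le {a b r : ℝ} (ha : |a| ≤ r) (hb : |b| ≤ r) (n : ℕ) :
    |b ^ (n + 1) - a ^ (n + 1)| ≤ (n + 1) * r ^ n * |b - a| := by
  refine (abs_pow_sub_pow_le b a (n + 1)).trans ?_
  rw [Nat.add_sub_cancel]
  push_cast
  rw [mul_comm |b - a|, mul_right_comm]
  exact mul_le_mul_of_nonneg_right (mul_le_mul_of_nonneg_left
    (pow_le_pow_left₀ (le_max_of_le_left (abs_nonneg _)) (max_le hb ha) n) (by positivity))
    (abs_nonneg _)

lemma mul_pow_mul_sub_le {a b : ℝ} (ha : 0 ≤ a) (hab : a ≤ b) (n : ℕ) :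
    (n + 1) * a ^ n * (b - a) ≤ b ^ (n + 1) - a ^ (n + 1) := by
  induction n with
  | zero => simp
  | succ n ih =>
    have h2 : a * ((n + 1) * a ^ n * (b - a)) ≤ b * (b ^ (n + 1) - a ^ (n + 1)) :=
      mul_le_mul hab ih (by positivity) (ha.trans hab)
    push_cast
    rw [pow_succ b (n + 1), pow_succ a (n + 1)]
    rw [pow_succ a n] at h2 ⊢
    nlinarith

lemma one_sub_pow_chord {a c : ℝ} (ha : 0 ≤ a) (hac : a ≤ c) (hc : c ≤ 1) (n : ℕ) :
    (1 - a ^ n) * (1 - c) ≤ (1 - c ^ n) * (1 - a) := by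
  induction n with
  | zero => simp
  | succ n ih =>
    have h1 : a ^ n ≤ c ^ n := pow_le_pow_left₀ ha hac n
    have h2 : 0 ≤ (1 - c) * (1 - a) := mul_nonneg (by linarith) (by linarith)
    rw [pow_succ, pow_succ]
    nlinarith

lemma taylor_pow_upper {c : ℝ} (hc : c ∈ Set.Icc (0 : ℝ) 1) (n : ℕ) :
    ((n : ℝ) + 1) * (1 - c) - (1 - c ^ (n + 1)) ≤ 1 / 2 * (n * (n + 1)) * (1 - c) ^ 2 := by
  induction n with
  | zero => simp
  | succ n ih =>
    have h1 := abs_pow_succ_sub_le (a := c) (b := 1) (r := 1)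
      (abs_le.2 ⟨by linarith [hc.1], hc.2⟩) (by simp) n
    rw [one_pow, one_pow, mul_one, abs_of_nonneg (sub_nonneg.2 hc.2)] at h1
    have h2 := mul_le_mul_of_nonneg_right ((le_abs_self _).trans h1) (sub_nonneg.2 hc.2)
    push_cast
    rw [pow_succ c (n + 1)]
    nlinarith

lemma taylor_pow_lower {c : ℝ} (hc : c ∈ Set.Icc (0 : ℝ) 1) (n : ℕ) :
    1 / 2 * (((n : ℝ) + 1) * (n + 2)) * c ^ n * (1 - c) ^ 2 ≤
      ((n : ℝ) + 2) * (1 - c) - (1 - c ^ (n + 2)) := by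
  induction n with
  | zero => simp; nlinarith
  | succ n ih =>
    have h1 := mul_pow_mul_sub_le hc.1 hc.2 (n + 1)
    have h2 := mul_le_mul_of_nonneg_right h1 (sub_nonneg.2 hc.2)
    have h3 : c ^ (n + 1) ≤ c ^ n := pow_le_pow_of_le_one hc.1 hc.2 (Nat.le_succ n)
    have h4 : 1 / 2 * (((n : ℝ) + 1) * (n + 2)) * c ^ (n + 1) * (1 - c) ^ 2 ≤
        1 / 2 * (((n : ℝ) + 1) * (n + 2)) * c ^ n * (1 - c) ^ 2 := by gcongr
    push_cast at h2 ⊢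
    rw [one_pow] at h2
    rw [show n + 1 + 2 = (n + 2) + 1 from rfl, pow_succ c (n + 2)]
    have h5 : c ^ (n + 1 + 1) = c ^ (n + 2) := rfl
    rw [h5] at h2
    nlinarith

lemma taylor_pow_pos {c : ℝ} (hc : -1 ≤ c) (hc1 : c < 1) (n : ℕ) :
    0 < ((n : ℝ) + 2) * (1 - c) - (1 - c ^ (n + 2)) := by
  induction n with
  | zero => simp; nlinarith
  | succ n ih =>
    have h1 : c ^ (n + 2) ≤ 1 := (le_abs_self _).trans (abs_pow_le_one_of_mem ⟨hc, hc1.le⟩ _)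
    push_cast
    rw [show n + 1 + 2 = (n + 2) + 1 from rfl, pow_succ c (n + 2)]
    nlinarith

namespace SeriesDeriv

variable {F F' : ℝ → ℝ}

lemma hasSum_sub {A : ℕ → ℝ}
    (hF : ∀ c ∈ Set.Icc (-1 : ℝ) 1, HasSum (fun n : ℕ => A n * c ^ n) (F c)) {a b : ℝ}
    (ha : a ∈ Set.Icc (-1 : ℝ) 1) (hb : b ∈ Set.Icc (-1 : ℝ) 1) :
    HasSum (fun n : ℕ => A (n + 1) * (b ^ (n + 1) - a ^ (n + 1))) (F b - F a) := by
  have h := (hasSum_nat_add_iff' 1).2 ((hF b hb).sub (hF a ha))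
  simpa [mul_sub] using h

lemma abs_sub_le (h : SeriesDeriv F F') {a b r : ℝ} (hr : r ≤ 1) (ha : |a| ≤ r) (hb : |b| ≤ r) :
    |F b - F a| ≤ F' r * |b - a| := by
  obtain ⟨A, hA, hF, hF'⟩ := h
  have hm : ∀ {x : ℝ}, |x| ≤ r → x ∈ Set.Icc (-1 : ℝ) 1 := fun hx => abs_le.1 (hx.trans hr)
  have hr0 : 0 ≤ r := (abs_nonneg a).trans ha
  have h1 := (hF' r (hm (abs_of_nonneg hr0).le)).mul_right |b - a|
  rw [← (hasSum_sub hF (hm ha) (hm hb)).tsum_eq, ← Real.norm_eq_abs]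
  refine tsum_of_norm_bounded h1 fun n => ?_
  rw [norm_mul, Real.norm_eq_abs, Real.norm_eq_abs, abs_of_nonneg (hA _)]
  refine (mul_le_mul_of_nonneg_left (abs_pow_succ_sub_le ha hb n) (hA _)).trans_eq ?_
  ring

lemma sub_le (h : SeriesDeriv F F') {c : ℝ} (hc : c ∈ Set.Icc (-1 : ℝ) 1) :
    F 1 - F c ≤ F' 1 * (1 - c) := by
  have h1 := h.abs_sub_le le_rfl (abs_le.2 hc) (by simp : |(1 : ℝ)| ≤ 1)
  rw [abs_of_nonneg (sub_nonneg.2 hc.2)] at h1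
  exact (le_abs_self _).trans h1

lemma mul_sub_le (h : SeriesDeriv F F') {a b : ℝ} (ha : 0 ≤ a) (hab : a ≤ b) (hb : b ≤ 1) :
    F' a * (b - a) ≤ F b - F a := by
  obtain ⟨A, hA, hF, hF'⟩ := h
  have ha' : a ∈ Set.Icc (-1 : ℝ) 1 := ⟨by linarith, by linarith⟩
  refine hasSum_le (fun n => ?_) ((hF' a ha').mul_right (b - a))
    (hasSum_sub hF ha' ⟨by linarith, hb⟩)
  refine le_trans (le_of_eq ?_) (mul_le_mul_of_nonneg_left (mul_pow_mul_sub_le ha hab n) (hA _))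
  ring

lemma chord (h : SeriesDeriv F F') {a c : ℝ} (ha : 0 ≤ a) (hac : a ≤ c) (hc : c ≤ 1) :
    (F 1 - F a) * (1 - c) ≤ (F 1 - F c) * (1 - a) := by
  obtain ⟨A, hA, hF, -⟩ := h
  refine hasSum_le (fun n => ?_)
    ((hasSum_sub hF ⟨by linarith, by linarith⟩ one_mem_Icc).mul_right (1 - c))
    ((hasSum_sub hF ⟨by linarith, hc⟩ one_mem_Icc).mul_right (1 - a))
  have := mul_le_mul_of_nonneg_left (one_sub_pow_chord ha hac hc (n + 1)) (hA (n + 1))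
  simpa only [one_pow, mul_assoc] using this

lemma nonneg_deriv (h : SeriesDeriv F F') : NonnegSeries F' := by
  obtain ⟨A, hA, -, hF'⟩ := h
  exact ⟨fun n => ((n : ℝ) + 1) * A (n + 1), fun n => mul_nonneg (by positivity) (hA _),
    by simpa using (hF' 1 one_mem_Icc).summable, hF'⟩

lemma nonnegSeries (h : SeriesDeriv F F') : NonnegSeries F := by
  obtain ⟨A, hA, hF, -⟩ := h
  exact ⟨A, hA, by simpa using (hF 1 one_mem_Icc).summable, hF⟩

end SeriesDeriv

namespace SeriesDerivTwo

variable {F F' F'' : ℝ → ℝ}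

lemma seriesDeriv (h : SeriesDerivTwo F F' F'') : SeriesDeriv F F' := by
  obtain ⟨A, hA, hF, hF', -⟩ := h
  exact ⟨A, hA, hF, hF'⟩

lemma deriv (h : SeriesDerivTwo F F' F'') : SeriesDeriv F' F'' := by
  obtain ⟨A, hA, -, hF', hF''⟩ := h
  refine ⟨fun n => ((n : ℝ) + 1) * A (n + 1), fun n => mul_nonneg (by positivity) (hA _), hF',
    fun c hc => (hF'' c hc).congr_fun fun n => ?_⟩
  push_cast; ring

lemma hasSum_remainder {A : ℕ → ℝ}
    (hF : ∀ c ∈ Set.Icc (-1 : ℝ) 1, HasSum (fun n : ℕ => A n * c ^ n) (F c))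
    (hF' : ∀ c ∈ Set.Icc (-1 : ℝ) 1, HasSum (fun n : ℕ => ((n : ℝ) + 1) * A (n + 1) * c ^ n) (F' c))
    {c : ℝ} (hc : c ∈ Set.Icc (-1 : ℝ) 1) :
    HasSum (fun n : ℕ => A (n + 2) * (((n : ℝ) + 2) * (1 - c) - (1 - c ^ (n + 2))))
      (F' 1 * (1 - c) - (F 1 - F c)) := by
  have h := (hasSum_nat_add_iff' 1).2 (((hF' 1 one_mem_Icc).mul_right (1 - c)).sub
    (SeriesDeriv.hasSum_sub hF hc one_mem_Icc))
  simp only [Finset.sum_range_one, Nat.cast_zero, zero_add, one_pow, mul_one, one_mul,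
    pow_one, sub_self, sub_zero] at h
  refine h.congr_fun fun n => ?_
  push_cast; ring

lemma remainder_le (h : SeriesDerivTwo F F' F'') {c : ℝ} (hc : c ∈ Set.Icc (0 : ℝ) 1) :
    F' 1 * (1 - c) - (F 1 - F c) ≤ 1 / 2 * F'' 1 * (1 - c) ^ 2 := by
  obtain ⟨A, hA, hF, hF', hF''⟩ := h
  refine hasSum_le (fun n => ?_) (hasSum_remainder hF hF' ⟨by linarith [hc.1], hc.2⟩)
    (((hF'' 1 one_mem_Icc).mul_left (1 / 2)).mul_right ((1 - c) ^ 2))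
  have := mul_le_mul_of_nonneg_left (taylor_pow_upper hc (n + 1)) (hA (n + 2))
  push_cast at this
  rw [one_pow]
  refine le_trans (le_of_eq ?_) (this.trans_eq ?_) <;> ring

lemma le_remainder (h : SeriesDerivTwo F F' F'') {c : ℝ} (hc : c ∈ Set.Icc (0 : ℝ) 1) :
    1 / 2 * F'' c * (1 - c) ^ 2 ≤ F' 1 * (1 - c) - (F 1 - F c) := by
  obtain ⟨A, hA, hF, hF', hF''⟩ := h
  have hc' : c ∈ Set.Icc (-1 : ℝ) 1 := ⟨by linarith [hc.1], hc.2⟩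
  refine hasSum_le (fun n => ?_) (((hF'' c hc').mul_left (1 / 2)).mul_right ((1 - c) ^ 2))
    (hasSum_remainder hF hF' hc')
  have := mul_le_mul_of_nonneg_left (taylor_pow_lower hc n) (hA (n + 2))
  refine le_trans (le_of_eq ?_) this
  ring

/-- A power series that attains its tangent at `1` elsewhere is affine. -/
lemma deriv_two_eq_zero (h : SeriesDerivTwo F F' F'') {c : ℝ} (hc : -1 ≤ c) (hc1 : c < 1)
    (he : F 1 - F c = F' 1 * (1 - c)) : F'' 1 = 0 := by
  obtain ⟨A, hA, hF, hF', hF''⟩ := h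
  have h1 := hasSum_remainder hF hF' ⟨hc, hc1.le⟩
  rw [← he, sub_self] at h1
  have h2 := (hasSum_zero_iff_of_nonneg fun n =>
    mul_nonneg (hA (n + 2)) (taylor_pow_pos hc hc1 n).le).1 h1
  have h3 : ∀ n, A (n + 2) = 0 := fun n =>
    (mul_eq_zero.1 (congrFun h2 n)).resolve_right (taylor_pow_pos hc hc1 n).ne'
  have h4 := hF'' 1 one_mem_Icc
  simp only [h3, mul_zero, zero_mul] at h4
  exact h4.unique hasSum_zero

end SeriesDerivTwo

/-! ### The hyperbolic tangent -/

lemma hasDerivAt_tanh (x : ℝ) : HasDerivAt Real.tanh (1 - Real.tanh x ^ 2) x := by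
  have h := (Real.hasDerivAt_sinh x).div (Real.hasDerivAt_cosh x) (Real.cosh_pos x).ne'
  have e : Real.tanh = fun y => Real.sinh y / Real.cosh y := funext Real.tanh_eq_sinh_div_cosh
  rw [e]
  convert! h using 1
  have := (Real.cosh_pos x).ne'
  field_simp

/-- The second derivative of the hyperbolic tangent. -/
def tanhSecond (x : ℝ) : ℝ := -2 * Real.tanh x * (1 - Real.tanh x ^ 2)

lemma hasDerivAt_tanh_dfn (x : ℝ) : HasDerivAt (Activation.dfn .tanh) (tanhSecond x) x := by
  have h := ((hasDerivAt_tanh x).pow 2).const_sub 1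
  convert! h using 1
  simp [tanhSecond]

lemma continuous_tanhSecond : Continuous tanhSecond := by
  have := continuous_tanh
  unfold tanhSecond
  fun_prop

lemma abs_tanhSecond_le (x : ℝ) : |tanhSecond x| ≤ 2 := by
  have h1 := (Real.abs_tanh_lt_one x).le
  have h2 := Activation.abs_dfn_le .tanh x
  simp only [Activation.dfn] at h2
  rw [tanhSecond, abs_mul, abs_mul, abs_neg, abs_two]
  nlinarith [abs_nonneg (Real.tanh x), abs_nonneg (1 - Real.tanh x ^ 2)]

lemma memLp_of_continuous_bounded {f : ℝ → ℝ} (hc : Continuous f) {C : ℝ} (hb : ∀ x, |f x| ≤ C)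
    (a : ℝ) : MemLp (fun x => f (a * x)) 2 stdGaussian :=
  MemLp.of_bound (hc.comp (continuous_const.mul continuous_id)).aestronglyMeasurable C
    (ae_of_all _ fun _ => hb _)

lemma hermiteCoeff_const_mul (a : ℝ) (f : ℝ → ℝ) (n : ℕ) :
    hermiteCoeff (fun x => a * f x) n = a * hermiteCoeff f n := by
  rw [hermiteCoeff, hermiteCoeff, ← integral_const_mul]
  congr 1; ext x; ring

lemma seriesDerivTwo_tanh {v : ℝ} (hv : 0 ≤ v) :
    SeriesDerivTwo (dual (Activation.fn .tanh) v) (fun c => v * dual (Activation.dfn .tanh) v c)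
      (fun c => v ^ 2 * dual tanhSecond v c) := by
  have hsv : √v ^ 2 = v := Real.sq_sqrt hv
  set f : ℝ → ℝ := fun x => Activation.fn .tanh (√v * x) with hf
  set f1 : ℝ → ℝ := fun x => √v * Activation.dfn .tanh (√v * x) with hf1
  set f2 : ℝ → ℝ := fun x => √v * (√v * tanhSecond (√v * x)) with hf2
  have hlin : ∀ x : ℝ, HasDerivAt (fun y => √v * y) √v x := fun x => by
    simpa using (hasDerivAt_id x).const_mul √v
  have hd1 : ∀ x, HasDerivAt f (f1 x) x := fun x => by
    have := (hasDerivAt_tanh (√v * x)).comp x (hlin x)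
    convert! this using 1
    simp [hf1, Activation.dfn, mul_comm]
  have hd2 : ∀ x, HasDerivAt f1 (f2 x) x := fun x => by
    have := ((hasDerivAt_tanh_dfn (√v * x)).comp x (hlin x)).const_mul √v
    convert! this using 1
    simp [hf2, mul_comm]
  have hm0 : MemLp f 2 stdGaussian := Activation.memLp_fn .tanh √v
  have hmd : MemLp (fun x => Activation.dfn .tanh (√v * x)) 2 stdGaussian :=
    Activation.memLp_dfn .tanh √v
  have hm1 : MemLp f1 2 stdGaussian := hmd.const_mul √v
  have hms : MemLp (fun x => tanhSecond (√v * x)) 2 stdGaussian :=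
    memLp_of_continuous_bounded continuous_tanhSecond abs_tanhSecond_le √v
  have hm2 : MemLp f2 2 stdGaussian := (hms.const_mul √v).const_mul √v
  refine ⟨fun n => hermiteCoeff f n ^ 2, fun n => sq_nonneg _, fun c hc => hasSum_dual hm0 hc,
    fun c hc => ?_, fun c hc => ?_⟩
  · refine ((hasSum_dual hmd hc).mul_left v).congr_fun fun n => ?_
    rw [← hermiteCoeff_deriv hd1 hm0 hm1 n, hf1, hermiteCoeff_const_mul, mul_pow, hsv]
    ring
  · refine ((hasSum_dual hms hc).mul_left (v ^ 2)).congr_fun fun n => ?_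
    have h1 := hermiteCoeff_deriv hd1 hm0 hm1 (n + 1)
    have h2 := hermiteCoeff_deriv hd2 hm1 hm2 n
    rw [h1, hf2, hermiteCoeff_const_mul, hermiteCoeff_const_mul, mul_pow, mul_pow, hsv] at h2
    push_cast at h2
    linear_combination -(c ^ n) * h2

lemma continuous_dual {F : ℝ → ℝ} (hc : Continuous F) {C : ℝ} (hb : ∀ x, |F x| ≤ C) :
    Continuous fun p : ℝ × ℝ => dual F p.1 p.2 := by
  refine continuous_of_dominated (bound := fun _ => C * C) (fun p => ?_) (fun p => ?_)
    (integrable_const _) (ae_of_all _ fun z => ?_)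
  · exact (by fun_prop : Continuous _).aestronglyMeasurable
  · refine ae_of_all _ fun z => ?_
    rw [norm_mul]
    exact mul_le_mul (hb _) (hb _) (norm_nonneg _) ((abs_nonneg _).trans (hb 0))
  · fun_prop

lemma continuous_dual_tanh : Continuous fun p : ℝ × ℝ => dual (Activation.fn .tanh) p.1 p.2 :=
  continuous_dual continuous_tanh fun x => (Real.abs_tanh_lt_one x).le

lemma continuous_dual_tanh_dfn :
    Continuous fun p : ℝ × ℝ => dual (Activation.dfn .tanh) p.1 p.2 :=
  continuous_dual (continuous_const.sub (continuous_tanh.pow 2)) (Activation.abs_dfn_le .tanh)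

lemma continuous_dual_tanhSecond : Continuous fun p : ℝ × ℝ => dual tanhSecond p.1 p.2 :=
  continuous_dual continuous_tanhSecond abs_tanhSecond_le

lemma dual_tanhSecond_one_pos {v : ℝ} (hv : 0 < v) : 0 < dual tanhSecond v 1 := by
  have hms := memLp_of_continuous_bounded continuous_tanhSecond abs_tanhSecond_le √v
  rw [dual_one, integral_pos_iff_support_of_nonneg (fun x => sq_nonneg _) hms.integrable_sq]
  refine stdGaussian_Ioi_pos.trans_le (measure_mono fun x hx => ?_)
  have h1 := Real_tanh_pos (mul_pos (Real.sqrt_pos.2 hv) hx)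
  have h2 := Real.tanh_sq_lt_one (√v * x)
  have h3 : tanhSecond (√v * x) ≠ 0 :=
    mul_ne_zero (mul_ne_zero (by norm_num) h1.ne') (sub_pos.2 h2).ne'
  exact pow_ne_zero 2 h3

lemma integral_tanh_eq_zero (a : ℝ) :
    ∫ x, Activation.fn .tanh (a * x) ∂stdGaussian = 0 := by
  have h1 : MeasurePreserving (fun x : ℝ => -x) stdGaussian stdGaussian :=
    ⟨measurable_neg, by rw [stdGaussian, gaussianReal_map_neg, neg_zero]⟩
  have h2 := h1.integral_comp' (f := MeasurableEquiv.neg ℝ)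
    (fun x => Activation.fn .tanh (a * x))
  have h3 : ∀ x, Activation.fn .tanh (a * (MeasurableEquiv.neg ℝ) x) =
      -Activation.fn .tanh (a * x) := fun x => by
    simp [Activation.fn, Real.tanh_neg]
  simp only [h3, integral_neg] at h2
  linarith

lemma dual_tanh_zero (v : ℝ) : dual (Activation.fn .tanh) v 0 = 0 := by
  have h := hasSum_dual (Activation.memLp_fn .tanh √v) (c := 0) (by simp)
  refine h.unique (hasSum_zero.congr_fun fun n => ?_)
  rcases Nat.eq_zero_or_pos n with rfl | hn
  · rw [hermiteCoeff_zero, integral_tanh_eq_zero]; simp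
  · simp [hn.ne']

/-! ### The variance map -/

lemma varianceMap_eq (φ : Activation) (σb σw v : ℝ) :
    varianceMap φ σb σw v = σb ^ 2 + σw ^ 2 * dual φ.fn v 1 := by
  rw [dual_one, varianceMap]

lemma chi_eq (φ : Activation) (σw v : ℝ) : chi φ σw v = σw ^ 2 * dual φ.dfn v 1 := by
  rw [dual_one, chi]

lemma strictMono_tanh : StrictMono Real.tanh := by
  refine strictMono_of_deriv_pos fun x => ?_
  rw [(hasDerivAt_tanh x).deriv]
  linarith [Real.tanh_sq_lt_one x]

lemma tanh_sq_mul_mono {a b : ℝ} (ha : 0 ≤ a) (hab : a ≤ b) (x : ℝ) :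
    Real.tanh (a * x) ^ 2 ≤ Real.tanh (b * x) ^ 2 := by
  wlog hx : 0 ≤ x generalizing x
  · have := this (-x) (by linarith)
    simpa [Real.tanh_neg] using this
  have h0 : 0 ≤ Real.tanh (a * x) := by
    simpa using strictMono_tanh.monotone (mul_nonneg ha hx)
  exact pow_le_pow_left₀ h0 (strictMono_tanh.monotone (mul_le_mul_of_nonneg_right hab hx)) 2

lemma mul_tanh_le {a b : ℝ} (ha : 0 ≤ a) (hab : a ≤ b) {x : ℝ} (hx : 0 ≤ x) :
    a * Real.tanh (b * x) ≤ b * Real.tanh (a * x) := by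
  have hd : ∀ y : ℝ, HasDerivAt (fun y => a * Real.tanh (b * y) - b * Real.tanh (a * y))
      (a * ((1 - Real.tanh (b * y) ^ 2) * b) - b * ((1 - Real.tanh (a * y) ^ 2) * a)) y :=
    fun y => by
    have hl : ∀ c : ℝ, HasDerivAt (fun y => c * y) c y := fun c => by
      simpa using (hasDerivAt_id y).const_mul c
    exact (((hasDerivAt_tanh (b * y)).comp y (hl b)).const_mul a).sub
      (((hasDerivAt_tanh (a * y)).comp y (hl a)).const_mul b)
  have hm : Antitone (fun y => a * Real.tanh (b * y) - b * Real.tanh (a * y)) := by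
    refine antitone_of_deriv_nonpos (fun y => (hd y).differentiableAt) fun y => ?_
    rw [(hd y).deriv]
    have := tanh_sq_mul_mono ha hab y
    have hb : 0 ≤ b := ha.trans hab
    nlinarith [mul_nonneg ha hb]
  have := hm hx
  simp only [mul_zero, Real.tanh_zero, sub_zero] at this
  linarith

lemma integrable_tanh_sq (a : ℝ) :
    Integrable (fun x => Activation.fn .tanh (a * x) ^ 2) stdGaussian :=
  (Activation.memLp_fn .tanh a).integrable_sq

lemma dual_tanh_mono {u v : ℝ} (huv : u ≤ v) :
    dual (Activation.fn .tanh) u 1 ≤ dual (Activation.fn .tanh) v 1 := by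
  rw [dual_one, dual_one]
  exact integral_mono (integrable_tanh_sq _) (integrable_tanh_sq _)
    fun x => tanh_sq_mul_mono (Real.sqrt_nonneg u) (Real.sqrt_le_sqrt huv) x

lemma mul_dual_tanh_le {u v : ℝ} (hu : 0 ≤ u) (huv : u ≤ v) :
    u * dual (Activation.fn .tanh) v 1 ≤ v * dual (Activation.fn .tanh) u 1 := by
  rw [dual_one, dual_one, ← integral_const_mul, ← integral_const_mul]
  refine integral_mono ((integrable_tanh_sq _).const_mul _) ((integrable_tanh_sq _).const_mul _)
    fun x => ?_
  have key : ∀ x : ℝ, 0 ≤ x → u * Real.tanh (√v * x) ^ 2 ≤ v * Real.tanh (√u * x) ^ 2 :=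
    fun x hx => by
    have h1 := mul_tanh_le (Real.sqrt_nonneg u) (Real.sqrt_le_sqrt huv) hx
    have h2 : 0 ≤ Real.tanh (√v * x) := by
      simpa using strictMono_tanh.monotone (mul_nonneg (Real.sqrt_nonneg v) hx)
    have h3 := pow_le_pow_left₀ (mul_nonneg (Real.sqrt_nonneg u) h2) h1 2
    rwa [mul_pow, mul_pow, Real.sq_sqrt hu, Real.sq_sqrt (hu.trans huv)] at h3
  rcases le_total 0 x with hx | hx
  · exact key x hx
  · simpa [Activation.fn, Real.tanh_neg] using key (-x) (by linarith)

/-- The variance map of the hyperbolic tangent contracts towards its fixed points. -/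
lemma abs_varianceMap_sub_le {σb σw q : ℝ} (hq : 0 < q)
    (hfix : varianceMap .tanh σb σw q = q) {v : ℝ} (hv : 0 ≤ v) :
    |varianceMap .tanh σb σw v - q| ≤ (1 - σb ^ 2 / q) * |v - q| := by
  rw [varianceMap_eq] at hfix ⊢
  set T := dual (Activation.fn .tanh) with hT
  have e : 1 - σb ^ 2 / q = σw ^ 2 * T q 1 / q := by
    field_simp
    linarith
  rw [e]
  have hw : 0 ≤ σw ^ 2 := sq_nonneg _
  rcases le_total v q with h | h
  · have h1 := mul_le_mul_of_nonneg_left (dual_tanh_mono h) hw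
    have h2 := mul_le_mul_of_nonneg_left (mul_dual_tanh_le hv h) hw
    rw [abs_of_nonpos (by linarith), abs_of_nonpos (by linarith), div_mul_eq_mul_div,
      le_div_iff₀ hq]
    nlinarith
  · have h1 := mul_le_mul_of_nonneg_left (dual_tanh_mono h) hw
    have h2 := mul_le_mul_of_nonneg_left (mul_dual_tanh_le hq.le h) hw
    rw [abs_of_nonneg (by linarith), abs_of_nonneg (by linarith), div_mul_eq_mul_div,
      le_div_iff₀ hq]
    nlinarith

lemma abs_dfn_sq_sub_le (x y : ℝ) :
    |Activation.dfn .tanh x ^ 2 - Activation.dfn .tanh y ^ 2| ≤ 4 * |x - y| := by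
  have hd : ∀ z, HasDerivAt (fun z => Activation.dfn .tanh z ^ 2)
      (2 * Activation.dfn .tanh z * tanhSecond z) z := fun z => by
    have := (hasDerivAt_tanh_dfn z).pow 2
    convert! this using 1
    simp
  have h := Convex.norm_image_sub_le_of_norm_hasDerivWithin_le (s := Set.univ) (C := 4)
    (fun z _ => (hd z).hasDerivWithinAt) (fun z _ => ?_) convex_univ (Set.mem_univ y)
    (Set.mem_univ x)
  · simpa [Real.norm_eq_abs] using h
  · rw [Real.norm_eq_abs, abs_mul, abs_mul, abs_two]
    have h1 := Activation.abs_dfn_le .tanh z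
    have h2 := abs_tanhSecond_le z
    nlinarith [abs_nonneg (Activation.dfn .tanh z), abs_nonneg (tanhSecond z)]

lemma exists_abs_chi_sub_le (σw : ℝ) {q : ℝ} (hq : 0 < q) :
    ∃ C, ∀ v, 0 ≤ v → |chi .tanh σw v - chi .tanh σw q| ≤ C * |v - q| := by
  have hx : Integrable (fun x : ℝ => |x|) stdGaussian := by
    have : MemLp (fun x : ℝ => x ^ 1) 1 stdGaussian := memLp_pow 1 1 (by simp)
    simpa using (memLp_one_iff_integrable.1 this).abs
  refine ⟨σw ^ 2 * (4 / √q * ∫ x, |x| ∂stdGaussian), fun v hv => ?_⟩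
  have hsq : |√v - √q| ≤ |v - q| / √q := by
    have hq' := Real.sqrt_pos.2 hq
    have e : v - q = (√v - √q) * (√v + √q) := by
      have h1 := Real.mul_self_sqrt hv
      have h2 := Real.mul_self_sqrt hq.le
      linear_combination h2 - h1
    rw [le_div_iff₀ hq']
    conv_rhs => rw [e, abs_mul]
    refine mul_le_mul_of_nonneg_left ?_ (abs_nonneg _)
    exact (by linarith [Real.sqrt_nonneg v] : √q ≤ √v + √q).trans (le_abs_self _)
  have hi : ∀ a : ℝ, Integrable (fun x => Activation.dfn .tanh (a * x) ^ 2) stdGaussian :=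
    fun a => (Activation.memLp_dfn .tanh a).integrable_sq
  rw [chi, chi, ← mul_sub, abs_mul, abs_of_nonneg (sq_nonneg σw), mul_assoc]
  refine mul_le_mul_of_nonneg_left ?_ (sq_nonneg _)
  rw [← integral_sub (hi _) (hi _)]
  refine (abs_integral_le_integral_abs).trans ?_
  have hb : ∫ x, |Activation.dfn .tanh (√v * x) ^ 2 - Activation.dfn .tanh (√q * x) ^ 2|
      ∂stdGaussian ≤ ∫ x, 4 * (|v - q| / √q) * |x| ∂stdGaussian := by
    refine integral_mono ((hi _).sub (hi _)).abs (hx.const_mul _) fun x => ?_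
    refine (abs_dfn_sq_sub_le _ _).trans ?_
    rw [← sub_mul, abs_mul, mul_assoc]
    have := mul_le_mul_of_nonneg_right hsq (abs_nonneg x)
    linarith
  refine hb.trans_eq ?_
  rw [integral_const_mul]
  ring

/-! ### Arc-cosine kernels -/

/-- Polar coordinates for the Gaussian integral of a homogeneous function. -/
lemma integral_stdGaussian_prod_polar {Φ : ℝ × ℝ → ℝ} {k : ℕ}
    (hΦ : ∀ r : ℝ, 0 < r → ∀ x y : ℝ, Φ (r * x, r * y) = r ^ k * Φ (x, y)) :
    ∫ z, Φ z ∂(stdGaussian.prod stdGaussian) =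
      (2 * Real.pi)⁻¹ * ((∫ r in Set.Ioi (0 : ℝ), r ^ (k + 1) * Real.exp (-r ^ 2 / 2)) *
        ∫ ψ in Set.Ioo (-Real.pi) Real.pi, Φ (Real.cos ψ, Real.sin ψ)) := by
  have h1 : (stdGaussian.prod stdGaussian) = (volume : Measure (ℝ × ℝ)).withDensity
      (fun z => gaussianPDF 0 1 z.1 * gaussianPDF 0 1 z.2) := by
    rw [stdGaussian, gaussianReal_of_var_ne_zero _ one_ne_zero,
      prod_withDensity (measurable_gaussianPDF 0 1) (measurable_gaussianPDF 0 1)]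
    rfl
  have hm : Measurable (fun z : ℝ × ℝ => gaussianPDF 0 1 z.1 * gaussianPDF 0 1 z.2) :=
    ((measurable_gaussianPDF 0 1).comp measurable_fst).mul
      ((measurable_gaussianPDF 0 1).comp measurable_snd)
  rw [h1, integral_withDensity_eq_integral_toReal_smul hm
    (ae_of_all _ fun z => ENNReal.mul_lt_top gaussianPDF_lt_top gaussianPDF_lt_top),
    ← integral_comp_polarCoord_symm, polarCoord_target, ← setIntegral_prod_mul,
    ← integral_const_mul]
  refine setIntegral_congr_fun (measurableSet_Ioi.prod measurableSet_Ioo) fun p hp => ?_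
  have hr : 0 < p.1 := hp.1
  have hpi : 0 ≤ 2 * Real.pi := by positivity
  simp only [polarCoord_symm_apply, smul_eq_mul, ENNReal.toReal_mul, toReal_gaussianPDF,
    gaussianPDFReal, hΦ p.1 hr, NNReal.coe_one, mul_one, sub_zero]
  have e1 : (√(2 * Real.pi))⁻¹ * Real.exp (-(p.1 * Real.cos p.2) ^ 2 / 2) *
      ((√(2 * Real.pi))⁻¹ * Real.exp (-(p.1 * Real.sin p.2) ^ 2 / 2)) =
      (2 * Real.pi)⁻¹ * Real.exp (-p.1 ^ 2 / 2) := by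
    rw [mul_mul_mul_comm, ← mul_inv, Real.mul_self_sqrt hpi, ← Real.exp_add]
    congr 2
    linear_combination (-p.1 ^ 2 / 2) * Real.sin_sq_add_cos_sq p.2
  rw [e1]
  ring

/-- `max x 0 ^ k`, with the convention that it is an indicator function for `k = 0`. -/
def reluPow (k : ℕ) (x : ℝ) : ℝ := if 0 < x then x ^ k else 0

lemma reluPow_mul (k : ℕ) {r : ℝ} (hr : 0 < r) (x : ℝ) :
    reluPow k (r * x) = r ^ k * reluPow k x := by
  simp only [reluPow, mul_pos_iff_of_pos_left hr]
  split_ifs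
  · rw [mul_pow]
  · simp

lemma integral_reluPow_circle (k : ℕ) {θ : ℝ} (h0 : 0 ≤ θ) (hπ : θ ≤ Real.pi) :
    ∫ ψ in Set.Ioo (-Real.pi) Real.pi,
        reluPow k (Real.cos ψ) * reluPow k (Real.cos θ * Real.cos ψ + Real.sin θ * Real.sin ψ) =
      ∫ ψ in (θ - Real.pi / 2)..(Real.pi / 2), (Real.cos ψ * Real.cos (ψ - θ)) ^ k := by
  have hsub : Set.Ioo (θ - Real.pi / 2) (Real.pi / 2) ⊆ Set.Ioo (-Real.pi) Real.pi :=
    Set.Ioo_subset_Ioo (by linarith) (by linarith)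
  rw [intervalIntegral.integral_of_le (by linarith), integral_Ioc_eq_integral_Ioo,
    ← Set.inter_eq_self_of_subset_right hsub, ← setIntegral_indicator measurableSet_Ioo]
  refine setIntegral_congr_fun measurableSet_Ioo fun ψ hψ => ?_
  have e : Real.cos θ * Real.cos ψ + Real.sin θ * Real.sin ψ = Real.cos (ψ - θ) := by
    rw [Real.cos_sub]; ring
  simp only [e]
  by_cases h1 : ψ ∈ Set.Ioo (θ - Real.pi / 2) (Real.pi / 2)
  · have hc1 : 0 < Real.cos ψ := Real.cos_pos_of_mem_Ioo ⟨by linarith [h1.1], h1.2⟩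
    have hc2 : 0 < Real.cos (ψ - θ) :=
      Real.cos_pos_of_mem_Ioo ⟨by linarith [h1.1], by linarith [h1.2]⟩
    rw [Set.indicator_of_mem h1, reluPow, reluPow, if_pos hc1, if_pos hc2, mul_pow]
  · rw [Set.indicator_of_notMem h1]
    rcases le_or_gt (Real.pi / 2) ψ with h2 | h2
    · have := Real.cos_nonpos_of_pi_div_two_le_of_le h2 (by linarith [hψ.2])
      rw [reluPow, if_neg this.not_gt, zero_mul]
    · have h3 : ψ ≤ θ - Real.pi / 2 := by
        by_contra h
        exact h1 ⟨not_le.1 h, h2⟩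
      rcases le_or_gt ψ (-(Real.pi / 2)) with h4 | h4
      · have := Real.cos_nonpos_of_pi_div_two_le_of_le (x := -ψ) (by linarith) (by linarith [hψ.1])
        rw [Real.cos_neg] at this
        rw [reluPow, if_neg this.not_gt, zero_mul]
      · have := Real.cos_nonpos_of_pi_div_two_le_of_le (x := θ - ψ) (by linarith) (by linarith)
        rw [← neg_sub, Real.cos_neg] at this
        rw [reluPow.eq_def k (Real.cos (ψ - θ)), if_neg this.not_gt, mul_zero]

lemma dual_reluPow (k : ℕ) {v θ : ℝ} (hv : 0 < v) (h0 : 0 ≤ θ) (hπ : θ ≤ Real.pi) :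
    dual (reluPow k) v (Real.cos θ) = (2 * Real.pi)⁻¹ *
      ((∫ r in Set.Ioi (0 : ℝ), r ^ (2 * k + 1) * Real.exp (-r ^ 2 / 2)) * (v ^ k *
        ∫ ψ in (θ - Real.pi / 2)..(Real.pi / 2), (Real.cos ψ * Real.cos (ψ - θ)) ^ k)) := by
  have hsv := Real.sqrt_pos.2 hv
  have hs : √(1 - Real.cos θ ^ 2) = Real.sin θ := by
    rw [← Real.sin_sq, Real.sqrt_sq (Real.sin_nonneg_of_nonneg_of_le_pi h0 hπ)]
  have hvk : √v ^ k * √v ^ k = v ^ k := by rw [← mul_pow, Real.mul_self_sqrt hv.le]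
  rw [dual, hs, ← integral_reluPow_circle k h0 hπ, ← integral_const_mul,
    integral_stdGaussian_prod_polar (k := 2 * k)]
  · congr 3
    ext ψ
    rw [reluPow_mul k hsv, reluPow_mul k hsv, ← hvk]
    ring
  · intro r hr x y
    have e : √v * (Real.cos θ * (r * x) + Real.sin θ * (r * y)) =
      r * (√v * (Real.cos θ * x + Real.sin θ * y)) := by ring
    dsimp only
    rw [e, mul_left_comm √v r x, reluPow_mul k hr, reluPow_mul k hr]
    ring

lemma integral_radial (k : ℕ) :
    ∫ r in Set.Ioi (0 : ℝ), r ^ (2 * k + 1) * Real.exp (-r ^ 2 / 2) =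
      2 ^ k * Real.Gamma ((k : ℝ) + 1) := by
  have h := integral_rpow_mul_exp_neg_mul_rpow (p := 2) (q := 2 * k + 1) (b := 1 / 2)
    (by norm_num) (by have : (0 : ℝ) ≤ k := by positivity
                      linarith) (by norm_num)
  have e : ∀ r ∈ Set.Ioi (0 : ℝ), r ^ (2 * k + 1) * Real.exp (-r ^ 2 / 2) =
      r ^ (2 * (k : ℝ) + 1) * Real.exp (-(1 / 2) * r ^ (2 : ℝ)) := fun r _ => by
    rw [← Real.rpow_natCast, ← Real.rpow_natCast]
    push_cast
    congr 2; ring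
  rw [setIntegral_congr_fun measurableSet_Ioi e, h]
  have e1 : (2 * (k : ℝ) + 1 + 1) / 2 = k + 1 := by ring
  have e2 : -(2 * (k : ℝ) + 1 + 1) / 2 = -((k + 1 : ℕ) : ℝ) := by push_cast; ring
  rw [e1, e2, Real.rpow_neg (by norm_num), Real.rpow_natCast, one_div, inv_pow, inv_inv, pow_succ]
  ring

lemma integral_cos_mul_cos (θ : ℝ) :
    ∫ ψ in (θ - Real.pi / 2)..(Real.pi / 2), (Real.cos ψ * Real.cos (ψ - θ)) ^ 1 =
      1 / 2 * ((Real.pi - θ) * Real.cos θ + Real.sin θ) := by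
  have hd : ∀ ψ ∈ Set.uIcc (θ - Real.pi / 2) (Real.pi / 2), HasDerivAt
      (fun ψ => 1 / 2 * (ψ * Real.cos θ + Real.sin ψ * Real.cos (ψ - θ)))
      ((Real.cos ψ * Real.cos (ψ - θ)) ^ 1) ψ := fun ψ _ => by
    have h1 : HasDerivAt (fun ψ => Real.cos (ψ - θ)) (-Real.sin (ψ - θ) * 1) ψ := by
      simpa using ((hasDerivAt_id ψ).sub_const θ).cos
    have h2 := (((hasDerivAt_id ψ).mul_const (Real.cos θ)).add
      ((Real.hasDerivAt_sin ψ).mul h1)).const_mul (1 / 2)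
    convert! h2 using 1
    have e : Real.cos θ = Real.cos ψ * Real.cos (ψ - θ) + Real.sin ψ * Real.sin (ψ - θ) := by
      rw [← Real.cos_sub]; congr 1; ring
    rw [e]; ring
  rw [intervalIntegral.integral_eq_sub_of_hasDerivAt hd
    ((by fun_prop : Continuous _).intervalIntegrable _ _)]
  have e1 : θ - Real.pi / 2 - θ = -(Real.pi / 2) := by ring
  rw [e1, Real.cos_neg, Real.cos_pi_div_two, Real.sin_pi_div_two, Real.cos_pi_div_two_sub]
  ring

lemma relu_fn_eq : Activation.fn .relu = reluPow 1 := by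
  ext x
  simp only [Activation.fn, reluPow, pow_one]
  split_ifs with h
  · exact max_eq_left h.le
  · exact max_eq_right (not_lt.1 h)

lemma relu_dfn_eq : Activation.dfn .relu = reluPow 0 := by
  ext x
  simp [Activation.dfn, reluPow]

/-- The defect `(sin θ - θ cos θ) / π` of the arc-cosine kernel of order one. -/
def arcDefect (θ : ℝ) : ℝ := (Real.sin θ - θ * Real.cos θ) / Real.pi

lemma dual_relu {v θ : ℝ} (hv : 0 < v) (h0 : 0 ≤ θ) (hπ : θ ≤ Real.pi) :
    dual (Activation.fn .relu) v (Real.cos θ) = v / 2 * (Real.cos θ + arcDefect θ) := by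
  rw [relu_fn_eq, dual_reluPow 1 hv h0 hπ, integral_radial, integral_cos_mul_cos, arcDefect]
  rw [Nat.cast_one, Real.Gamma_add_one one_ne_zero, Real.Gamma_one]
  field_simp
  ring

lemma dual_relu_dfn {v θ : ℝ} (hv : 0 < v) (h0 : 0 ≤ θ) (hπ : θ ≤ Real.pi) :
    dual (Activation.dfn .relu) v (Real.cos θ) = 1 / 2 * (1 - θ / Real.pi) := by
  rw [relu_dfn_eq, dual_reluPow 0 hv h0 hπ, integral_radial]
  simp
  field_simp
  ring

lemma arcDefect_zero : arcDefect 0 = 0 := by simp [arcDefect]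

lemma continuous_arcDefect : Continuous arcDefect := by
  unfold arcDefect
  fun_prop

lemma arcDefect_pos {θ : ℝ} (h0 : 0 < θ) (hπ : θ ≤ Real.pi) : 0 < arcDefect θ := by
  have hpi := Real.pi_pos
  refine div_pos ?_ hpi
  rcases lt_or_ge θ (Real.pi / 2) with h | h
  · have hc : 0 < Real.cos θ := Real.cos_pos_of_mem_Ioo ⟨by linarith, h⟩
    have := Real.lt_tan h0 h
    rw [Real.tan_eq_sin_div_cos, lt_div_iff₀ hc] at this
    linarith
  · have hc := Real.cos_nonpos_of_pi_div_two_le_of_le h (by linarith)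
    rcases hπ.lt_or_eq with h1 | rfl
    · have := Real.sin_pos_of_pos_of_lt_pi h0 h1
      nlinarith
    · simp [hpi]

lemma dual_relu_one {v : ℝ} (hv : 0 < v) : dual (Activation.fn .relu) v 1 = v / 2 := by
  simpa [arcDefect_zero] using dual_relu hv le_rfl Real.pi_pos.le

lemma dual_relu_dfn_one {v : ℝ} (hv : 0 < v) : dual (Activation.dfn .relu) v 1 = 1 / 2 := by
  simpa using dual_relu_dfn hv le_rfl Real.pi_pos.le

lemma tendsto_arcDefect_div :
    Tendsto (fun θ => arcDefect θ / θ ^ 3) (𝓝[>] 0) (𝓝 (1 / (3 * Real.pi))) := by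
  have hpi := Real.pi_pos
  rw [tendsto_iff_norm_sub_tendsto_zero]
  refine squeeze_zero' (Eventually.of_forall fun _ => norm_nonneg _)
    (g := fun θ : ℝ => 2 * θ) ?_ ?_
  · filter_upwards [Ioo_mem_nhdsGT (zero_lt_one' ℝ)] with θ hθ
    have h1 : |θ| ≤ 1 := by rw [abs_of_pos hθ.1]; exact hθ.2.le
    have hc := Real.cos_bound h1
    have hs := Real.sin_bound h1
    rw [abs_of_pos hθ.1] at hc hs
    rw [abs_le] at hc hs
    have hp : 0 < θ ^ 3 := pow_pos hθ.1 3
    have h4 : 0 < θ ^ 4 := pow_pos hθ.1 4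
    have h5 : θ * θ ^ 4 ≤ θ ^ 4 := mul_le_of_le_one_left h4.le hθ.2.le
    have e : arcDefect θ / θ ^ 3 - 1 / (3 * Real.pi) =
        (Real.sin θ - θ * Real.cos θ - θ ^ 3 / 3) / (Real.pi * θ ^ 3) := by
      have := hθ.1.ne'
      rw [arcDefect]; field_simp
    rw [e, Real.norm_eq_abs, abs_div, abs_of_pos (mul_pos hpi hp), div_le_iff₀ (mul_pos hpi hp)]
    have h6 : |Real.sin θ - θ * Real.cos θ - θ ^ 3 / 3| ≤ θ ^ 4 := by
      rw [abs_le]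
      constructor <;> nlinarith
    refine h6.trans ?_
    have h7 : (1 : ℝ) ≤ 2 * Real.pi := by linarith [Real.pi_gt_three]
    calc θ ^ 4 ≤ 2 * Real.pi * θ ^ 4 := le_mul_of_one_le_left h4.le h7
      _ = 2 * θ * (Real.pi * θ ^ 3) := by ring
  · have : Tendsto (fun θ : ℝ => 2 * θ) (𝓝 0) (𝓝 (2 * 0)) := tendsto_id.const_mul 2
    rw [mul_zero] at this
    exact this.mono_left nhdsWithin_le_nhds

lemma tendsto_one_sub_cos_div :
    Tendsto (fun θ => (1 - Real.cos θ) / θ ^ 2) (𝓝[>] 0) (𝓝 (1 / 2)) := by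
  rw [tendsto_iff_norm_sub_tendsto_zero]
  refine squeeze_zero' (Eventually.of_forall fun _ => norm_nonneg _)
    (g := fun θ : ℝ => θ) ?_ ?_
  · filter_upwards [Ioo_mem_nhdsGT (zero_lt_one' ℝ)] with θ hθ
    have h1 : |θ| ≤ 1 := by rw [abs_of_pos hθ.1]; exact hθ.2.le
    have hc := Real.cos_bound h1
    rw [abs_of_pos hθ.1] at hc
    rw [abs_le] at hc
    have hp : 0 < θ ^ 2 := pow_pos hθ.1 2
    have h4 : θ ^ 4 ≤ θ ^ 3 := pow_le_pow_of_le_one hθ.1.le hθ.2.le (by norm_num)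
    have e : (1 - Real.cos θ) / θ ^ 2 - 1 / 2 = (1 - Real.cos θ - θ ^ 2 / 2) / θ ^ 2 := by
      have := hθ.1.ne'
      field_simp
    rw [e, Real.norm_eq_abs, abs_div, abs_of_pos hp, div_le_iff₀ hp]
    have e3 : θ * θ ^ 2 = θ ^ 3 := by ring
    rw [e3, abs_le]
    constructor <;> linarith
  · exact tendsto_id.mono_left nhdsWithin_le_nhds

/-! ### Asymptotics of recursive sequences -/

lemma tendsto_zero_of_le_average {y α ε : ℕ → ℝ} (hy : ∀ l, 0 ≤ y l)
    (hα : ∀ᶠ l in atTop, α l ∈ Set.Icc (0 : ℝ) 1) (hs : ¬ Summable α)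
    (hε : Tendsto ε atTop (𝓝 0))
    (h : ∀ᶠ l in atTop, y (l + 1) ≤ (1 - α l) * y l + α l * ε l) :
    Tendsto y atTop (𝓝 0) := by
  refine tendsto_order.2 ⟨fun a ha => Eventually.of_forall fun l => ha.trans_le (hy l),
    fun η hη => ?_⟩
  obtain ⟨N, hN⟩ := eventually_atTop.1
    ((hα.and h).and (hε.eventually_le_const (half_pos hη)))
  have hs' : Tendsto (fun n => ∑ i ∈ Finset.range n, α (i + N)) atTop atTop := by
    refine (not_summable_iff_tendsto_nat_atTop_of_nonneg fun i => ?_).1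
      (mt (summable_nat_add_iff N).1 hs)
    exact (hN (i + N) (by omega)).1.1.1
  have key : ∀ n, y (n + N) - η / 2 ≤
      Real.exp (-∑ i ∈ Finset.range n, α (i + N)) * |y N - η / 2| := fun n => by
    induction n with
    | zero => simpa using le_abs_self (y N - η / 2)
    | succ n ih =>
      obtain ⟨⟨⟨h0, h1⟩, h2⟩, h3⟩ := hN (n + N) (by omega)
      have h4 := mul_le_mul_of_nonneg_left h3 h0
      have h5 := mul_le_mul_of_nonneg_left ih (sub_nonneg.2 h1)
      have h6 : 1 - α (n + N) ≤ Real.exp (-α (n + N)) := Real.one_sub_le_exp_neg _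
      have h7 := mul_le_mul_of_nonneg_right h6
        (mul_nonneg (Real.exp_pos (-∑ i ∈ Finset.range n, α (i + N))).le
          (abs_nonneg (y N - η / 2)))
      rw [Finset.sum_range_succ, neg_add, Real.exp_add, mul_comm (Real.exp _) (Real.exp _),
        mul_assoc]
      rw [show n + 1 + N = n + N + 1 by omega]
      linarith
  have hlim : Tendsto (fun n => Real.exp (-∑ i ∈ Finset.range n, α (i + N)) * |y N - η / 2|)
      atTop (𝓝 0) := by
    have := (Real.tendsto_exp_neg_atTop_nhds_zero.comp hs').mul_const |y N - η / 2|
    simpa using this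
  have h8 : ∀ᶠ n in atTop, y (n + N) < η := by
    filter_upwards [hlim.eventually_lt_const (half_pos hη)] with n hn
    linarith [key n]
  obtain ⟨n0, hn0⟩ := eventually_atTop.1 h8
  refine eventually_atTop.2 ⟨n0 + N, fun l hl => ?_⟩
  have := hn0 (l - N) (by omega)
  rwa [Nat.sub_add_cancel (by omega)] at this

lemma not_summable_const_pos {a : ℝ} (ha : a ≠ 0) : ¬ Summable (fun _ : ℕ => a) := fun h =>
  ha (tendsto_nhds_unique tendsto_const_nhds h.tendsto_atTop_zero)

/-- Sequences contracted towards a point up to a vanishing error. -/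
lemma tendsto_zero_of_le_mul_add {y ε κ : ℕ → ℝ} {k : ℝ} (hy : ∀ l, 0 ≤ y l) (hk0 : 0 ≤ k)
    (hk1 : k < 1) (hκ : ∀ᶠ l in atTop, κ l ≤ k) (hε : Tendsto ε atTop (𝓝 0))
    (h : ∀ᶠ l in atTop, y (l + 1) ≤ κ l * y l + ε l) : Tendsto y atTop (𝓝 0) := by
  have hp : 0 < 1 - k := by linarith
  refine tendsto_zero_of_le_average (α := fun _ => 1 - k) (ε := fun l => ε l / (1 - k)) hy
    (Eventually.of_forall fun _ => ⟨hp.le, by linarith⟩) (not_summable_const_pos hp.ne')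
    (by simpa using hε.div_const (1 - k)) ?_
  filter_upwards [h, hκ] with l h1 h2
  have := mul_le_mul_of_nonneg_right h2 (hy l)
  rw [mul_div_cancel₀ _ hp.ne']
  linarith

lemma tendsto_of_linear_recursion {x r h : ℕ → ℝ} {r₀ h₀ : ℝ} (hr : Tendsto r atTop (𝓝 r₀))
    (hr1 : |r₀| < 1) (hh : Tendsto h atTop (𝓝 h₀)) (hx : ∀ l, x (l + 1) = r l * x l + h l) :
    Tendsto x atTop (𝓝 (h₀ / (1 - r₀))) := by
  set m := h₀ / (1 - r₀) with hm
  have hne : 1 - r₀ ≠ 0 := by linarith [le_abs_self r₀]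
  obtain ⟨k, hk, hk1⟩ := exists_between hr1
  have hε : Tendsto (fun l => |h l - (1 - r l) * m|) atTop (𝓝 0) := by
    have h1 := (hh.sub ((hr.const_sub 1).mul_const m)).abs
    have h2 : h₀ - (1 - r₀) * m = 0 := by rw [hm]; field_simp; ring
    rwa [h2, abs_zero] at h1
  rw [tendsto_iff_norm_sub_tendsto_zero]
  refine tendsto_zero_of_le_mul_add (κ := fun l => |r l|) (fun l => norm_nonneg _)
    ((abs_nonneg _).trans hk.le) hk1 (hr.abs.eventually_le_const hk) hε
    (Eventually.of_forall fun l => ?_)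
  rw [Real.norm_eq_abs, Real.norm_eq_abs, ← abs_mul, hx]
  refine le_trans (le_of_eq ?_) (abs_add_le _ _)
  congr 1; ring

lemma tendsto_div_of_recursion {x e h : ℕ → ℝ} {a h₀ : ℝ} (ha : 0 ≤ a)
    (he : Tendsto (fun l : ℕ => l * e l) atTop (𝓝 a)) (hh : Tendsto h atTop (𝓝 h₀))
    (hx : ∀ l, x (l + 1) = (1 - e l) * x l + h l) :
    Tendsto (fun l : ℕ => x l / l) atTop (𝓝 (h₀ / (1 + a))) := by
  set m := h₀ / (1 + a) with hm
  have hane : 1 + a ≠ 0 := by linarith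
  rw [tendsto_iff_norm_sub_tendsto_zero]
  have hα0 : ∀ᶠ l : ℕ in atTop, 1 / 2 ≤ 1 + l * e l :=
    (he.const_add 1).eventually_const_le (by linarith)
  have hα1 : ∀ᶠ l : ℕ in atTop, 1 + l * e l ≤ (l : ℝ) + 1 := by
    filter_upwards [he.eventually_le_const (lt_add_one a),
      (tendsto_natCast_atTop_atTop (R := ℝ)).eventually_ge_atTop (a + 1)] with l h1 h2
    linarith
  refine tendsto_zero_of_le_average (α := fun l : ℕ => (1 + l * e l) / (l + 1))
    (ε := fun l : ℕ => |h l - m - l * e l * m| / (1 + l * e l)) (fun l => norm_nonneg _) ?_ ?_ ?_ ?_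
  · filter_upwards [hα0, hα1] with l h3 h4
    have : (0 : ℝ) < (l : ℝ) + 1 := by positivity
    exact ⟨div_nonneg (by linarith) this.le, (div_le_one this).2 h4⟩
  · intro hs
    have h3 : Summable (fun l : ℕ => 1 / 2 * (1 / ((l : ℝ) + 1))) := by
      refine Summable.of_norm_bounded_eventually_nat hs ?_
      filter_upwards [hα0] with l hl
      have : (0 : ℝ) < (l : ℝ) + 1 := by positivity
      rw [Real.norm_eq_abs, abs_of_nonneg (by positivity), ← mul_div_assoc, mul_one]
      gcongr
    have h4 : Summable (fun l : ℕ => 1 / (((l + 1 : ℕ)) : ℝ)) := by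
      have := h3.mul_left 2
      refine this.congr fun l => ?_
      push_cast; ring
    exact Real.not_summable_one_div_natCast ((summable_nat_add_iff 1).1 h4)
  · have h1 : Tendsto (fun l : ℕ => |h l - m - l * e l * m|) atTop (𝓝 0) := by
      have h2 := ((hh.sub_const m).sub (he.mul_const m)).abs
      have h3 : h₀ - m - a * m = 0 := by rw [hm]; field_simp; ring
      rwa [h3, abs_zero] at h2
    have h4 : Tendsto (fun l : ℕ => |h l - m - l * e l * m| / (1 + l * e l)) atTop
        (𝓝 (0 / (1 + a))) := h1.div (he.const_add 1) hane
    rwa [zero_div] at h4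
  · filter_upwards [hα0, hα1, eventually_gt_atTop 0] with l hl hle hl0
    have hl1 : (0 : ℝ) < (l : ℝ) + 1 := by positivity
    have h1 : 0 ≤ 1 - (1 + l * e l) / ((l : ℝ) + 1) := sub_nonneg.2 ((div_le_one hl1).2 hle)
    have e1 : (1 + l * e l) / ((l : ℝ) + 1) * (|h l - m - l * e l * m| / (1 + l * e l)) =
        |(h l - m - l * e l * m) / ((l : ℝ) + 1)| := by
      rw [abs_div, abs_of_pos hl1]
      field_simp
    have e2 : (1 - (1 + l * e l) / ((l : ℝ) + 1)) * |x l / l - m| =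
        |(1 - (1 + l * e l) / ((l : ℝ) + 1)) * (x l / l - m)| := by
      rw [abs_mul, abs_of_nonneg h1]
    rw [Real.norm_eq_abs, Real.norm_eq_abs, hx, e1, e2]
    refine le_trans (le_of_eq ?_) (abs_add_le _ _)
    congr 1
    push_cast
    field_simp
    ring

/-- Sequences with `w (l + 1) = w l * (1 - η l)` and `η ~ β w` decay like `1 / (β l)`. -/
lemma tendsto_mul_of_quadratic_decay {w η : ℕ → ℝ} {β : ℝ} (hw : ∀ l, 0 < w l)
    (hw0 : Tendsto w atTop (𝓝 0)) (h : ∀ l, w (l + 1) = w l * (1 - η l))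
    (hη : Tendsto (fun l => η l / w l) atTop (𝓝 β)) (hβ : 0 < β) :
    Tendsto (fun l : ℕ => l * w l) atTop (𝓝 (1 / β)) := by
  have hη0 : Tendsto η atTop (𝓝 0) := by
    have := hη.mul hw0
    rw [mul_zero] at this
    exact this.congr fun l => div_mul_cancel₀ _ (hw l).ne'
  have h1 : ∀ l, (w (l + 1))⁻¹ - (w l)⁻¹ = η l / w l / (1 - η l) := fun l => by
    have h2 := hw l
    have h3 := hw (l + 1)
    rw [h] at h3 ⊢
    have h4 : 1 - η l ≠ 0 := (pos_of_mul_pos_right h3 h2.le).ne'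
    have h5 := h2.ne'
    field_simp
    ring
  have h2 : Tendsto (fun l => (w (l + 1))⁻¹ - (w l)⁻¹) atTop (𝓝 β) := by
    simp only [h1]
    have h4 : Tendsto (fun l => η l / w l / (1 - η l)) atTop (𝓝 (β / (1 - 0))) :=
      hη.div (hη0.const_sub 1) (by norm_num)
    rwa [sub_zero, div_one] at h4
  have h3 := h2.cesaro
  simp only [Finset.sum_range_sub (fun l => (w l)⁻¹)] at h3
  have h4 : Tendsto (fun l : ℕ => (l : ℝ)⁻¹ * (w 0)⁻¹) atTop (𝓝 0) := by
    simpa using (tendsto_inv_atTop_nhds_zero_nat (𝕜 := ℝ)).mul_const (w 0)⁻¹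
  have h5 := ((h3.add h4).inv₀ (by simpa using hβ.ne'))
  simp only [add_zero] at h5
  rw [one_div]
  refine h5.congr fun l => ?_
  rw [← mul_add, sub_add_cancel, mul_inv, inv_inv, inv_inv]

lemma exists_partial_products {r : ℕ → ℝ} (hr : ∀ l, 0 < r l) (hs : Summable fun l => r l - 1) :
    ∃ (P : ℕ → ℝ) (R : ℝ), (∀ l, 0 < P l) ∧ 0 < R ∧ (∀ l, P (l + 1) = r l * P l) ∧
      Tendsto P atTop (𝓝 R) := by
  have h1 : Summable fun l => Real.log (r l) := by
    simpa using Real.summable_log_one_add_of_summable hs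
  refine ⟨fun l => Real.exp (∑ i ∈ Finset.range l, Real.log (r i)),
    Real.exp (∑' i, Real.log (r i)), fun l => Real.exp_pos _, Real.exp_pos _, fun l => ?_,
    (Real.continuous_exp.tendsto _).comp h1.hasSum.tendsto_sum_nat⟩
  simp only
  rw [Finset.sum_range_succ, Real.exp_add, Real.exp_log (hr l), mul_comm]

/-- Average growth of a kernel driven by a quadratically decaying gap. -/
lemma tendsto_div_of_quadratic_gap {r s x e K h : ℕ → ℝ} {b c h₀ : ℝ} (hr : ∀ l, 0 < r l)
    (hrs : Summable fun l => r l - 1) (hs : ∀ l, 0 < s l) (hs0 : Tendsto s atTop (𝓝 0))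
    (hsx : ∀ l, s (l + 1) = r l * s l * (1 - x l))
    (hx : Tendsto (fun l => x l / s l) atTop (𝓝 b)) (hb : 0 < b) (hc : 0 ≤ c)
    (he : Tendsto (fun l => e l / s l) atTop (𝓝 c)) (hh : Tendsto h atTop (𝓝 h₀))
    (hK : ∀ l, K (l + 1) = r l * (1 - e l) * K l + h l) :
    Tendsto (fun l : ℕ => K l / l) atTop (𝓝 (h₀ / (1 + c / b))) := by
  obtain ⟨P, R, hP, hR, hPr, hPR⟩ := exists_partial_products hr hrs
  have h1 : Tendsto (fun l : ℕ => l * (s l / P l)) atTop (𝓝 (1 / (b * R))) := by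
    refine tendsto_mul_of_quadratic_decay (fun l => div_pos (hs l) (hP l))
      (by
        have h : Tendsto (fun l => s l / P l) atTop (𝓝 (0 / R)) := hs0.div hPR hR.ne'
        rwa [zero_div] at h) (fun l => ?_) ?_ (mul_pos hb hR) (η := x)
    · rw [hsx, hPr]
      have := (hr l).ne'
      have := (hP l).ne'
      field_simp
    · refine (hx.mul hPR).congr fun l => ?_
      rw [div_div_eq_mul_div, div_mul_eq_mul_div]
  have h2 : Tendsto (fun l : ℕ => l * e l) atTop (𝓝 (c / b)) := by
    have h3 := (he.mul hPR).mul h1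
    have e1 : c * R * (1 / (b * R)) = c / b := by
      have := hR.ne'
      have := hb.ne'
      field_simp
    rw [e1] at h3
    refine h3.congr fun l => ?_
    have := (hP l).ne'
    have := (hs l).ne'
    field_simp
  have h3 : Tendsto (fun l => h l / P (l + 1)) atTop (𝓝 (h₀ / R)) :=
    hh.div (hPR.comp (tendsto_add_atTop_nat 1)) hR.ne'
  have h4 := tendsto_div_of_recursion (x := fun l => K l / P l) (div_nonneg hc hb.le) h2 h3
    fun l => by
      rw [hK, hPr]
      have := (hP l).ne'
      have := (hr l).ne'
      field_simp
  have h5 := h4.mul hPR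
  have e2 : h₀ / R / (1 + c / b) * R = h₀ / (1 + c / b) := by
    have := hR.ne'
    field_simp
  rw [e2] at h5
  refine h5.congr fun l => ?_
  have := (hP l).ne'
  field_simp

/-- Average growth of a kernel driven by an angle that decays through the arc-cosine kernel. -/
lemma tendsto_div_of_arcDefect {w θ k h : ℕ → ℝ} {W κ h₀ : ℝ} (hw : ∀ l, 0 < w l) (hW : 0 < W)
    (hwW : Tendsto w atTop (𝓝 W)) (hκ : 0 < κ) (hθ : ∀ l, θ l ∈ Set.Ioc 0 Real.pi)
    (hs : ∀ l, w (l + 1) * (1 - Real.cos (θ (l + 1))) =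
      w l * (1 - Real.cos (θ l)) - κ * w l * arcDefect (θ l))
    (hh : Tendsto θ atTop (𝓝 0) → Tendsto h atTop (𝓝 h₀))
    (hk : ∀ l, k (l + 1) = (1 - κ * (θ l / Real.pi)) * k l + h l) :
    Tendsto (fun l : ℕ => k l / l) atTop (𝓝 (h₀ / 4)) := by
  set s : ℕ → ℝ := fun l => w l * (1 - Real.cos (θ l)) with hsdef
  have hcos : ∀ l, 0 < 1 - Real.cos (θ l) := fun l => by
    have := Real.cos_lt_cos_of_nonneg_of_le_pi le_rfl (hθ l).2 (hθ l).1
    rw [Real.cos_zero] at this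
    linarith
  have hspos : ∀ l, 0 < s l := fun l => mul_pos (hw l) (hcos l)
  have hanti : Antitone s := antitone_nat_of_succ_le fun l => by
    have : 0 < κ * w l * arcDefect (θ l) :=
      mul_pos (mul_pos hκ (hw l)) (arcDefect_pos (hθ l).1 (hθ l).2)
    simp only [hsdef, hs]
    linarith
  obtain ⟨s₁, hs₁⟩ : ∃ s₁, Tendsto s atTop (𝓝 s₁) :=
    ⟨_, tendsto_atTop_ciInf hanti ⟨0, by rintro _ ⟨l, rfl⟩; exact (hspos l).le⟩⟩
  have hθeq : ∀ l, θ l = Real.arccos (1 - s l / w l) := fun l => by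
    have : 1 - s l / w l = Real.cos (θ l) := by
      simp only [hsdef]; rw [mul_div_cancel_left₀ _ (hw l).ne']; ring
    rw [this, Real.arccos_cos (hθ l).1.le (hθ l).2]
  set θ₁ := Real.arccos (1 - s₁ / W) with hθ₁
  have hθlim : Tendsto θ atTop (𝓝 θ₁) := by
    simp only [funext hθeq]
    exact (Real.continuous_arccos.tendsto _).comp ((hs₁.div hwW hW.ne').const_sub 1)
  have hθ₁0 : θ₁ = 0 := by
    have h1 : Tendsto (fun l => s (l + 1)) atTop (𝓝 (s₁ - κ * W * arcDefect θ₁)) := by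
      have : ∀ l, s (l + 1) = s l - κ * w l * arcDefect (θ l) := hs
      simp only [this]
      exact hs₁.sub ((hwW.const_mul κ).mul ((continuous_arcDefect.tendsto _).comp hθlim))
    have h2 := tendsto_nhds_unique h1 (hs₁.comp (tendsto_add_atTop_nat 1))
    by_contra hne
    have h3 : 0 < θ₁ := lt_of_le_of_ne (Real.arccos_nonneg _) (Ne.symm hne)
    have : 0 < κ * W * arcDefect θ₁ :=
      mul_pos (mul_pos hκ hW) (arcDefect_pos h3 (Real.arccos_le_pi _))
    linarith
  rw [hθ₁0] at hθlim
  have hθ' : Tendsto θ atTop (𝓝[>] 0) :=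
    tendsto_nhdsWithin_iff.2 ⟨hθlim, Eventually.of_forall fun l => (hθ l).1⟩
  have hA := tendsto_arcDefect_div.comp hθ'
  have hC := tendsto_one_sub_cos_div.comp hθ'
  simp only [Function.comp_def] at hA hC
  have hsq : Tendsto (fun l => √(s l) / θ l) atTop (𝓝 √(W / 2)) := by
    have h1 := (hwW.mul hC).sqrt
    rw [mul_one_div] at h1
    refine h1.congr fun l => ?_
    rw [← mul_div_assoc, Real.sqrt_div (hspos l).le, Real.sqrt_sq (hθ l).1.le]
  have hW2 : 0 < √(W / 2) := Real.sqrt_pos.2 (by linarith)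
  set x : ℕ → ℝ := fun l => κ * arcDefect (θ l) / (1 - Real.cos (θ l)) with hx
  have hxs : ∀ l, s (l + 1) = s l * (1 - x l) := fun l => by
    have := (hcos l).ne'
    simp only [hsdef, hx, hs]
    field_simp
  have hxθ : Tendsto (fun l => x l / θ l) atTop (𝓝 (2 * κ / (3 * Real.pi))) := by
    have h1 := (hA.const_mul κ).div hC (by norm_num)
    have e1 : κ * (1 / (3 * Real.pi)) / (1 / 2) = 2 * κ / (3 * Real.pi) := by field_simp
    rw [e1] at h1
    refine h1.congr fun l => ?_
    have := (hcos l).ne'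
    have := (hθ l).1.ne'
    simp only [hx, Pi.div_apply]
    field_simp
  have hx0 : Tendsto x atTop (𝓝 0) := by
    have := hxθ.mul hθlim
    rw [mul_zero] at this
    exact this.congr fun l => div_mul_cancel₀ _ (hθ l).1.ne'
  have hx1 : ∀ l, 0 < 1 - x l := fun l => by
    have := hspos (l + 1)
    rw [hxs] at this
    exact pos_of_mul_pos_right this (hspos l).le
  have hy0 : Tendsto (fun l => √(s l)) atTop (𝓝 0) := by
    have := hsq.mul hθlim
    rw [mul_zero] at this
    exact this.congr fun l => div_mul_cancel₀ _ (hθ l).1.ne'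
  have hdec := tendsto_mul_of_quadratic_decay (w := fun l => √(s l)) (η := fun l => 1 - √(1 - x l))
    (β := κ / (3 * Real.pi * √(W / 2))) (fun l => Real.sqrt_pos.2 (hspos l)) hy0
    (fun l => by rw [hxs, Real.sqrt_mul (hspos l).le]; ring) (by
      have h1 : Tendsto (fun l => 1 + √(1 - x l)) atTop (𝓝 2) := by
        have := ((hx0.const_sub 1).sqrt).const_add 1
        simpa [one_add_one_eq_two] using this
      have h2 := (hxθ.div hsq hW2.ne').div h1 (by norm_num)
      have e1 : 2 * κ / (3 * Real.pi) / √(W / 2) / 2 = κ / (3 * Real.pi * √(W / 2)) := by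
        field_simp
      rw [e1] at h2
      refine h2.congr fun l => ?_
      have h3 := Real.mul_self_sqrt (hx1 l).le
      have h4 : 0 < 1 + √(1 - x l) := by positivity
      have h5 := (hθ l).1.ne'
      have h6 := (Real.sqrt_pos.2 (hspos l)).ne'
      have e2 : 1 - √(1 - x l) = x l / (1 + √(1 - x l)) := by
        rw [eq_div_iff h4.ne']; linear_combination -h3
      rw [e2]
      simp only [Pi.div_apply]
      field_simp) (by positivity)
  have hlθ : Tendsto (fun l : ℕ => l * (κ * (θ l / Real.pi))) atTop (𝓝 3) := by
    have h1 := (hdec.div hsq hW2.ne').mul_const (κ / Real.pi)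
    have e1 : 1 / (κ / (3 * Real.pi * √(W / 2))) / √(W / 2) * (κ / Real.pi) = 3 := by
      field_simp
    rw [e1] at h1
    refine h1.congr fun l => ?_
    have h6 := (Real.sqrt_pos.2 (hspos l)).ne'
    simp only [Pi.div_apply]
    field_simp
  have := tendsto_div_of_recursion (by norm_num) hlθ (hh hθlim) hk
  norm_num at this
  exact this

/-! ### Correlations of the layers -/

section

variable {d : ℕ} {φ : Activation} {s σb σw : ℝ}

/-- The correlation of the layer `l + 1` as a function of the inner product of two unit inputs. -/
def corFun (d : ℕ) (φ : Activation) (s σb σw : ℝ) (l : ℕ) (t : ℝ) : ℝ :=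
  covFun d φ s σb σw l t / covFun d φ s σb σw l 1

lemma covFun_succ (hd : 2 ≤ d) (hs : 0 ≤ s) (hσw : 0 < σw) (l : ℕ) (t : ℝ) :
    covFun d φ s σb σw (l + 1) t = s * covFun d φ s σb σw l t + (σb ^ 2 + σw ^ 2 *
      dual φ.fn (covFun d φ s σb σw l 1) (corFun d φ s σb σw l t)) := by
  simp only [covFun, gaussPair_eq_dual _ (covFun_one_pos hd hs hσw l), corFun]

lemma corFun_one (hd : 2 ≤ d) (hs : 0 ≤ s) (hσw : 0 < σw) (l : ℕ) :
    corFun d φ s σb σw l 1 = 1 :=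
  div_self (covFun_one_pos hd hs hσw l).ne'

lemma covFun_succ_one (hd : 2 ≤ d) (hs : 0 ≤ s) (hσw : 0 < σw) (l : ℕ) :
    covFun d φ s σb σw (l + 1) 1 = s * covFun d φ s σb σw l 1 + (σb ^ 2 + σw ^ 2 *
      dual φ.fn (covFun d φ s σb σw l 1) 1) := by
  rw [covFun_succ hd hs hσw, corFun_one hd hs hσw]

lemma ntkFun_succ (hd : 2 ≤ d) (hs : 0 ≤ s) (hσw : 0 < σw) (l : ℕ) (t : ℝ) :
    ntkFun d φ s σb σw (l + 1) t = ntkFun d φ s σb σw l t * (s + σw ^ 2 *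
        dual φ.dfn (covFun d φ s σb σw l 1) (corFun d φ s σb σw l t)) +
      (σb ^ 2 + σw ^ 2 *
        dual φ.fn (covFun d φ s σb σw l 1) (corFun d φ s σb σw l t)) := by
  simp only [ntkFun, gaussPair_eq_dual _ (covFun_one_pos hd hs hσw l), corFun]

lemma ntkFun_succ_plain (hd : 2 ≤ d) (hσw : 0 < σw) (l : ℕ) (t : ℝ) :
    ntkFun d φ 0 σb σw (l + 1) t = σw ^ 2 *
        dual φ.dfn (covFun d φ 0 σb σw l 1) (corFun d φ 0 σb σw l t) * ntkFun d φ 0 σb σw l t +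
      covFun d φ 0 σb σw (l + 1) t := by
  rw [ntkFun_succ hd le_rfl hσw, covFun_succ hd le_rfl hσw]
  ring

lemma nonnegSeries_corFun (hd : 2 ≤ d) (hs : 0 ≤ s) (hσw : 0 < σw) (l : ℕ) :
    NonnegSeries (corFun d φ s σb σw l) :=
  (nonnegSeries_covFun hd hs hσw l).div_const (covFun_one_pos hd hs hσw l).le

lemma corFun_mem (hd : 2 ≤ d) (hs : 0 ≤ s) (hσw : 0 < σw) (l : ℕ) {t : ℝ}
    (ht : t ∈ Set.Icc (-1 : ℝ) 1) : corFun d φ s σb σw l t ∈ Set.Icc (-1 : ℝ) 1 := by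
  have h := (nonnegSeries_corFun (φ := φ) (σb := σb) hd hs hσw l).abs_le_one ht
  rw [corFun_one hd hs hσw] at h
  exact abs_le.1 h

lemma mul_one_sub_corFun (hd : 2 ≤ d) (hs : 0 ≤ s) (hσw : 0 < σw) (l : ℕ) (t : ℝ) :
    covFun d φ s σb σw l 1 * (1 - corFun d φ s σb σw l t) =
      covFun d φ s σb σw l 1 - covFun d φ s σb σw l t := by
  have := (covFun_one_pos (φ := φ) (σb := σb) hd hs hσw l).ne'
  rw [corFun]
  field_simp

/-- The gap between the variance and the covariance is at least linear in `1 - t`. -/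
lemma exists_mul_one_sub_le_gap (hd : 2 ≤ d) (hs : 0 ≤ s) (hσw : 0 < σw) (l : ℕ) :
    ∃ κ, 0 < κ ∧ ∀ t ∈ Set.Icc (-1 : ℝ) 1,
      κ * (1 - t) ≤ covFun d φ s σb σw l 1 - covFun d φ s σb σw l t := by
  induction l with
  | zero =>
    refine ⟨σw ^ 2 / d, by positivity, fun t _ => le_of_eq ?_⟩
    simp only [covFun]
    ring
  | succ l ih =>
    obtain ⟨κ, hκ, h⟩ := ih
    have hv := covFun_one_pos (φ := φ) (σb := σb) hd hs hσw l
    have ha := pow_pos (φ.hermiteCoeff_one_pos (Real.sqrt_pos.2 hv)) 2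
    refine ⟨σw ^ 2 * (hermiteCoeff (fun x => φ.fn (√(covFun d φ s σb σw l 1) * x)) 1 ^ 2 *
      (κ / covFun d φ s σb σw l 1)), by positivity, fun t ht => ?_⟩
    have h1 := φ.mul_one_sub_le_dual (covFun d φ s σb σw l 1)
      (corFun_mem (φ := φ) (σb := σb) hd hs hσw l ht)
    have h2 : κ / covFun d φ s σb σw l 1 * (1 - t) ≤ 1 - corFun d φ s σb σw l t := by
      rw [div_mul_eq_mul_div, div_le_iff₀ hv, mul_comm _ (covFun d φ s σb σw l 1),
        mul_one_sub_corFun hd hs hσw]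
      exact h t ht
    have h3 : 0 ≤ covFun d φ s σb σw l 1 - covFun d φ s σb σw l t :=
      (mul_nonneg hκ.le (by linarith [ht.2])).trans (h t ht)
    rw [covFun_succ_one hd hs hσw, covFun_succ hd hs hσw]
    have h4 := mul_le_mul_of_nonneg_left ((mul_le_mul_of_nonneg_left h2 ha.le).trans h1)
      (sq_nonneg σw)
    have h5 := mul_nonneg hs h3
    linarith

lemma covFun_lt (hd : 2 ≤ d) (hs : 0 ≤ s) (hσw : 0 < σw) (l : ℕ) {t : ℝ} (ht : -1 ≤ t)
    (ht1 : t < 1) : covFun d φ s σb σw l t < covFun d φ s σb σw l 1 := by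
  obtain ⟨κ, hκ, h⟩ := exists_mul_one_sub_le_gap (φ := φ) (σb := σb) hd hs hσw l
  have := mul_pos hκ (sub_pos.2 ht1)
  linarith [h t ⟨ht, ht1.le⟩]

lemma corFun_lt_one (hd : 2 ≤ d) (hs : 0 ≤ s) (hσw : 0 < σw) (l : ℕ) {t : ℝ} (ht : -1 ≤ t)
    (ht1 : t < 1) : corFun d φ s σb σw l t < 1 :=
  (div_lt_one (covFun_one_pos hd hs hσw l)).2 (covFun_lt hd hs hσw l ht ht1)

lemma covFun_one_eq_iterate (hd : 2 ≤ d) (hσw : 0 < σw) (l : ℕ) :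
    covFun d φ 0 σb σw l 1 = (varianceMap φ σb σw)^[l] (covFun d φ 0 σb σw 0 1) := by
  induction l with
  | zero => rfl
  | succ l ih =>
    rw [Function.iterate_succ_apply', ← ih, covFun_succ_one hd le_rfl hσw, varianceMap_eq]
    ring

lemma IsLimitVariance.tendsto_covFun (hd : 2 ≤ d) (hσw : 0 < σw) {q : ℝ}
    (h : IsLimitVariance φ σb σw (covFun d φ 0 σb σw 0 1) q) :
    Tendsto (fun l => covFun d φ 0 σb σw l 1) atTop (𝓝 q) :=
  h.2.congr fun l => (covFun_one_eq_iterate hd hσw l).symm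

end

/-! ### Comparison of the covariance maps with their derivatives -/

lemma cos_arccos_of_mem {c : ℝ} (hc : c ∈ Set.Icc (-1 : ℝ) 1) : Real.cos (Real.arccos c) = c :=
  Real.cos_arccos hc.1 hc.2

lemma arcDefect_nonneg {θ : ℝ} (h0 : 0 ≤ θ) (hπ : θ ≤ Real.pi) : 0 ≤ arcDefect θ := by
  rcases h0.eq_or_lt with rfl | h
  · rw [arcDefect_zero]
  · exact (arcDefect_pos h hπ).le

lemma Activation.dual_sub_le (φ : Activation) {v c : ℝ} (hv : 0 < v)
    (hc : c ∈ Set.Icc (-1 : ℝ) 1) :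
    dual φ.fn v 1 - dual φ.fn v c ≤ dual φ.dfn v 1 * (v * (1 - c)) := by
  cases φ with
  | relu =>
    have h1 := dual_relu hv (Real.arccos_nonneg c) (Real.arccos_le_pi c)
    have h2 := arcDefect_nonneg (Real.arccos_nonneg c) (Real.arccos_le_pi c)
    rw [cos_arccos_of_mem hc] at h1
    rw [h1, dual_relu_one hv, dual_relu_dfn_one hv]
    nlinarith [mul_nonneg hv.le h2]
  | tanh =>
    have h := (seriesDerivTwo_tanh hv.le).seriesDeriv.sub_le hc
    linarith

lemma Activation.tendsto_dual_dfn (φ : Activation) {v c : ℕ → ℝ} {q c₀ : ℝ} (hv : ∀ l, 0 < v l)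
    (hq : 0 < q) (hvq : Tendsto v atTop (𝓝 q)) (hc : ∀ l, c l ∈ Set.Icc (-1 : ℝ) 1)
    (hc₀ : Tendsto c atTop (𝓝 c₀)) :
    Tendsto (fun l => dual φ.dfn (v l) (c l)) atTop (𝓝 (dual φ.dfn q c₀)) := by
  cases φ with
  | relu =>
    have hc₀m : c₀ ∈ Set.Icc (-1 : ℝ) 1 :=
      isClosed_Icc.mem_of_tendsto hc₀ (Eventually.of_forall hc)
    have e : ∀ {v c : ℝ}, 0 < v → c ∈ Set.Icc (-1 : ℝ) 1 →
        dual (Activation.dfn .relu) v c = 1 / 2 * (1 - Real.arccos c / Real.pi) :=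
      fun {v c} hv hc => by
        have h := dual_relu_dfn hv (Real.arccos_nonneg c) (Real.arccos_le_pi c)
        rwa [cos_arccos_of_mem hc] at h
    rw [e hq hc₀m]
    simp only [fun l => e (hv l) (hc l)]
    exact ((((Real.continuous_arccos.tendsto _).comp hc₀).div_const _).const_sub 1).const_mul _
  | tanh =>
    have h : Tendsto ((fun p : ℝ × ℝ => dual (Activation.dfn .tanh) p.1 p.2) ∘
        fun l => (v l, c l)) atTop (𝓝 (dual (Activation.dfn .tanh) q c₀)) :=
      (continuous_dual_tanh_dfn.tendsto (q, c₀)).comp (hvq.prodMk_nhds hc₀)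
    exact h

/-! ### The ordered phase -/

/-- Pointwise convergence to a positive constant on `(-1, 1)`, with a domination that is integrable
for the weight of the Funk–Hecke formula. -/
def ConvergesDominated (d : ℕ) (g : ℕ → ℝ → ℝ) : Prop :=
  ∃ a C e : ℝ, 0 < a ∧ -1 < ((d : ℝ) - 3) / 2 - e ∧
    (∀ᶠ l in atTop, ∀ t ∈ Set.Ioo (-1 : ℝ) 1, |g l t| ≤ C * (1 - t ^ 2) ^ (-e)) ∧
    ∀ t ∈ Set.Ioo (-1 : ℝ) 1, Tendsto (fun l => g l t) atTop (𝓝 a)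

lemma convergesDominated_of_bounded {d : ℕ} (hd : 2 ≤ d) {g : ℕ → ℝ → ℝ} {a b : ℝ} (ha : 0 < a)
    (hg : ∀ l, NonnegSeries (g l)) (h1 : Tendsto (fun l => g l 1) atTop (𝓝 b))
    (ht : ∀ t ∈ Set.Ioo (-1 : ℝ) 1, Tendsto (fun l => g l t) atTop (𝓝 a)) :
    ConvergesDominated d g := by
  have hd' : (2 : ℝ) ≤ d := by exact_mod_cast hd
  refine ⟨a, b + 1, 0, ha, by linarith, ?_, ht⟩
  filter_upwards [h1.eventually_le_const (lt_add_one b)] with l hl t ht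
  rw [neg_zero, Real.rpow_zero, mul_one]
  exact ((hg l).abs_le_one ⟨ht.1.le, ht.2.le⟩).trans hl

section

variable {d : ℕ} {φ : Activation} {σb σw : ℝ}

lemma covFun_gap_succ_le (hd : 2 ≤ d) (hσw : 0 < σw) (l : ℕ) {t : ℝ}
    (ht : t ∈ Set.Icc (-1 : ℝ) 1) :
    covFun d φ 0 σb σw (l + 1) 1 - covFun d φ 0 σb σw (l + 1) t ≤
      chi φ σw (covFun d φ 0 σb σw l 1) * (covFun d φ 0 σb σw l 1 - covFun d φ 0 σb σw l t) := by
  have h := φ.dual_sub_le (covFun_one_pos (φ := φ) (σb := σb) hd le_rfl hσw l)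
    (corFun_mem (φ := φ) (σb := σb) hd le_rfl hσw l ht)
  rw [mul_one_sub_corFun hd le_rfl hσw] at h
  rw [covFun_succ_one hd le_rfl hσw, covFun_succ hd le_rfl hσw, chi_eq]
  nlinarith [mul_le_mul_of_nonneg_left h (sq_nonneg σw)]

lemma chi_nonneg (φ : Activation) (σw q : ℝ) : 0 ≤ chi φ σw q :=
  mul_nonneg (sq_nonneg _) (integral_nonneg fun _ => sq_nonneg _)

lemma covFun_le (hd : 2 ≤ d) (hσw : 0 < σw) (l : ℕ) {t : ℝ} (ht : t ∈ Set.Icc (-1 : ℝ) 1) :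
    covFun d φ 0 σb σw l t ≤ covFun d φ 0 σb σw l 1 :=
  (le_abs_self _).trans ((nonnegSeries_covFun hd le_rfl hσw l).abs_le_one ht)

lemma Ordered.convergesDominated (hd : 2 ≤ d) (hσw : 0 < σw) (h : Ordered φ σb σw) :
    ConvergesDominated d (ntkFun d φ 0 σb σw) := by
  obtain ⟨q, hq, hχ⟩ := h _ (covFun_one_pos (φ := φ) (s := 0) (σb := σb) hd le_rfl hσw 0)
  have hv := hq.tendsto_covFun hd hσw
  have hq0 := hq.1
  have hvp := covFun_one_pos (φ := φ) (s := 0) (σb := σb) hd le_rfl hσw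
  have hχl : Tendsto (fun l => chi φ σw (covFun d φ 0 σb σw l 1)) atTop (𝓝 (chi φ σw q)) := by
    simp only [chi_eq]
    exact (φ.tendsto_dual_dfn hvp hq0 hv (fun _ => one_mem_Icc) tendsto_const_nhds).const_mul _
  have key : ∀ t ∈ Set.Icc (-1 : ℝ) 1, Tendsto (fun l => ntkFun d φ 0 σb σw l t) atTop
      (𝓝 (q / (1 - chi φ σw q))) := fun t ht => by
    obtain ⟨k, hk, hk1⟩ := exists_between hχ
    have hgap : Tendsto (fun l => covFun d φ 0 σb σw l 1 - covFun d φ 0 σb σw l t) atTop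
        (𝓝 0) :=
      tendsto_zero_of_le_mul_add (ε := fun _ => 0) (fun l => sub_nonneg.2 (covFun_le hd hσw l ht))
        ((chi_nonneg φ σw q).trans hk.le) hk1 (hχl.eventually_le_const hk) tendsto_const_nhds
        (Eventually.of_forall fun l => by rw [add_zero]; exact covFun_gap_succ_le hd hσw l ht)
    have hC : Tendsto (fun l => covFun d φ 0 σb σw l t) atTop (𝓝 q) := by
      have := hv.sub hgap
      simpa using this
    have hc : Tendsto (fun l => corFun d φ 0 σb σw l t) atTop (𝓝 1) := by
      have := hC.div hv hq0.ne'
      rw [div_self hq0.ne'] at this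
      exact this
    have hr := (φ.tendsto_dual_dfn hvp hq0 hv
      (fun l => corFun_mem (φ := φ) (σb := σb) hd le_rfl hσw l ht) hc).const_mul (σw ^ 2)
    rw [← chi_eq] at hr
    exact tendsto_of_linear_recursion hr (by rwa [abs_of_nonneg (chi_nonneg φ σw q)])
      (hC.comp (tendsto_add_atTop_nat 1)) fun l => ntkFun_succ_plain hd hσw l t
  exact convergesDominated_of_bounded hd (div_pos hq0 (sub_pos.2 hχ))
    (nonnegSeries_ntkFun hd le_rfl hσw) (key 1 one_mem_Icc)
    fun t ht => key t ⟨ht.1.le, ht.2.le⟩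

end

/-! ### The rectifier -/

lemma chi_relu (σw : ℝ) {q : ℝ} (hq : 0 < q) : chi .relu σw q = σw ^ 2 / 2 := by
  rw [chi_eq, dual_relu_dfn_one hq]; ring

section

variable {d : ℕ} {σb σw : ℝ}

lemma limitVariance_relu (hd : 2 ≤ d) (hσw : 0 < σw) {q : ℝ}
    (h : IsLimitVariance .relu σb σw (covFun d .relu 0 σb σw 0 1) q) :
    q = σb ^ 2 + σw ^ 2 / 2 * q := by
  have hv := h.tendsto_covFun hd hσw
  have hvp := covFun_one_pos (φ := .relu) (s := 0) (σb := σb) hd le_rfl hσw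
  have h1 : ∀ l, covFun d .relu 0 σb σw (l + 1) 1 =
      σb ^ 2 + σw ^ 2 / 2 * covFun d .relu 0 σb σw l 1 := fun l => by
    rw [covFun_succ_one hd le_rfl hσw, dual_relu_one (hvp l)]; ring
  have h2 := hv.comp (tendsto_add_atTop_nat 1)
  simp only [Function.comp_def, h1] at h2
  exact tendsto_nhds_unique h2 ((hv.const_mul _).const_add _)

lemma not_chaotic_relu (hd : 2 ≤ d) (hσw : 0 < σw) : ¬ Chaotic .relu σb σw := fun h => by
  obtain ⟨q, hq, hχ⟩ := h _ (covFun_one_pos (d := d) (φ := .relu) (s := 0) (σb := σb) hd le_rfl hσw 0)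
  have h1 := limitVariance_relu hd hσw hq
  have hq0 := hq.1
  rw [chi_relu σw hq.1] at hχ
  nlinarith [sq_nonneg σb]

/-- Growth of the normalised neural tangent kernel, for the rectifier at criticality. -/
lemma tendsto_ntkFun_relu {s A W : ℝ} (hd : 2 ≤ d) (hs : 0 ≤ s) (hσw : 0 < σw)
    (hA : A = s + σw ^ 2 / 2) (hA1 : 1 ≤ A) (hW : 0 < W)
    (hw : Tendsto (fun l => covFun d .relu s σb σw l 1 / A ^ l) atTop (𝓝 W))
    (hb : Tendsto (fun l : ℕ => σb ^ 2 / A ^ (l + 1)) atTop (𝓝 0)) :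
    (∀ t ∈ Set.Ioo (-1 : ℝ) 1, Tendsto (fun l : ℕ => ntkFun d .relu s σb σw l t / A ^ l / l) atTop
      (𝓝 (σw ^ 2 / 2 / A * W / 4))) ∧
    Tendsto (fun l : ℕ => ntkFun d .relu s σb σw l 1 / A ^ l / l) atTop
      (𝓝 (σw ^ 2 / 2 / A * W)) := by
  have hAp : 0 < A := by linarith
  have hAl : ∀ l, (A : ℝ) ^ l ≠ 0 := fun l => (pow_pos hAp l).ne'
  have hvp := covFun_one_pos (φ := .relu) (s := s) (σb := σb) hd hs hσw
  have hv1 : ∀ l, covFun d .relu s σb σw (l + 1) 1 =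
      A * covFun d .relu s σb σw l 1 + σb ^ 2 := fun l => by
    rw [covFun_succ_one hd hs hσw, dual_relu_one (hvp l), hA]; ring
  constructor
  · intro t ht
    have hmem := fun l => corFun_mem (φ := .relu) (s := s) (σb := σb) hd hs hσw l
      (t := t) ⟨ht.1.le, ht.2.le⟩
    set θ : ℕ → ℝ := fun l => Real.arccos (corFun d .relu s σb σw l t) with hθ
    have hcos : ∀ l, Real.cos (θ l) = corFun d .relu s σb σw l t :=
      fun l => cos_arccos_of_mem (hmem l)
    have hθm : ∀ l, θ l ∈ Set.Ioc 0 Real.pi := fun l =>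
      ⟨Real.arccos_pos.2 (corFun_lt_one hd hs hσw l ht.1.le ht.2), Real.arccos_le_pi _⟩
    have hF : ∀ l, dual (Activation.fn .relu) (covFun d .relu s σb σw l 1)
        (corFun d .relu s σb σw l t) =
          covFun d .relu s σb σw l 1 / 2 * (Real.cos (θ l) + arcDefect (θ l)) := fun l => by
      rw [← dual_relu (hvp l) (hθm l).1.le (hθm l).2, hcos]
    have hD : ∀ l, dual (Activation.dfn .relu) (covFun d .relu s σb σw l 1)
        (corFun d .relu s σb σw l t) = 1 / 2 * (1 - θ l / Real.pi) := fun l => by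
      rw [← dual_relu_dfn (hvp l) (hθm l).1.le (hθm l).2, hcos]
    have hC : ∀ l, covFun d .relu s σb σw l t =
        covFun d .relu s σb σw l 1 * Real.cos (θ l) := fun l => by
      rw [hcos, corFun, mul_div_cancel₀ _ (hvp l).ne']
    refine tendsto_div_of_arcDefect (w := fun l => covFun d .relu s σb σw l 1 / A ^ l) (θ := θ)
      (κ := σw ^ 2 / 2 / A)
      (h := fun l => σb ^ 2 / A ^ (l + 1) + σw ^ 2 / 2 / A *
        (covFun d .relu s σb σw l 1 / A ^ l) * (Real.cos (θ l) + arcDefect (θ l)))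
      (fun l => div_pos (hvp l) (pow_pos hAp l)) hW hw (by positivity) hθm (fun l => ?_)
      (fun hθ0 => ?_) (fun l => ?_)
    · have h1 := covFun_succ (φ := .relu) (σb := σb) hd hs hσw l t
      rw [hC (l + 1), hC l, hF, hv1] at h1
      have e1 : covFun d .relu s σb σw (l + 1) 1 * (1 - Real.cos (θ (l + 1))) =
          A * (covFun d .relu s σb σw l 1 * (1 - Real.cos (θ l))) -
            σw ^ 2 / 2 * covFun d .relu s σb σw l 1 * arcDefect (θ l) := by
        rw [hv1]
        rw [mul_sub, h1, hA]; ring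
      rw [div_mul_eq_mul_div, e1, pow_succ]
      have := hAl l
      field_simp
      ring
    · have h1 : Tendsto (fun l => Real.cos (θ l) + arcDefect (θ l)) atTop (𝓝 1) := by
        have := ((Real.continuous_cos.tendsto _).comp hθ0).add
          ((continuous_arcDefect.tendsto _).comp hθ0)
        simpa [arcDefect_zero] using this
      have := hb.add ((hw.const_mul (σw ^ 2 / 2 / A)).mul h1)
      simpa using this
    · rw [ntkFun_succ hd hs hσw, hF, hD, pow_succ]
      have := hAl l
      have e : s = A - σw ^ 2 / 2 := by rw [hA]; ring
      rw [e]
      field_simp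
      ring
  · have h1 := tendsto_div_of_recursion (x := fun l => ntkFun d .relu s σb σw l 1 / A ^ l)
      (e := fun _ => 0) (a := 0)
      (h := fun l => σb ^ 2 / A ^ (l + 1) + σw ^ 2 / 2 / A *
        (covFun d .relu s σb σw l 1 / A ^ l)) le_rfl (by simp)
      (by simpa using hb.add (hw.const_mul (σw ^ 2 / 2 / A))) fun l => by
        rw [ntkFun_succ hd hs hσw, corFun_one hd hs hσw, dual_relu_one (hvp l),
          dual_relu_dfn_one (hvp l), pow_succ]
        have := hAl l
        have e : s = A - σw ^ 2 / 2 := by rw [hA]; ring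
        rw [e]
        field_simp
        ring
    simpa using h1

lemma tendsto_div_succ {x : ℕ → ℝ} {a : ℝ} (h : Tendsto (fun l : ℕ => x l / l) atTop (𝓝 a)) :
    Tendsto (fun l : ℕ => x l / ((l : ℝ) + 1)) atTop (𝓝 a) := by
  have h1 := h.mul (tendsto_natCast_div_add_atTop (1 : ℝ))
  rw [mul_one] at h1
  refine h1.congr' ?_
  filter_upwards [eventually_gt_atTop 0] with l hl
  have : (l : ℝ) ≠ 0 := by exact_mod_cast hl.ne'
  field_simp

lemma EdgeOfChaos.convergesDominated_relu (hd : 2 ≤ d) (hσw : 0 < σw)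
    (h : EdgeOfChaos .relu σb σw) :
    ConvergesDominated d (fun l t => ntkFun d .relu 0 σb σw l t / ((l : ℝ) + 1)) := by
  obtain ⟨q, hq, hχ⟩ := h _ (covFun_one_pos (d := d) (φ := .relu) (s := 0) (σb := σb) hd le_rfl hσw 0)
  have h1 := limitVariance_relu hd hσw hq
  have hv := hq.tendsto_covFun hd hσw
  rw [chi_relu σw hq.1] at hχ
  have hσb : σb ^ 2 = 0 := by rw [hχ] at h1; linarith
  obtain ⟨h2, h3⟩ := tendsto_ntkFun_relu (σb := σb) (s := 0) (A := 1) (W := q) hd le_rfl hσw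
    (by linarith) le_rfl hq.1 (by simpa using hv) (by simp [hσb])
  simp only [one_pow, div_one, hχ, one_mul] at h2 h3
  have hq0 := hq.1
  exact convergesDominated_of_bounded hd (by linarith : 0 < q / 4)
    (fun l => (nonnegSeries_ntkFun hd le_rfl hσw l).div_const (by positivity))
    (tendsto_div_succ h3) fun t ht => tendsto_div_succ (h2 t ht)

lemma convergesDominated_resnet (hd : 2 ≤ d) (hσw : 0 < σw) :
    ConvergesDominated d (fun l t => ntkFun d .relu 1 σb σw l t /
      (((l : ℝ) + 1) * (1 + σw ^ 2 / 2) ^ l)) := by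
  set A := 1 + σw ^ 2 / 2 with hA
  have hB : 0 < σw ^ 2 / 2 := by positivity
  have hA1 : 1 < A := by linarith
  have hAp : 0 < A := by linarith
  have hvp := covFun_one_pos (d := d) (φ := .relu) (s := 1) (σb := σb) hd zero_le_one hσw
  have hv : ∀ l, covFun d .relu 1 σb σw l 1 / A ^ l =
      covFun d .relu 1 σb σw 0 1 + σb ^ 2 / (A - 1) - σb ^ 2 / (A - 1) / A ^ l := fun l => by
    induction l with
    | zero => simp
    | succ l ih =>
      have h1 : covFun d .relu 1 σb σw (l + 1) 1 =
          A * covFun d .relu 1 σb σw l 1 + σb ^ 2 := by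
        rw [covFun_succ_one hd zero_le_one hσw, dual_relu_one (hvp l), hA]; ring
      have hAl := (pow_pos hAp l).ne'
      have hA' : A - 1 ≠ 0 := by linarith
      rw [div_eq_iff hAl] at ih
      rw [h1, ih, pow_succ]
      field_simp
      ring
  have hinv : ∀ b : ℝ, Tendsto (fun l : ℕ => b / A ^ l) atTop (𝓝 0) := fun b =>
    (tendsto_pow_atTop_atTop_of_one_lt hA1).const_div_atTop b
  set W := covFun d .relu 1 σb σw 0 1 + σb ^ 2 / (A - 1) with hW
  have hWp : 0 < W := add_pos_of_pos_of_nonneg (hvp 0) (div_nonneg (sq_nonneg _) (by linarith))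
  have hw : Tendsto (fun l => covFun d .relu 1 σb σw l 1 / A ^ l) atTop (𝓝 W) := by
    simp only [hv]
    simpa using (hinv (σb ^ 2 / (A - 1))).const_sub W
  obtain ⟨h2, h3⟩ := tendsto_ntkFun_relu hd zero_le_one hσw hA hA1.le hWp hw
    ((hinv (σb ^ 2)).comp (tendsto_add_atTop_nat 1))
  have e : ∀ (l : ℕ) (t : ℝ), ntkFun d .relu 1 σb σw l t / (((l : ℝ) + 1) * A ^ l) =
      ntkFun d .relu 1 σb σw l t / A ^ l / ((l : ℝ) + 1) := fun l t => by
    rw [div_div, mul_comm]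
  simp only [e]
  exact convergesDominated_of_bounded hd (by positivity : 0 < σw ^ 2 / 2 / A * W / 4)
    (fun l => ((nonnegSeries_ntkFun hd zero_le_one hσw l).div_const (pow_pos hAp l).le).div_const
      (by positivity)) (tendsto_div_succ h3) fun t ht => tendsto_div_succ (h2 t ht)

end

/-! ### The hyperbolic tangent on the edge of chaos -/

lemma tendsto_of_continuous_prod {f : ℝ → ℝ → ℝ} (hf : Continuous fun p : ℝ × ℝ => f p.1 p.2)
    {v c : ℕ → ℝ} {q c₀ : ℝ} (hv : Tendsto v atTop (𝓝 q)) (hc : Tendsto c atTop (𝓝 c₀)) :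
    Tendsto (fun l => f (v l) (c l)) atTop (𝓝 (f q c₀)) := by
  have h : Tendsto ((fun p : ℝ × ℝ => f p.1 p.2) ∘ fun l => (v l, c l)) atTop (𝓝 (f q c₀)) :=
    (hf.tendsto (q, c₀)).comp (hv.prodMk_nhds hc)
  exact h

lemma dual_tanh_dfn_one_pos (v : ℝ) : 0 < dual (Activation.dfn .tanh) v 1 := by
  rw [dual_one, integral_pos_iff_support_of_nonneg (fun x => sq_nonneg _)
    (Activation.memLp_dfn .tanh √v).integrable_sq]
  have : (Function.support fun x => Activation.dfn .tanh (√v * x) ^ 2) = Set.univ := by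
    rw [Set.eq_univ_iff_forall]
    intro x
    have h : Activation.dfn .tanh (√v * x) ≠ 0 := (sub_pos.2 (Real.tanh_sq_lt_one _)).ne'
    exact pow_ne_zero 2 h
  rw [this]
  simp

lemma dual_tanh_ne_tangent {v c : ℝ} (hv : 0 < v) (hc : -1 ≤ c) (hc1 : c < 1) :
    dual (Activation.fn .tanh) v 1 - dual (Activation.fn .tanh) v c ≠
      v * dual (Activation.dfn .tanh) v 1 * (1 - c) := fun h => by
  have h1 := (seriesDerivTwo_tanh hv.le).deriv_two_eq_zero hc hc1 h
  exact (mul_pos (pow_pos hv 2) (dual_tanhSecond_one_pos hv)).ne' h1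

section

variable {d : ℕ} {σb σw : ℝ}

lemma limitVariance_tanh (hd : 2 ≤ d) (hσw : 0 < σw) {q : ℝ}
    (h : IsLimitVariance .tanh σb σw (covFun d .tanh 0 σb σw 0 1) q) :
    varianceMap .tanh σb σw q = q := by
  have hv := h.tendsto_covFun hd hσw
  have h2 := hv.comp (tendsto_add_atTop_nat 1)
  simp only [Function.comp_def, covFun_succ_one hd le_rfl hσw, zero_mul, zero_add] at h2
  have h3 := ((tendsto_of_continuous_prod (f := dual (Activation.fn .tanh)) continuous_dual_tanh hv
    (tendsto_const_nhds (x := (1 : ℝ)))).const_mul (σw ^ 2)).const_add (σb ^ 2)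
  rw [varianceMap_eq]
  exact tendsto_nhds_unique h3 h2

lemma sq_pos_of_chi_tanh_eq_one {q : ℝ} (hq : 0 < q) (hfix : varianceMap .tanh σb σw q = q)
    (hχ : chi .tanh σw q = 1) : 0 < σb ^ 2 := by
  rcases (sq_nonneg σb).eq_or_lt with h0 | h0
  · exfalso
    rw [varianceMap_eq, ← h0, zero_add] at hfix
    rw [chi_eq] at hχ
    refine dual_tanh_ne_tangent hq (c := 0) (by norm_num) zero_lt_one ?_
    have hw : σw ^ 2 ≠ 0 := fun h => by rw [h, zero_mul] at hχ; exact zero_ne_one hχ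
    rw [dual_tanh_zero]
    refine mul_left_cancel₀ hw ?_
    linear_combination hfix - q * hχ
  · exact h0

lemma summable_chi_tanh_sub_one (hd : 2 ≤ d) (hσw : 0 < σw) {q : ℝ} (hq : 0 < q)
    (hfix : varianceMap .tanh σb σw q = q) (hχ : chi .tanh σw q = 1) :
    Summable fun l => chi .tanh σw (covFun d .tanh 0 σb σw l 1) - 1 := by
  have hσb := sq_pos_of_chi_tanh_eq_one hq hfix hχ
  have hvp := covFun_one_pos (d := d) (φ := .tanh) (s := 0) (σb := σb) hd le_rfl hσw
  have hk0 : 0 ≤ 1 - σb ^ 2 / q := by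
    rw [sub_nonneg, div_le_one hq]
    rw [varianceMap_eq] at hfix
    nlinarith [mul_pos (pow_pos hσw 2) (Activation.dual_one_pos .tanh hq)]
  have hk1 : 1 - σb ^ 2 / q < 1 := by linarith [div_pos hσb hq]
  have hgeo : ∀ l, |covFun d .tanh 0 σb σw l 1 - q| ≤
      (1 - σb ^ 2 / q) ^ l * |covFun d .tanh 0 σb σw 0 1 - q| := fun l => by
    induction l with
    | zero => simp
    | succ l ih =>
      have e : covFun d .tanh 0 σb σw (l + 1) 1 =
          varianceMap .tanh σb σw (covFun d .tanh 0 σb σw l 1) := by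
        rw [covFun_succ_one hd le_rfl hσw, varianceMap_eq]; ring
      rw [e, pow_succ, mul_comm ((1 - σb ^ 2 / q) ^ l), mul_assoc]
      exact (abs_varianceMap_sub_le hq hfix (hvp l).le).trans (mul_le_mul_of_nonneg_left ih hk0)
  obtain ⟨C, hC⟩ := exists_abs_chi_sub_le σw hq
  refine Summable.of_norm_bounded (g := fun l => |C| *
    ((1 - σb ^ 2 / q) ^ l * |covFun d .tanh 0 σb σw 0 1 - q|))
    (((summable_geometric_of_lt_one hk0 hk1).mul_right _).mul_left _) fun l => ?_
  have h := hC _ (hvp l).le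
  rw [hχ] at h
  rw [Real.norm_eq_abs]
  refine h.trans ?_
  exact mul_le_mul (le_abs_self C) (hgeo l) (abs_nonneg _) (abs_nonneg _)

lemma tendsto_gap_zero_tanh (hd : 2 ≤ d) (hσw : 0 < σw) {q : ℝ} (hq : 0 < q)
    (hv : Tendsto (fun l => covFun d .tanh 0 σb σw l 1) atTop (𝓝 q))
    (hfix : varianceMap .tanh σb σw q = q) (hχ : chi .tanh σw q = 1)
    {t : ℝ} (ht : t ∈ Set.Ioo (-1 : ℝ) 1) :
    Tendsto (fun l => covFun d .tanh 0 σb σw l 1 - covFun d .tanh 0 σb σw l t) atTop (𝓝 0) := by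
  have ht' : t ∈ Set.Icc (-1 : ℝ) 1 := ⟨ht.1.le, ht.2.le⟩
  obtain ⟨P, R, hP, hR, hPr, hPR⟩ := exists_partial_products
    (r := fun l => chi .tanh σw (covFun d .tanh 0 σb σw l 1))
    (fun l => by rw [chi_eq]; exact mul_pos (pow_pos hσw 2) (dual_tanh_dfn_one_pos _))
    (summable_chi_tanh_sub_one hd hσw hq hfix hχ)
  set s : ℕ → ℝ := fun l => covFun d .tanh 0 σb σw l 1 - covFun d .tanh 0 σb σw l t with hs
  have hspos : ∀ l, 0 < s l := fun l => sub_pos.2 (covFun_lt hd le_rfl hσw l ht.1.le ht.2)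
  have hanti : Antitone fun l => s l / P l := antitone_nat_of_succ_le fun l => by
    rw [hPr, div_le_div_iff₀ (by rw [← hPr]; exact hP _) (hP l)]
    have := mul_le_mul_of_nonneg_right (covFun_gap_succ_le (φ := .tanh) (σb := σb) hd hσw l ht')
      (hP l).le
    refine this.trans (le_of_eq ?_)
    simp only [hs]
    ring
  obtain ⟨a, ha⟩ : ∃ a, Tendsto (fun l => s l / P l) atTop (𝓝 a) :=
    ⟨_, tendsto_atTop_ciInf hanti ⟨0, by rintro _ ⟨l, rfl⟩; exact (div_pos (hspos l) (hP l)).le⟩⟩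
  obtain ⟨s₁, hs₁⟩ : ∃ s₁, Tendsto s atTop (𝓝 s₁) :=
    ⟨a * R, (ha.mul hPR).congr fun l => div_mul_cancel₀ _ (hP l).ne'⟩
  have hs₁0 : 0 ≤ s₁ := ge_of_tendsto' hs₁ fun l => (hspos l).le
  have hvp := covFun_one_pos (d := d) (φ := .tanh) (s := 0) (σb := σb) hd le_rfl hσw
  have hcs : ∀ l, corFun d .tanh 0 σb σw l t = 1 - s l / covFun d .tanh 0 σb σw l 1 := fun l => by
    have := (hvp l).ne'
    simp only [hs, corFun]
    field_simp
    ring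
  have hc : Tendsto (fun l => corFun d .tanh 0 σb σw l t) atTop (𝓝 (1 - s₁ / q)) := by
    simp only [hcs]
    exact (hs₁.div hv hq.ne').const_sub 1
  have hcm : 1 - s₁ / q ∈ Set.Icc (-1 : ℝ) 1 := isClosed_Icc.mem_of_tendsto hc
    (Eventually.of_forall fun l => corFun_mem hd le_rfl hσw l ht')
  have h1 : Tendsto (fun l => s (l + 1)) atTop (𝓝 (σw ^ 2 *
      (dual (Activation.fn .tanh) q 1 - dual (Activation.fn .tanh) q (1 - s₁ / q)))) := by
    have e : ∀ l, s (l + 1) = σw ^ 2 *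
        (dual (Activation.fn .tanh) (covFun d .tanh 0 σb σw l 1) 1 -
          dual (Activation.fn .tanh) (covFun d .tanh 0 σb σw l 1)
            (corFun d .tanh 0 σb σw l t)) := fun l => by
      simp only [hs]
      rw [covFun_succ_one hd le_rfl hσw, covFun_succ hd le_rfl hσw]
      ring
    simp only [e]
    exact ((tendsto_of_continuous_prod continuous_dual_tanh hv tendsto_const_nhds).sub
      (tendsto_of_continuous_prod continuous_dual_tanh hv hc)).const_mul _
  have h2 := tendsto_nhds_unique h1 (hs₁.comp (tendsto_add_atTop_nat 1))
  rcases hs₁0.eq_or_lt with h0 | h0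
  · rwa [← h0] at hs₁
  · exfalso
    have hlt : 1 - s₁ / q < 1 := by linarith [div_pos h0 hq]
    refine dual_tanh_ne_tangent hq hcm.1 hlt ?_
    rw [chi_eq] at hχ
    refine mul_left_cancel₀ (pow_pos hσw 2).ne' (h2.trans ?_)
    have := hq.ne'
    field_simp
    linear_combination -(s₁ * hχ)

lemma tendsto_ntkFun_tanh (hd : 2 ≤ d) (hσw : 0 < σw) {q : ℝ} (hq : 0 < q)
    (hv : Tendsto (fun l => covFun d .tanh 0 σb σw l 1) atTop (𝓝 q))
    (hfix : varianceMap .tanh σb σw q = q) (hχ : chi .tanh σw q = 1)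
    {t : ℝ} (ht : t ∈ Set.Ioo (-1 : ℝ) 1) :
    Tendsto (fun l : ℕ => ntkFun d .tanh 0 σb σw l t / l) atTop (𝓝 (q / 3)) := by
  have ht' : t ∈ Set.Icc (-1 : ℝ) 1 := ⟨ht.1.le, ht.2.le⟩
  have hgap := tendsto_gap_zero_tanh hd hσw hq hv hfix hχ ht
  set v : ℕ → ℝ := fun l => covFun d .tanh 0 σb σw l 1 with hvdef
  set s : ℕ → ℝ := fun l => v l - covFun d .tanh 0 σb σw l t with hs
  set c : ℕ → ℝ := fun l => corFun d .tanh 0 σb σw l t with hcdef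
  have hvp : ∀ l, 0 < v l := covFun_one_pos (φ := .tanh) (σb := σb) hd le_rfl hσw
  have hspos : ∀ l, 0 < s l := fun l => sub_pos.2 (covFun_lt hd le_rfl hσw l ht.1.le ht.2)
  have hvc : ∀ l, v l * (1 - c l) = s l := fun l => mul_one_sub_corFun hd le_rfl hσw l t
  have hC : Tendsto (fun l => covFun d .tanh 0 σb σw l t) atTop (𝓝 q) := by
    have := hv.sub hgap
    simpa [hs] using this
  have hc : Tendsto c atTop (𝓝 1) := by
    have := hC.div hv hq.ne'
    rw [div_self hq.ne'] at this
    exact this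
  have hc01 : ∀ᶠ l in atTop, c l ∈ Set.Icc (0 : ℝ) 1 := by
    filter_upwards [hc.eventually_const_le zero_lt_one] with l hl
    exact ⟨hl, (corFun_mem hd le_rfl hσw l ht').2⟩
  set F := dual (Activation.fn .tanh) with hF
  set D := dual (Activation.dfn .tanh) with hD
  set H := dual tanhSecond with hH
  have hD1 : ∀ v, 0 < D v 1 := dual_tanh_dfn_one_pos
  have hDl : Tendsto (fun l => D (v l) 1) atTop (𝓝 (D q 1)) :=
    tendsto_of_continuous_prod continuous_dual_tanh_dfn hv tendsto_const_nhds
  have hHl : Tendsto (fun l => H (v l) 1 / D (v l) 1) atTop (𝓝 (H q 1 / D q 1)) :=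
    (tendsto_of_continuous_prod continuous_dual_tanhSecond hv tendsto_const_nhds).div hDl
      (hD1 q).ne'
  have hHc : Tendsto (fun l => H (v l) (c l) / D (v l) 1) atTop (𝓝 (H q 1 / D q 1)) :=
    (tendsto_of_continuous_prod continuous_dual_tanhSecond hv hc).div hDl (hD1 q).ne'
  have hb : 0 < H q 1 / D q 1 := div_pos (dual_tanhSecond_one_pos hq) (hD1 q)
  have hss : ∀ l, s (l + 1) = σw ^ 2 * (F (v l) 1 - F (v l) (c l)) := fun l => by
    simp only [hs, hvdef]
    rw [covFun_succ_one hd le_rfl hσw, covFun_succ hd le_rfl hσw]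
    ring
  have key := tendsto_div_of_quadratic_gap (r := fun l => chi .tanh σw (v l)) (s := s)
    (x := fun l => 1 - (F (v l) 1 - F (v l) (c l)) / (D (v l) 1 * s l))
    (e := fun l => 1 - D (v l) (c l) / D (v l) 1)
    (K := fun l => ntkFun d .tanh 0 σb σw l t)
    (h := fun l => covFun d .tanh 0 σb σw (l + 1) t)
    (b := 1 / 2 * (H q 1 / D q 1)) (c := H q 1 / D q 1) (h₀ := q)
    (fun l => by rw [chi_eq]; exact mul_pos (pow_pos hσw 2) (hD1 _))
    (summable_chi_tanh_sub_one hd hσw hq hfix hχ) hspos hgap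
    (fun l => by
      have h1 := (hD1 (v l)).ne'
      have h2 := (hspos l).ne'
      rw [hss, chi_eq]
      simp only [← hD]
      field_simp
      ring)
    (by
      refine tendsto_of_tendsto_of_tendsto_of_le_of_le' (hHc.const_mul (1 / 2))
        (hHl.const_mul (1 / 2)) ?_ ?_
      · filter_upwards [hc01] with l hl
        have h1 := (seriesDerivTwo_tanh (hvp l).le).le_remainder hl
        have h2 := hspos l
        have h3 := hD1 (v l)
        have e : (1 - (F (v l) 1 - F (v l) (c l)) / (D (v l) 1 * s l)) / s l =
          (D (v l) 1 * s l - (F (v l) 1 - F (v l) (c l))) / (D (v l) 1 * s l ^ 2) := by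
          field_simp
        rw [e, le_div_iff₀ (by positivity)]
        have e2 : 1 / 2 * (H (v l) (c l) / D (v l) 1) * (D (v l) 1 * s l ^ 2) =
          1 / 2 * (v l ^ 2 * H (v l) (c l)) * (1 - c l) ^ 2 := by
          rw [← hvc l]; field_simp
        rw [e2, ← hvc l]
        refine h1.trans (le_of_eq ?_)
        simp only [hF, hD]
        ring
      · filter_upwards [hc01] with l hl
        have h1 := (seriesDerivTwo_tanh (hvp l).le).remainder_le hl
        have h2 := hspos l
        have h3 := hD1 (v l)
        have e : (1 - (F (v l) 1 - F (v l) (c l)) / (D (v l) 1 * s l)) / s l =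
          (D (v l) 1 * s l - (F (v l) 1 - F (v l) (c l))) / (D (v l) 1 * s l ^ 2) := by
          field_simp
        rw [e, div_le_iff₀ (by positivity)]
        have e2 : 1 / 2 * (H (v l) 1 / D (v l) 1) * (D (v l) 1 * s l ^ 2) =
          1 / 2 * (v l ^ 2 * H (v l) 1) * (1 - c l) ^ 2 := by
          rw [← hvc l]; field_simp
        rw [e2, ← hvc l]
        refine le_trans (le_of_eq ?_) h1
        simp only [hF, hD]
        ring)
    (by positivity) hb.le
    (by
      refine tendsto_of_tendsto_of_tendsto_of_le_of_le' hHc hHl ?_ ?_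
      · filter_upwards [hc01] with l hl
        have h1 := (seriesDerivTwo_tanh (hvp l).le).deriv.mul_sub_le hl.1 hl.2 le_rfl
        have h2 := hspos l
        have h3 := hD1 (v l)
        have e : (1 - D (v l) (c l) / D (v l) 1) / s l =
          (D (v l) 1 - D (v l) (c l)) / (D (v l) 1 * s l) := by field_simp
        rw [e, div_le_div_iff₀ h3 (by positivity)]
        have h4 : H (v l) (c l) * s l ≤ D (v l) 1 - D (v l) (c l) := by
          refine le_of_mul_le_mul_left ?_ (hvp l)
          rw [← hvc l]
          refine le_trans (le_of_eq ?_) (h1.trans (le_of_eq ?_))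
          · simp only [hH]; ring
          · simp only [hD]; ring
        nlinarith
      · filter_upwards [hc01] with l hl
        have h1 := (seriesDerivTwo_tanh (hvp l).le).deriv.sub_le (c := c l)
          ⟨by linarith [hl.1], hl.2⟩
        have h2 := hspos l
        have h3 := hD1 (v l)
        have e : (1 - D (v l) (c l) / D (v l) 1) / s l =
          (D (v l) 1 - D (v l) (c l)) / (D (v l) 1 * s l) := by field_simp
        rw [e, div_le_div_iff₀ (by positivity) h3]
        have h4 : D (v l) 1 - D (v l) (c l) ≤ H (v l) 1 * s l := by
          refine le_of_mul_le_mul_left ?_ (hvp l)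
          rw [← hvc l]
          refine le_trans (le_of_eq ?_) (h1.trans (le_of_eq ?_))
          · simp only [hD]; ring
          · simp only [hH]; ring
        nlinarith)
    (hC.comp (tendsto_add_atTop_nat 1))
    (fun l => by
      have h1 := (hD1 (v l)).ne'
      rw [ntkFun_succ_plain hd hσw, chi_eq]
      simp only [← hD]
      field_simp
      ring)
  have e : q / (1 + H q 1 / D q 1 / (1 / 2 * (H q 1 / D q 1))) = q / 3 := by
    generalize H q 1 / D q 1 = z at *
    field_simp
    norm_num
  rwa [e] at key

lemma tendsto_ntkFun_tanh_one (hd : 2 ≤ d) (hσw : 0 < σw) {q : ℝ} (hq : 0 < q)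
    (hv : Tendsto (fun l => covFun d .tanh 0 σb σw l 1) atTop (𝓝 q))
    (hfix : varianceMap .tanh σb σw q = q) (hχ : chi .tanh σw q = 1) :
    Tendsto (fun l : ℕ => ntkFun d .tanh 0 σb σw l 1 / l) atTop (𝓝 q) := by
  obtain ⟨P, R, hP, hR, hPr, hPR⟩ := exists_partial_products
    (r := fun l => chi .tanh σw (covFun d .tanh 0 σb σw l 1))
    (fun l => by rw [chi_eq]; exact mul_pos (pow_pos hσw 2) (dual_tanh_dfn_one_pos _))
    (summable_chi_tanh_sub_one hd hσw hq hfix hχ)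
  have h1 := tendsto_div_of_recursion (x := fun l => ntkFun d .tanh 0 σb σw l 1 / P l)
    (e := fun _ => 0) (a := 0) (h := fun l => covFun d .tanh 0 σb σw (l + 1) 1 / P (l + 1))
    (h₀ := q / R) le_rfl (by simp)
    ((hv.comp (tendsto_add_atTop_nat 1)).div (hPR.comp (tendsto_add_atTop_nat 1)) hR.ne')
    fun l => by
      have h2 := (hP l).ne'
      have h3 := (hP (l + 1)).ne'
      have h4 : ntkFun d .tanh 0 σb σw (l + 1) 1 = chi .tanh σw (covFun d .tanh 0 σb σw l 1) *
          ntkFun d .tanh 0 σb σw l 1 + covFun d .tanh 0 σb σw (l + 1) 1 := by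
        rw [ntkFun_succ_plain hd hσw, corFun_one hd le_rfl hσw, chi_eq]
      rw [h4, sub_zero, one_mul, add_div]
      congr 1
      rw [div_eq_div_iff h3 h2, hPr]
      ring
  have h5 := h1.mul hPR
  rw [add_zero, div_one, div_mul_cancel₀ _ hR.ne'] at h5
  refine h5.congr fun l => ?_
  have := (hP l).ne'
  field_simp

lemma EdgeOfChaos.convergesDominated_tanh (hd : 2 ≤ d) (hσw : 0 < σw)
    (h : EdgeOfChaos .tanh σb σw) :
    ConvergesDominated d (fun l t => ntkFun d .tanh 0 σb σw l t / ((l : ℝ) + 1)) := by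
  obtain ⟨q, hq, hχ⟩ := h _ (covFun_one_pos (d := d) (φ := .tanh) (s := 0) (σb := σb) hd le_rfl hσw 0)
  have hfix := limitVariance_tanh hd hσw hq
  have hv := hq.tendsto_covFun hd hσw
  exact convergesDominated_of_bounded hd (div_pos hq.1 three_pos)
    (fun l => (nonnegSeries_ntkFun hd le_rfl hσw l).div_const (by positivity))
    (tendsto_div_succ (tendsto_ntkFun_tanh_one hd hσw hq.1 hv hfix hχ))
    fun t ht => tendsto_div_succ (tendsto_ntkFun_tanh hd hσw hq.1 hv hfix hχ ht)

end

/-! ### The chaotic phase -/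

lemma SeriesDeriv.affine {F F' : ℝ → ℝ} (h : SeriesDeriv F F') {a b : ℝ} (ha : 0 ≤ a)
    (hb : 0 ≤ b) : SeriesDeriv (fun c => a + b * F c) (fun c => b * F' c) := by
  obtain ⟨A, hA, hF, hF'⟩ := h
  refine ⟨fun n => (if n = 0 then a else 0) + b * A n, fun n => ?_, fun c hc => ?_, fun c hc => ?_⟩
  · have := mul_nonneg hb (hA n)
    dsimp only
    split_ifs <;> linarith
  · refine ((hasSum_ite_eq 0 a).add ((hF c hc).mul_left b)).congr_fun fun n => ?_
    rcases eq_or_ne n 0 with rfl | h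
    · simp
    · simp [h]; ring
  · refine ((hF' c hc).mul_left b).congr_fun fun n => ?_
    simp
    ring

/-- A fixed point in `(0, 1)` and an interval on which the map is a contraction. -/
lemma SeriesDeriv.exists_contraction {f f' : ℝ → ℝ} (h : SeriesDeriv f f') (h1 : f 1 = 1)
    (h0 : 0 < f 0) (hf1 : 1 < f' 1) :
    ∃ c₁ c₀, 0 < c₁ ∧ c₁ < c₀ ∧ c₀ < 1 ∧ f c₁ = c₁ ∧ f c₀ < c₀ ∧ f' c₀ < 1 := by
  have hcf := h.nonnegSeries.continuousOn
  have hcf' := h.nonneg_deriv.continuousOn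
  obtain ⟨c₂, h20, h21, h22⟩ : ∃ c₂, 0 < c₂ ∧ c₂ < 1 ∧ f c₂ < c₂ := by
    have hcont := (hcf' 1 one_mem_Icc).mono_left
      (nhdsWithin_mono 1 (fun x (hx : x ∈ Set.Ioo (0 : ℝ) 1) => ⟨by linarith [hx.1], hx.2.le⟩))
    have hne : (𝓝[Set.Ioo (0 : ℝ) 1] 1).NeBot :=
      mem_closure_iff_nhdsWithin_neBot.1 (by rw [closure_Ioo zero_ne_one]; simp)
    obtain ⟨c, hc, hcm⟩ := ((hcont.eventually_const_lt hf1).and self_mem_nhdsWithin).exists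
    refine ⟨c, hcm.1, hcm.2, ?_⟩
    have h2 := h.mul_sub_le hcm.1.le hcm.2.le le_rfl
    have h3 : 0 < 1 - c := by linarith [hcm.2]
    rw [h1] at h2
    nlinarith
  obtain ⟨c₁, ⟨h10, h11⟩, hfix⟩ : ∃ c₁ ∈ Set.Ioo 0 c₂, f c₁ - c₁ = 0 := by
    have hc : ContinuousOn (fun c => f c - c) (Set.Icc 0 c₂) :=
      (hcf.mono (Set.Icc_subset_Icc (by norm_num) h21.le)).sub continuousOn_id
    have := intermediate_value_Ioo' h20.le hc
    exact this ⟨by linarith, by linarith⟩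
  have hfix' : f c₁ = c₁ := by linarith
  have hd1 : f' c₁ < 1 := by
    have h2 := h.mul_sub_le h10.le h11.le h21.le
    rw [hfix'] at h2
    have h3 : 0 < c₂ - c₁ := by linarith
    by_contra hle
    have h4 := mul_le_mul_of_nonneg_right (not_lt.1 hle) h3.le
    linarith
  obtain ⟨c₀, hc₀, h01, h02⟩ : ∃ c₀, f' c₀ < 1 ∧ c₁ < c₀ ∧ c₀ < c₂ := by
    have hat : ContinuousAt f' c₁ :=
      hcf'.continuousAt (Icc_mem_nhds (by linarith) (by linarith))
    have hev := (hat.tendsto.mono_left (nhdsWithin_le_nhds (s := Set.Ioi c₁))).eventually_lt_const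
      hd1
    obtain ⟨c, hc, hcm⟩ := (hev.and (Ioo_mem_nhdsGT h11)).exists
    exact ⟨c, hc, hcm.1, hcm.2⟩
  refine ⟨c₁, c₀, h10, h01, h02.trans h21, hfix', ?_, hc₀⟩
  have h2 := h.abs_sub_le (a := c₁) (b := c₀) (r := c₀) (h02.trans h21).le
    (by rw [abs_of_pos h10]; exact h01.le) (by rw [abs_of_pos (h10.trans h01)])
  have h3 : 0 < c₀ - c₁ := by linarith
  rw [hfix', abs_of_pos h3] at h2
  have h4 := (le_abs_self _).trans h2
  nlinarith

section

variable {f f' : ℕ → ℝ → ℝ} {F F' : ℝ → ℝ} {c k : ℕ → ℝ → ℝ}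

/-- The dynamics of a kernel `k` driven by correlations `c`, which are iterates of maps `f` that
converge to a map `F` with slope larger than `1` at its fixed point `1`. -/
structure ChaoticDynamics (f f' : ℕ → ℝ → ℝ) (F F' : ℝ → ℝ) (c k : ℕ → ℝ → ℝ) : Prop where
  series : ∀ l, SeriesDeriv (f l) (f' l)
  limit_series : SeriesDeriv F F'
  map_one : ∀ l, f l 1 = 1
  limit_one : F 1 = 1
  limit_zero : 0 < F 0
  slope : 1 < F' 1
  tendsto_map : ∀ x, Tendsto (fun l => f l x) atTop (𝓝 (F x))
  tendsto_deriv : ∀ (x : ℕ → ℝ) (y : ℝ), Tendsto x atTop (𝓝 y) →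
    Tendsto (fun l => f' l (x l)) atTop (𝓝 (F' y))
  cor_series : ∀ l, NonnegSeries (c l)
  cor_succ : ∀ l t, c (l + 1) t = f l (c l t)
  cor_gap : ∀ l, ∃ κ, 0 < κ ∧ ∀ t ∈ Set.Icc (-1 : ℝ) 1, κ * (1 - t) ≤ 1 - c l t
  ker_series : ∀ l, NonnegSeries (k l)
  ker_succ : ∀ l t, k (l + 1) t = f' l (c l t) * k l t + c (l + 1) t

namespace ChaoticDynamics

lemma cor_nonneg (h : ChaoticDynamics f f' F F' c k) (l : ℕ) {t : ℝ} (ht : t ∈ Set.Ico (0 : ℝ) 1) :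
    0 ≤ c l t := (h.cor_series l).nonneg ⟨ht.1, ht.2.le⟩

lemma cor_lt_one (h : ChaoticDynamics f f' F F' c k) (l : ℕ) {t : ℝ} (ht : t ∈ Set.Ico (0 : ℝ) 1) :
    c l t < 1 := by
  obtain ⟨κ, hκ, hg⟩ := h.cor_gap l
  have := hg t ⟨by linarith [ht.1], ht.2.le⟩
  have := mul_pos hκ (sub_pos.2 ht.2)
  linarith

lemma escape (h : ChaoticDynamics f f' F F' c k) {a b x : ℝ} {l : ℕ} (ha : 0 ≤ a) (ha1 : a < 1)
    (hab : f l a ≤ b) (hx : a ≤ x) (hx1 : x ≤ 1) :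
    (1 - b) / (1 - a) * (1 - x) ≤ 1 - f l x := by
  have h1 := (h.series l).chord ha hx hx1
  rw [h.map_one] at h1
  have h2 : 0 < 1 - a := by linarith
  rw [div_mul_eq_mul_div, div_le_iff₀ h2]
  refine le_trans (mul_le_mul_of_nonneg_right ?_ (by linarith)) h1
  linarith

lemma abs_map_le (h : ChaoticDynamics f f' F F' c k) {a b x : ℝ} {l : ℕ} (ha1 : a ≤ 1)
    (hab : f l a ≤ b) (hx : |x| ≤ a) : |f l x| ≤ b := by
  have h1 := (h.series l).nonnegSeries.abs_le (abs_le.1 (hx.trans ha1))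
  have h2 := (h.series l).nonnegSeries.mono (abs_nonneg x) hx ha1
  linarith

lemma exists_constants (h : ChaoticDynamics f f' F F' c k) :
    ∃ (c₁ c₀ b κ : ℝ) (N : ℕ), 0 < c₁ ∧ c₁ < c₀ ∧ c₀ < 1 ∧ F c₁ = c₁ ∧ b < c₀ ∧ F' c₀ < κ ∧ κ < 1 ∧
      ∀ l, N ≤ l → f l c₀ ≤ b ∧ f' l c₀ ≤ κ := by
  obtain ⟨c₁, c₀, h1, h2, h3, h4, h5, h6⟩ :=
    h.limit_series.exists_contraction h.limit_one h.limit_zero h.slope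
  obtain ⟨b, hb, hb0⟩ := exists_between h5
  obtain ⟨κ, hκ, hκ1⟩ := exists_between h6
  obtain ⟨N, hN⟩ := eventually_atTop.1
    (((h.tendsto_map c₀).eventually_le_const hb).and
      ((h.tendsto_deriv (fun _ => c₀) c₀ tendsto_const_nhds).eventually_le_const hκ))
  exact ⟨c₁, c₀, b, κ, N, h1, h2, h3, h4, hb0, hκ, hκ1, hN⟩

/-- The correlations leave every neighbourhood of `1`. -/
lemma eventually_abs_cor_le (h : ChaoticDynamics f f' F F' c k) {c₀ b : ℝ} {N : ℕ} (h0 : 0 < c₀)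
    (h1 : c₀ < 1) (hb : b < c₀) (hN : ∀ l, N ≤ l → f l c₀ ≤ b)
    {t : ℝ} (ht : t ∈ Set.Ioo (-1 : ℝ) 1) : ∀ᶠ l in atTop, |c l t| ≤ c₀ := by
  have hta : |t| ∈ Set.Ico (0 : ℝ) 1 := ⟨abs_nonneg t, abs_lt.2 ht⟩
  have hle : ∀ l, |c l t| ≤ c l |t| := fun l => (h.cor_series l).abs_le ⟨ht.1.le, ht.2.le⟩
  obtain ⟨l₀, hl₀, hc⟩ : ∃ l₀, N ≤ l₀ ∧ c l₀ |t| ≤ c₀ := by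
    by_contra! hcon
    set lam := (1 - b) / (1 - c₀) with hlam
    have hlam1 : 1 < lam := by rw [hlam, one_lt_div (by linarith)]; linarith
    have hgrow : ∀ n, lam ^ n * (1 - c N |t|) ≤ 1 - c (N + n) |t| := fun n => by
      induction n with
      | zero => simp
      | succ n ih =>
        have h2 := h.escape (l := N + n) h0.le h1 (hN _ (by omega)) (hcon (N + n) (by omega)).le
          (h.cor_lt_one _ hta).le
        rw [← add_assoc, h.cor_succ, pow_succ', mul_assoc]
        exact (mul_le_mul_of_nonneg_left ih (by linarith)).trans h2
    have hpos : 0 < 1 - c N |t| := sub_pos.2 (h.cor_lt_one N hta)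
    obtain ⟨n, hn⟩ := pow_unbounded_of_one_lt (1 / (1 - c N |t|)) hlam1
    rw [div_lt_iff₀ hpos] at hn
    linarith [hgrow n, h.cor_nonneg (N + n) hta]
  filter_upwards [eventually_ge_atTop l₀] with l hl
  refine (hle l).trans ?_
  induction l, hl using Nat.le_induction with
  | base => exact hc
  | succ l hl ih =>
    rw [h.cor_succ]
    have h2 := h.abs_map_le (l := l) h1.le (hN l (hl₀.trans hl))
      (x := c l |t|) (by rwa [abs_of_nonneg (h.cor_nonneg l hta)])
    exact ((le_abs_self _).trans h2).trans hb.le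

lemma tendsto_cor (h : ChaoticDynamics f f' F F' c k) {c₁ c₀ b κ : ℝ} {N : ℕ} (hc₁ : 0 < c₁)
    (h01 : c₁ < c₀) (h1 : c₀ < 1) (hfix : F c₁ = c₁) (hb : b < c₀) (hκ0 : 0 ≤ κ) (hκ : κ < 1)
    (hN : ∀ l, N ≤ l → f l c₀ ≤ b ∧ f' l c₀ ≤ κ) {t : ℝ} (ht : t ∈ Set.Ioo (-1 : ℝ) 1) :
    Tendsto (fun l => c l t) atTop (𝓝 c₁) := by
  have hε : Tendsto (fun l => |f l c₁ - c₁|) atTop (𝓝 0) := by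
    simpa [hfix] using ((h.tendsto_map c₁).sub_const c₁).abs
  rw [tendsto_iff_norm_sub_tendsto_zero]
  refine tendsto_zero_of_le_mul_add (κ := fun _ => κ) (fun l => norm_nonneg _) hκ0 hκ
    (Eventually.of_forall fun _ => le_rfl) hε ?_
  filter_upwards [h.eventually_abs_cor_le (hc₁.trans h01) h1 hb (fun l hl => (hN l hl).1) ht,
    eventually_ge_atTop N] with l hl hlN
  have h2 := (h.series l).abs_sub_le h1.le (by rw [abs_of_pos hc₁]; exact h01.le) hl
  rw [Real.norm_eq_abs, Real.norm_eq_abs, h.cor_succ]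
  have h3 := mul_le_mul_of_nonneg_right (hN l hlN).2 (abs_nonneg (c l t - c₁))
  have h4 := abs_sub_le (f l (c l t)) (f l c₁) c₁
  linarith

/-- While the correlation is close to `1`, the kernel grows at most as fast as the gap between the
correlation and `1`. -/
lemma ker_le (h : ChaoticDynamics f f' F F' c k) {c₀ b κ : ℝ} {N : ℕ} (h0 : 0 < c₀)
    (h1 : c₀ < 1) (hb : b < c₀) (hκ : κ < 1) (hN : ∀ l, N ≤ l → f l c₀ ≤ b ∧ f' l c₀ ≤ κ) :
    ∃ C, ∀ l, N ≤ l → ∀ t ∈ Set.Ico (0 : ℝ) 1, k l t ≤ C / (1 - c N t) := by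
  set lam := (1 - b) / (1 - c₀) with hlam
  have hlam1 : 0 < lam - 1 := by
    rw [hlam, sub_pos, one_lt_div (by linarith)]; linarith
  set E := 1 / (lam - 1) with hE
  have hE0 : 0 < E := one_div_pos.2 hlam1
  have hEl : E * (lam - 1) = 1 := one_div_mul_cancel hlam1.ne'
  set M := k N 1 + E with hM
  have hk1 : 0 ≤ k N 1 := (h.ker_series N).nonneg ⟨zero_le_one, le_rfl⟩
  set M' := max M (1 / (1 - κ)) with hM'
  have hκ' : 0 < 1 - κ := by linarith
  have hMM : M ≤ M' := le_max_left _ _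
  have hM'κ : 1 ≤ M' * (1 - κ) := (div_le_iff₀ hκ').1 (le_max_right _ _)
  refine ⟨M', fun l hl t ht => ?_⟩
  have ht1 : t ≤ 1 := ht.2.le
  have hδ : ∀ l, 0 < 1 - c l t := fun l => sub_pos.2 (h.cor_lt_one l ht)
  have hδ1 : ∀ l, 1 - c l t ≤ 1 := fun l => by linarith [h.cor_nonneg l ht]
  have hkn : ∀ l, 0 ≤ k l t := fun l => (h.ker_series l).nonneg ⟨ht.1, ht1⟩
  have hD := hδ N
  set D := 1 - c N t with hDdef
  have hgap : ∀ l, M * (1 - c l t) / D ≤ M' / D := fun l =>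
    div_le_div_of_nonneg_right (by nlinarith [hδ l, hδ1 l]) hD.le
  have key : (c₀ ≤ c l t ∧ k l t ≤ M * (1 - c l t) / D - E) ∨ (c l t ≤ c₀ ∧ k l t ≤ M' / D) := by
    induction l, hl using Nat.le_induction with
    | base =>
      have hb1 : k N t ≤ M * (1 - c N t) / D - E := by
        rw [← hDdef, mul_div_assoc, div_self hD.ne', mul_one, hM, add_sub_cancel_right]
        exact (h.ker_series N).mono ht.1 ht1 le_rfl
      rcases le_total c₀ (c N t) with hc | hc
      · exact Or.inl ⟨hc, hb1⟩
      · exact Or.inr ⟨hc, by linarith [hgap N]⟩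
    | succ l hl ih =>
      obtain ⟨hNb, hNκ⟩ := hN l hl
      rcases ih with ⟨hc, hk⟩ | ⟨hc, hk⟩
      · have hesc := h.escape (l := l) h0.le h1 hNb hc (h.cor_lt_one l ht).le
        rw [← hlam, ← h.cor_succ] at hesc
        have hslope := (h.series l).mul_sub_le (h.cor_nonneg l ht) (h.cor_lt_one l ht).le le_rfl
        rw [h.map_one, ← h.cor_succ] at hslope
        have hf'0 : 0 ≤ f' l (c l t) := (h.series l).nonneg_deriv.nonneg
          ⟨h.cor_nonneg l ht, (h.cor_lt_one l ht).le⟩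
        have hstep : k (l + 1) t ≤ M * (1 - c (l + 1) t) / D - E := by
          have e1 : f' l (c l t) ≤ (1 - c (l + 1) t) / (1 - c l t) := by
            rwa [le_div_iff₀ (hδ l)]
          have e2 : lam ≤ (1 - c (l + 1) t) / (1 - c l t) := by
            rwa [le_div_iff₀ (hδ l)]
          have e3 : c (l + 1) t ≤ 1 := (h.cor_lt_one _ ht).le
          rw [h.ker_succ]
          set ρ := (1 - c (l + 1) t) / (1 - c l t) with hρ
          have e4 : ρ * (M * (1 - c l t) / D - E) = M * (1 - c (l + 1) t) / D - ρ * E := by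
            rw [hρ]
            have := (hδ l).ne'
            field_simp
          have e5 : f' l (c l t) * k l t ≤ ρ * (M * (1 - c l t) / D - E) :=
            mul_le_mul e1 hk (hkn l) (hf'0.trans e1)
          nlinarith
        rcases le_total c₀ (c (l + 1) t) with hc' | hc'
        · exact Or.inl ⟨hc', hstep⟩
        · exact Or.inr ⟨hc', by linarith [hgap (l + 1)]⟩
      · have hc' : |c l t| ≤ c₀ := by rwa [abs_of_nonneg (h.cor_nonneg l ht)]
        have h2 := (le_abs_self _).trans (h.abs_map_le (l := l) h1.le hNb hc')
        rw [← h.cor_succ] at h2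
        refine Or.inr ⟨h2.trans hb.le, ?_⟩
        have h3 := ((h.series l).nonneg_deriv.mono (h.cor_nonneg l ht) hc h1.le).trans hNκ
        have hf'0 : 0 ≤ f' l (c l t) := (h.series l).nonneg_deriv.nonneg
          ⟨h.cor_nonneg l ht, (h.cor_lt_one l ht).le⟩
        have h4 : f' l (c l t) * k l t ≤ κ * (M' / D) :=
          mul_le_mul h3 hk (hkn l) (hf'0.trans h3)
        have h5 : M' * (1 - κ) ≤ M' / D * (1 - κ) := by
          refine mul_le_mul_of_nonneg_right ?_ hκ'.le
          rw [le_div_iff₀ hD]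
          nlinarith [hδ1 N]
        rw [h.ker_succ]
        nlinarith [(h.cor_lt_one (l + 1) ht).le]
  rcases key with ⟨-, hk⟩ | ⟨-, hk⟩
  · linarith [hgap l]
  · exact hk

lemma converges_dominated (h : ChaoticDynamics f f' F F' c k) :
    ∃ a C : ℝ, 0 < a ∧
      (∀ᶠ l in atTop, ∀ t ∈ Set.Ioo (-1 : ℝ) 1, |k l t| ≤ C * (1 - t ^ 2) ^ (-1 : ℝ)) ∧
      ∀ t ∈ Set.Ioo (-1 : ℝ) 1, Tendsto (fun l => k l t) atTop (𝓝 a) := by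
  obtain ⟨c₁, c₀, b, κ, N, h0, h01, h1, hfix, hb, hκF, hκ, hN⟩ := h.exists_constants
  have hF'0 : 0 ≤ F' c₁ := h.limit_series.nonneg_deriv.nonneg ⟨h0.le, by linarith⟩
  have hF'1 : F' c₁ ≤ F' c₀ := h.limit_series.nonneg_deriv.mono h0.le h01.le h1.le
  obtain ⟨C, hC⟩ := h.ker_le (h0.trans h01) h1 hb hκ hN
  obtain ⟨ρ, hρ, hgap⟩ := h.cor_gap N
  refine ⟨c₁ / (1 - F' c₁), 2 * C / ρ, div_pos h0 (by linarith), ?_, fun t ht => ?_⟩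
  · filter_upwards [eventually_ge_atTop N] with l hl t ht
    have hta : |t| ∈ Set.Ico (0 : ℝ) 1 := ⟨abs_nonneg t, abs_lt.2 ht⟩
    have hp2 : 0 < 1 - t ^ 2 := by nlinarith [ht.1, ht.2]
    have hcN : 0 < 1 - c N |t| := sub_pos.2 (h.cor_lt_one N hta)
    have h2 := hC l hl |t| hta
    have h3 := hgap |t| ⟨by linarith [hta.1], hta.2.le⟩
    have h4 : 0 ≤ k l |t| := (h.ker_series l).nonneg ⟨hta.1, hta.2.le⟩
    have hC0 : 0 ≤ C := by
      rw [le_div_iff₀ hcN] at h2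
      exact (mul_nonneg h4 hcN.le).trans h2
    have h5 : 1 - t ^ 2 ≤ 2 * (1 - |t|) := by nlinarith [sq_abs t, hta.1, hta.2]
    refine ((h.ker_series l).abs_le ⟨ht.1.le, ht.2.le⟩).trans (h2.trans ?_)
    rw [Real.rpow_neg_one, ← div_eq_mul_inv, div_div]
    rw [div_le_div_iff₀ hcN (mul_pos hρ hp2)]
    have h6 : ρ * (1 - t ^ 2) ≤ 2 * (1 - c N |t|) := by nlinarith
    nlinarith
  · have hcor := h.tendsto_cor h0 h01 h1 hfix hb ((hF'0.trans hF'1).trans hκF.le) hκ hN ht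
    exact tendsto_of_linear_recursion (h.tendsto_deriv _ _ hcor)
      (by rw [abs_of_nonneg hF'0]; linarith)
      (hcor.comp (tendsto_add_atTop_nat 1)) fun l => h.ker_succ l t

end ChaoticDynamics

end

lemma Chaotic.convergesDominated_tanh {d : ℕ} {σb σw : ℝ} (hd : 4 ≤ d) (hσb : 0 < σb) (hσw : 0 < σw)
    (h : Chaotic .tanh σb σw) : ConvergesDominated d (ntkFun d .tanh 0 σb σw) := by
  have hd2 : 2 ≤ d := by omega
  have hvp := covFun_one_pos (d := d) (φ := .tanh) (s := 0) (σb := σb) hd2 le_rfl hσw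
  obtain ⟨q, hq, hχ⟩ := h _ (hvp 0)
  have hfix := limitVariance_tanh hd2 hσw hq
  have hv := hq.tendsto_covFun hd2 hσw
  have hv' := hv.comp (tendsto_add_atTop_nat 1)
  have hq0 := hq.1
  set v : ℕ → ℝ := fun l => covFun d .tanh 0 σb σw l 1 with hvdef
  have hv1 : ∀ l, v (l + 1) = σb ^ 2 + σw ^ 2 * dual (Activation.fn .tanh) (v l) 1 := fun l => by
    simp only [hvdef]
    rw [covFun_succ_one hd2 le_rfl hσw]; ring
  have dyn : ChaoticDynamics
      (fun l c => σb ^ 2 / v (l + 1) + σw ^ 2 / v (l + 1) * dual (Activation.fn .tanh) (v l) c)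
      (fun l c => σw ^ 2 / v (l + 1) * (v l * dual (Activation.dfn .tanh) (v l) c))
      (fun c => σb ^ 2 / q + σw ^ 2 / q * dual (Activation.fn .tanh) q c)
      (fun c => σw ^ 2 / q * (q * dual (Activation.dfn .tanh) q c))
      (corFun d .tanh 0 σb σw) (fun l t => ntkFun d .tanh 0 σb σw l t / v l) :=
    { series := fun l => (seriesDerivTwo_tanh (hvp l).le).seriesDeriv.affine
        (div_nonneg (sq_nonneg _) (hvp _).le) (div_nonneg (sq_nonneg _) (hvp _).le)
      limit_series := (seriesDerivTwo_tanh hq0.le).seriesDeriv.affine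
        (div_nonneg (sq_nonneg _) hq0.le) (div_nonneg (sq_nonneg _) hq0.le)
      map_one := fun l => by
        have := (hvp (l + 1)).ne'
        have e := hv1 l
        rw [div_mul_eq_mul_div, ← add_div, ← e]
        exact div_self this
      limit_one := by
        rw [varianceMap_eq] at hfix
        rw [div_mul_eq_mul_div, ← add_div, hfix]
        exact div_self hq0.ne'
      limit_zero := by
        rw [dual_tanh_zero, mul_zero, add_zero]
        positivity
      slope := by
        rw [chi_eq] at hχ
        refine hχ.trans_le (le_of_eq ?_)
        field_simp
      tendsto_map := fun x => (tendsto_const_nhds.div hv' hq0.ne').add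
        ((tendsto_const_nhds.div hv' hq0.ne').mul
          (tendsto_of_continuous_prod continuous_dual_tanh hv tendsto_const_nhds))
      tendsto_deriv := fun x y hx => (tendsto_const_nhds.div hv' hq0.ne').mul
          (hv.mul (tendsto_of_continuous_prod continuous_dual_tanh_dfn hv hx))
      cor_series := nonnegSeries_corFun hd2 le_rfl hσw
      cor_succ := fun l t => by
        rw [corFun, covFun_succ hd2 le_rfl hσw]
        ring
      cor_gap := fun l => by
        obtain ⟨κ, hκ, hg⟩ := exists_mul_one_sub_le_gap (φ := .tanh) (σb := σb) hd2 le_rfl hσw l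
        refine ⟨κ / v l, div_pos hκ (hvp l), fun t ht => ?_⟩
        have h1 := hg t ht
        rw [← mul_one_sub_corFun hd2 le_rfl hσw] at h1
        rw [div_mul_eq_mul_div, div_le_iff₀ (hvp l), mul_comm _ (v l)]
        exact h1
      ker_series := fun l => (nonnegSeries_ntkFun hd2 le_rfl hσw l).div_const (hvp l).le
      ker_succ := fun l t => by
        have h1 := (hvp l).ne'
        have h2 : v l ≠ 0 := h1
        rw [ntkFun_succ_plain hd2 hσw, corFun, corFun]
        simp only [hvdef] at h2 ⊢
        field_simp }
  obtain ⟨a, C, ha, hbd, hlim⟩ := dyn.converges_dominated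
  have hd' : (4 : ℝ) ≤ d := by exact_mod_cast hd
  refine ⟨q * a, (q + 1) * C, 1, mul_pos hq0 ha, by linarith, ?_, fun t ht => ?_⟩
  · filter_upwards [hbd, hv.eventually_le_const (lt_add_one q)] with l hl hvl t ht
    have h1 := hl t ht
    have h2 : v l ≠ 0 := (hvp l).ne'
    have e : ntkFun d .tanh 0 σb σw l t = v l * (ntkFun d .tanh 0 σb σw l t / v l) := by
      field_simp
    rw [e, abs_mul, abs_of_pos (hvp l), mul_assoc]
    exact mul_le_mul hvl h1 (abs_nonneg _) (by linarith)
  · refine (hv.mul (hlim t ht)).congr fun l => ?_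
    have h2 : v l ≠ 0 := (hvp l).ne'
    field_simp

/-! ### The limiting kernels as functions of the inner product -/

lemma ConvergesDominated.tendsto_funkHecke {d : ℕ} (hd : 2 ≤ d) {g : ℕ → ℝ → ℝ}
    (h : ConvergesDominated d g) (hg : ∀ l, ContinuousOn (g l) (Set.Icc (-1) 1)) :
    ∃ a, 0 < a ∧ ∀ k, Tendsto (fun l => funkHecke d (g l) k) atTop (𝓝 (if k = 0 then a else 0)) := by
  obtain ⟨a, C, e, ha, he, hbd, hlim⟩ := h
  exact ⟨a, ha, DeepNTK.tendsto_funkHecke hd (Eventually.of_forall hg) hlim hbd he⟩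

/-- The kernel `κ^{l+1}` on the unit sphere as a function of the inner product. -/
def Model.zonal (d : ℕ) (σb σw : ℝ) (l : ℕ) (t : ℝ) : Model → ℝ
  | .plain φ => ntkFun d φ 0 σb σw l t
  | .average φ => ntkFun d φ 0 σb σw l t / ((l : ℝ) + 1)
  | .resnet => ntkFun d .relu 1 σb σw l t / (((l : ℝ) + 1) * (1 + σw ^ 2 / 2) ^ l)

section

variable {d : ℕ} {σb σw : ℝ} (m : Model)

lemma Model.nonnegSeries_zonal (hd : 2 ≤ d) (hσw : 0 < σw) (l : ℕ) :
    NonnegSeries fun t => m.zonal d σb σw l t := by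
  cases m with
  | plain φ => exact nonnegSeries_ntkFun hd le_rfl hσw l
  | average φ => exact (nonnegSeries_ntkFun hd le_rfl hσw l).div_const (by positivity)
  | resnet => exact (nonnegSeries_ntkFun hd zero_le_one hσw l).div_const (by positivity)

lemma Model.kernel_eq_zonal (l : ℕ) (x x' : USphere (Fin d)) :
    m.kernel d σb σw (l + 1) x x' = m.zonal d σb σw l (inner ℝ x.1 x'.1) := by
  cases m with
  | plain φ => exact ffnnNTK_eq l x x'
  | average φ => simp only [Model.kernel, Model.zonal, ffnnNTK_eq, Nat.cast_succ]
  | resnet => simp only [Model.kernel, Model.zonal, resNTK_eq, Nat.cast_succ, Nat.add_sub_cancel]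

lemma Model.convKernel_eq_zonal {n₀ M r : ℕ} [NeZero M] (hd : n₀ * M = d) (hd2 : 2 ≤ d)
    {S : Set (ConvInput n₀ M)} (hS : LocationFree n₀ M r σb σw S) (l : ℕ)
    (x x' : USphere (Fin n₀ × ZMod M)) (hx : x.1 ∈ S) (hx' : x'.1 ∈ S) (α α' : ZMod M) :
    m.convKernel n₀ M r σb σw (l + 1) (x.1, α) (x'.1, α') =
      m.zonal d σb σw l (inner ℝ x.1 x'.1) := by
  cases m with
  | plain φ => exact cnnNTK_eq hd hd2 φ hS l x x' hx hx' α α'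
  | average φ =>
    simp only [Model.convKernel, Model.zonal, cnnNTK_eq hd hd2 φ hS l x x' hx hx' α α',
      Nat.cast_succ]
  | resnet =>
    simp only [Model.convKernel, Model.zonal, convResNTK_eq hd hd2 hS l x x' hx hx' α α',
      Nat.cast_succ, Nat.add_sub_cancel]

lemma Model.Admissible.convergesDominated {m : Model} (hm : m.Admissible σb σw) (hd : 2 ≤ d)
    (hσw : 0 < σw) (hch : ∀ φ, m = .plain φ → Chaotic φ σb σw → 0 < σb ∧ 4 ≤ d) :
    ConvergesDominated d fun l t => m.zonal d σb σw l t := by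
  match m, hm with
  | .plain φ, .inl h => exact h.convergesDominated hd hσw
  | .plain .relu, .inr h => exact absurd h (not_chaotic_relu hd hσw)
  | .plain .tanh, .inr h =>
    obtain ⟨hσb, hd4⟩ := hch _ rfl h
    exact h.convergesDominated_tanh hd4 hσb hσw
  | .average .relu, h => exact EdgeOfChaos.convergesDominated_relu hd hσw h
  | .average .tanh, h => exact EdgeOfChaos.convergesDominated_tanh hd hσw h
  | .resnet, _ => exact convergesDominated_resnet hd hσw

lemma IsHarmonicBasis.hasSum_funkHecke {ι : Type} [Fintype ι] [Nonempty ι]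
    {Y : (k : ℕ) → Fin (numHarmonics ι k) → USphere ι → ℝ} (hY : IsHarmonicBasis ι Y)
    (hι : Fintype.card ι = d) (hd : 2 ≤ d) {g : ℝ → ℝ} (hg : NonnegSeries g) (x y : USphere ι) :
    HasSum (fun k => funkHecke d g k * ∑ j, Y k j x * Y k j y) (g (inner ℝ x.1 y.1)) := by
  obtain ⟨b, hb, hs, H⟩ := hg
  subst hι
  simp only [funkHecke_series hd hb hs H]
  exact hY.hasSum_series hd hb hs H x y

lemma integral_zonal_mul_harmonic (hd : 2 ≤ d) {g : ℝ → ℝ} (hg : NonnegSeries g) {k : ℕ}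
    {Y : USphere (Fin d) → ℝ} (hY : Y ∈ sphericalHarmonics (Fin d) k) (x : USphere (Fin d)) :
    ∫ w : USphere (Fin d), g (inner ℝ x.1 w.1) * Y w ∂(uniformSphere (Fin d)) =
      funkHecke d g k * Y x := by
  obtain ⟨b, hb, hs, H⟩ := hg
  have : Nonempty (Fin d) := ⟨⟨0, by omega⟩⟩
  rw [funkHecke_series hd hb hs H]
  have h := integral_series_mul (by rwa [Fintype.card_fin]) hb hs H hY x
  rwa [Fintype.card_fin] at h

end

end DeepNTK

end

theorem theorem3 (d : ℕ) (hd : 2 ≤ d) (σb σw : ℝ) (hσb : 0 ≤ σb) (hσw : 0 < σw)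
    (m : DeepNTK.Model) (hm : m.Admissible σb σw) :
    -- orthonormal bases of spherical harmonics exist
    (∃ Y, DeepNTK.IsHarmonicBasis (Fin d) Y) ∧
    ∃ (g : ℕ → ℝ → ℝ) (μ : ℕ → ℕ → ℝ),
      -- the eigenvalues are given by the Funk–Hecke formula
      (∀ L, 1 ≤ L → ContinuousOn (g L) (Set.Icc (-1) 1)) ∧
      (∀ L, 1 ≤ L → ∀ k, μ L k = DeepNTK.funkHecke d (g L) k) ∧
      -- fully connected layers: zonal kernel, diagonalized by the spherical harmonics
      (∀ L, 1 ≤ L → ∀ x x' : DeepNTK.USphere (Fin d),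
        m.kernel d σb σw L x x' =
          g L (inner ℝ (x : EuclideanSpace ℝ (Fin d)) (x' : EuclideanSpace ℝ (Fin d)))) ∧
      (∀ L, 1 ≤ L → ∀ k, ∀ Y ∈ DeepNTK.sphericalHarmonics (Fin d) k,
        ∀ x : DeepNTK.USphere (Fin d),
          ∫ w : DeepNTK.USphere (Fin d), m.kernel d σb σw L x w * Y w
            ∂(DeepNTK.uniformSphere (Fin d)) = μ L k * Y x) ∧
      (∀ L, 1 ≤ L → ∀ Y, DeepNTK.IsHarmonicBasis (Fin d) Y →
        ∀ x x' : DeepNTK.USphere (Fin d),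
          HasSum (fun k => μ L k * ∑ j, Y k j x * Y k j x') (m.kernel d σb σw L x x')) ∧
      -- convolutional layers, on data sets whose first layer covariance is location free
      (∀ (n₀ M r : ℕ) [NeZero M], n₀ * M = d →
        ∀ S : Set (DeepNTK.ConvInput n₀ M), DeepNTK.LocationFree n₀ M r σb σw S →
        ∀ L, 1 ≤ L → ∀ x x' : DeepNTK.USphere (Fin n₀ × ZMod M), x.1 ∈ S → x'.1 ∈ S →
        ∀ α α' : ZMod M,
          m.convKernel n₀ M r σb σw L (x.1, α) (x'.1, α') = g L (inner ℝ x.1 x'.1) ∧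
          ∀ Y, DeepNTK.IsHarmonicBasis (Fin n₀ × ZMod M) Y →
            HasSum (fun k => μ L k * ∑ j, Y k j x * Y k j x')
              (m.convKernel n₀ M r σb σw L (x.1, α) (x'.1, α'))) ∧
      -- behaviour of the eigenvalues as the depth tends to infinity
      -- (in the chaotic phase: with nonzero bias variance and in dimension at least four)
      ((∀ φ, m = DeepNTK.Model.plain φ → DeepNTK.Chaotic φ σb σw → 0 < σb ∧ 4 ≤ d) →
        (∃ μ₀ : ℝ, 0 < μ₀ ∧ Tendsto (fun L => μ L 0) atTop (𝓝 μ₀)) ∧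
        (∀ k, 1 ≤ k → Tendsto (fun L => μ L k) atTop (𝓝 0))) := by
  have hNe : Nonempty (Fin d) := ⟨⟨0, by omega⟩⟩
  have hser := fun l => m.nonnegSeries_zonal (σb := σb) hd hσw l
  refine ⟨DeepNTK.exists_isHarmonicBasis (Fin d), fun L t => m.zonal d σb σw (L - 1) t,
    fun L k => DeepNTK.funkHecke d (fun t => m.zonal d σb σw (L - 1) t) k,
    fun L _ => (hser _).continuousOn, fun _ _ _ => rfl, ?_, ?_, ?_, ?_, ?_⟩
  · rintro (_ | l) hL x x'
    · omega
    · exact m.kernel_eq_zonal l x x'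
  · rintro (_ | l) hL k Y hY x
    · omega
    · simp only [m.kernel_eq_zonal]
      exact DeepNTK.integral_zonal_mul_harmonic hd (hser l) hY x
  · rintro (_ | l) hL Y hY x x'
    · omega
    · rw [m.kernel_eq_zonal]
      exact hY.hasSum_funkHecke (Fintype.card_fin d) hd (hser l) x x'
  · rintro n₀ M r _ hnM S hS (_ | l) hL x x' hx hx' α α'
    · omega
    · rw [m.convKernel_eq_zonal hnM hd hS l x x' hx hx' α α']
      have hcard : Fintype.card (Fin n₀ × ZMod M) = d := by
        rw [Fintype.card_prod, Fintype.card_fin, ZMod.card, hnM]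
      have : Nonempty (Fin n₀ × ZMod M) := Fintype.card_pos_iff.1 (by omega)
      exact ⟨rfl, fun Y hY => hY.hasSum_funkHecke hcard hd (hser l) x x'⟩
  · intro hch
    obtain ⟨a, ha, hlim⟩ := (hm.convergesDominated hd hσw hch).tendsto_funkHecke hd
      fun l => (hser l).continuousOn
    refine ⟨⟨a, ha, (tendsto_add_atTop_iff_nat 1).1 (hlim 0)⟩, fun k hk => ?_⟩
    have h := hlim k
    rw [if_neg (by omega)] at h
    exact (tendsto_add_atTop_iff_nat 1).1 h
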